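/- **Setting.** Let $S,A$ be finite non-empty sets, $H\ge 1$, $P=\{P_h(\cdot\mid s,a)\}_{h=1}^H$ a time-inhomogeneous transition kernel on $S$, and $\rho$ an initial state distribution known to the learner. A trajectory $(s_1,a_1,\dots,s_H,a_H,s_{H+1})$ of a Markov policy $\pi$ has $s_1\sim\rho$, $a_h\sim\pi_h(\cdot\mid s_h)$, $s_{h+1}\sim P_h(\cdot\mid s_h,a_h)$. For a reward function $r=(r_h)_{h\le H}$, $r_h:S\times A\to[0,1]$, let $V_1^\pi(s)=\mathbb E_{\pi,P}[\sum_{h=1}^H r_h(s_h,a_h)\mid s_1=s]$ and $V_1^\star(s)=\sup_\pi V_1^\pi(s)$. For $\epsilon>0$ and $\delta\in(0,1)$ put $$\ell_0=\ln\frac{|S||A|H}{\delta\min\{\epsilon,1\}},\qquad \ell=\kappa\,\ell_0,$$ where $\kappa,c_\omega,c_f,C>0$ are universal constants. The learner observes no rewards while it interacts with the environment, and runs three phases. **1. Exploration.** Let $c=4|S|H^2\ell$, $\omega=c_\omega\epsilon/(|S||A|H^2\ell^2)$, $T=\lceil 2c/\omega\rceil$, and $\eta=\sqrt{4H\ln(|S||A|)/(BG)}$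 with $B=1/c$, $G=4|S||A|H\ln T$. Start from $\mu^1_h(s,a,s')=1/(|S|^2|A|)$. In episode $t=1,\dots,T$ play $\pi^t_h(a\mid s)=\sum_{s'}\mu^t_h(s,a,s')/\sum_{a',s'}\mu^t_h(s,a',s')$ (uniform if the denominator vanishes). Let $\lambda^t_h(s,a)=1/(c+n^{t-1}_h(s,a))$, where $n^{t}_h$ counts visits in episodes $1,\dots,t$; let $\hat P^t_h(s'\mid s,a)=n^t_h(s,a,s')/\max\{1,n^t_h(s,a)\}$ and $$\mu^{t+1}\in\arg\max_{\mu\in\Lambda^t}\Big\{\eta\sum_{h,s,a,s'}\mu_h(s,a,s')\lambda^t_h(s,a)-D(\mu\,\|\,\mu^t)\Big\},\quad D(\mu\|\nu)=\sum\mu\ln\frac{\mu}{\nu}-\sum\mu+\sum\nu,$$ where $\Lambda^t$ is the set of $\mu\ge0$ with $\sum_{s,a,s'}\mu_h(s,a,s')=1$ for all $h$, $\sum_{a,s'}\mu_1(s,a,s')=\rho(s)$, $\sum_{x,a}\mu_h(x,a,s)=\sum_{a,s'}\mu_{h+1}(s,a,s')$ for $h<H$, and $|\mu_h(s,a,s')-\hat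 P^t_h(s'\mid s,a)m|\le e^t_h(s'\mid s,a)\,m$, with $m=\sum_{x}\mu_h(s,a,x)$ and $$e^t_h(s'\mid s,a)=2\sqrt{\frac{\hat P^t_h(s'\mid s,a)\,\ell}{\max\{n^t_h(s,a),1\}}}+\frac{14\,\ell}{3\max\{n^t_h(s,a),1\}}.$$ The exploration policy $\pi_{\exp}=\frac1T\sum_{t}\pi^t$ is the mixture that, for each trajectory, draws $t\in\{1,\dots,T\}$ uniformly and plays $\pi^t$. **2. Dynamics estimation.** Sample $N$ independent trajectories from $\pi_{\exp}$, with counts $N_h(s,a,s')$ and $N_h(s,a)=\sum_{s'}N_h(s,a,s')$, and set $\hat P_h(s'\mid s,a)=N_h(s,a,s')/\max\{1,N_h(s,a)\}$. **3. Policy estimation.** Given a reward function $r$, let $\hat V_{H+1}=0$ and, for $h=H,\dots,1$, $$b_h(s,a)=\min\Big\{\sqrt{\tfrac{c_f|S|\ell}{N_h(s,a)}\operatorname{Var}_{\hat P_h(\cdot\mid s,a)}(\hat V_{h+1})}+c_f|S|H\tfrac{\ell}{N_h(s,a)},\;H\Big\}\quad(b_h(s,a)=H\text{ if }N_h(s,a)=0),$$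 $$\hat Q_h(s,a)=\max\Big\{r_h(s,a)+\sum_{s'}\hat P_h(s'\mid s,a)\hat V_{h+1}(s')-b_h(s,a),\,0\Big\},\quad \hat V_h(s)=\max_a\hat Q_h(s,a),\quad \hat\pi_h(s)\in\arg\max_a\hat Q_h(s,a).$$ **Theorem (Reward-Free guarantee).** The universal constants $\kappa,c_\omega,c_f,C>0$ can be chosen such that, for all $S,A,H,\rho,P$, all $\epsilon>0$, $\delta\in(0,1)$, and every integer $$N\ge C\,\frac{|S|^2|A|H^3\ell_0^3}{\epsilon^2},$$ with probability at least $1-\delta$ over the two sampling phases, simultaneously for every reward function $r$ with values in $[0,1]$ (and however ties in the $\arg\max$ are broken) the returned policy satisfies $$\mathbb E_{s\sim\rho}\big[V_1^\star(s)-V_1^{\hat\pi}(s)\big]\le\epsilon .$$ -/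

import Mathlib

open scoped BigOperators

noncomputable section

namespace RewardFree

section MDP

variable {S A : Type*} [Fintype S] [Fintype A] [DecidableEq S] [DecidableEq A] {H : ℕ}

/-- A trajectory `(s_1, a_1, …, s_H, a_H, s_{H+1})`: `H + 1` states and `H` actions.
Step `h` (with value `0, …, H - 1`) stands for the mathematical step `h + 1`. -/
abbrev Traj (S A : Type*) (H : ℕ) : Type _ := (Fin (H + 1) → S) × (Fin H → A)

/-- State visited at step `h`. -/
def Traj.state (z : Traj S A H) (h : Fin H) : S := z.1 h.castSucc

/-- Action played at step `h`. -/
def Traj.action (z : Traj S A H) (h : Fin H) : A := z.2 h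

/-- State reached after step `h`. -/
def Traj.next (z : Traj S A H) (h : Fin H) : S := z.1 h.succ

/-- `P` is a time-inhomogeneous transition kernel. -/
def IsKernel (P : Fin H → S → A → S → ℝ) : Prop := ∀ h s a, P h s a ∈ stdSimplex ℝ S

/-- `π` is a (randomized) Markov policy. -/
def IsPolicy (π : Fin H → S → A → ℝ) : Prop := ∀ h s, π h s ∈ stdSimplex ℝ A

/-- The Markov policy that plays the action `f h s` in state `s` at step `h`. -/
def detPolicy (f : Fin H → S → A) : Fin H → S → A → ℝ := fun h s => Pi.single (f h s) 1

/-- Probability of the trajectory `z` when the initial state is drawn from `ρ`, the policy is `π`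
and the transition kernel is `P`. -/
def trajProb (ρ : S → ℝ) (P : Fin H → S → A → S → ℝ) (π : Fin H → S → A → ℝ)
    (z : Traj S A H) : ℝ :=
  ρ (z.1 0) * ∏ h : Fin H,
    π h (z.state h) (z.action h) * P h (z.state h) (z.action h) (z.next h)

/-- The value `V_1^π(s)`: expected total reward of `π` from the initial state `s`. -/
def value (P : Fin H → S → A → S → ℝ) (r : Fin H → S → A → ℝ) (π : Fin H → S → A → ℝ)
    (s : S) : ℝ :=
  ∑ z : Traj S A H, trajProb (Pi.single s 1) P π z * ∑ h : Fin H, r h (z.state h) (z.action h)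

/-- The optimal value `V_1^⋆(s)`: supremum of `V_1^π(s)` over all Markov policies `π`. -/
def optValue (P : Fin H → S → A → S → ℝ) (r : Fin H → S → A → ℝ) (s : S) : ℝ :=
  ⨆ π : {π : Fin H → S → A → ℝ // IsPolicy π}, value P r π.1 s

/-! ### Empirical counts -/

/-- `N_h(s, a, s')` in the first `t` trajectories of `D`. -/
def transCount {K : ℕ} (D : Fin K → Traj S A H) (t : ℕ) (h : Fin H) (s : S) (a : A) (s' : S) : ℕ :=
  (Finset.univ.filter fun i : Fin K =>
    (i : ℕ) < t ∧ (D i).state h = s ∧ (D i).action h = a ∧ (D i).next h = s').card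

/-- `N_h(s, a)` in the first `t` trajectories of `D`. -/
def visitCount {K : ℕ} (D : Fin K → Traj S A H) (t : ℕ) (h : Fin H) (s : S) (a : A) : ℕ :=
  ∑ s', transCount D t h s a s'

/-- The empirical kernel `N_h(s, a, s') / max {1, N_h(s, a)}` of the first `t` trajectories. -/
def empKernel {K : ℕ} (D : Fin K → Traj S A H) (t : ℕ) (h : Fin H) (s : S) (a : A) (s' : S) : ℝ :=
  (transCount D t h s a s' : ℝ) / max 1 (visitCount D t h s a : ℝ)

/-! ### The online algorithm (mirror ascent over occupancy measures `μ_h(s, a, s')`) -/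

/-- Bernstein confidence radius after `t` trajectories, with logarithmic factor `ℓ`. -/
def confRadius {K : ℕ} (ℓ : ℝ) (D : Fin K → Traj S A H) (t : ℕ)
    (h : Fin H) (s : S) (a : A) (s' : S) : ℝ :=
  2 * √(empKernel D t h s a s' * ℓ / max (visitCount D t h s a : ℝ) 1)
    + 14 * ℓ / (3 * max (visitCount D t h s a : ℝ) 1)

/-- Occupancy measures with initial distribution `ρ` whose transitions lie in the confidence set
built from the first `t` trajectories. -/
structure IsConfOccupancy {K : ℕ} (ρ : S → ℝ) (ℓ : ℝ) (D : Fin K → Traj S A H) (t : ℕ)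
    (μ : Fin H → S → A → S → ℝ) : Prop where
  nonneg : ∀ h s a s', 0 ≤ μ h s a s'
  total : ∀ h, ∑ s, ∑ a, ∑ s', μ h s a s' = 1
  init : ∀ h : Fin H, (h : ℕ) = 0 → ∀ s, ∑ a, ∑ s', μ h s a s' = ρ s
  flow : ∀ h h' : Fin H, (h' : ℕ) = h + 1 → ∀ s,
    ∑ x, ∑ a, μ h x a s = ∑ a, ∑ s', μ h' s a s'
  upper : ∀ h s a s',
    μ h s a s' ≤ (empKernel D t h s a s' + confRadius ℓ D t h s a s') * ∑ x, μ h s a x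
  lower : ∀ h s a s',
    (empKernel D t h s a s' - confRadius ℓ D t h s a s') * ∑ x, μ h s a x ≤ μ h s a s'

/-- Bregman divergence of the negative entropy (unnormalized relative entropy). -/
def entropyDiv (μ ν : Fin H → S → A → S → ℝ) : ℝ :=
  (∑ h, ∑ s, ∑ a, ∑ s', μ h s a s' * Real.log (μ h s a s' / ν h s a s'))
    - (∑ h, ∑ s, ∑ a, ∑ s', μ h s a s') + ∑ h, ∑ s, ∑ a, ∑ s', ν h s a s'

/-- The mirror-ascent objective `η ⟨μ, r⟩ - D(μ ‖ ν)`. -/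
def omdObjective (η : ℝ) (r : Fin H → S → A → ℝ) (ν μ : Fin H → S → A → S → ℝ) : ℝ :=
  η * (∑ h, ∑ s, ∑ a, ∑ s', μ h s a s' * r h s a) - entropyDiv μ ν

open Classical in
/-- A maximizer of the mirror-ascent objective over `Λ` (and `ν` itself if there is none). -/
def omdStep (Λ : Set (Fin H → S → A → S → ℝ)) (η : ℝ) (r : Fin H → S → A → ℝ)
    (ν : Fin H → S → A → S → ℝ) : Fin H → S → A → S → ℝ :=
  if hex : ∃ μ ∈ Λ, IsMaxOn (omdObjective η r ν) Λ μ then hex.choose else ν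

/-- The intrinsic reward `1 / (c + N_h(s, a))`, with the counts of the first `t` trajectories. -/
def intrinsicReward {K : ℕ} (c : ℝ) (D : Fin K → Traj S A H) (t : ℕ)
    (h : Fin H) (s : S) (a : A) : ℝ :=
  1 / (c + visitCount D t h s a)

/-- The occupancy measures `μ^1, μ^2, …` of the online algorithm: `occIterate … D t` is `μ^{t+1}`,
computed from the first `t` trajectories of `D`. The update that produces `μ^{t+2}` uses the
intrinsic reward of episode `t + 1` (the counts of the first `t` trajectories) and the confidence
set of the first `t + 1` trajectories. -/
def occIterate {K : ℕ} (ρ : S → ℝ) (ℓ c η : ℝ) (D : Fin K → Traj S A H) :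
    ℕ → Fin H → S → A → S → ℝ
  | 0 => fun _ _ _ _ => 1 / ((Fintype.card S : ℝ) ^ 2 * Fintype.card A)
  | t + 1 => omdStep {μ | IsConfOccupancy ρ ℓ D (t + 1) μ} η (intrinsicReward c D t)
      (occIterate ρ ℓ c η D t)

open Classical in
/-- The Markov policy induced by an occupancy measure (uniform in states of measure zero). -/
def inducedPolicy (μ : Fin H → S → A → S → ℝ) (h : Fin H) (s : S) (a : A) : ℝ :=
  if ∑ a', ∑ s', μ h s a' s' = 0 then 1 / (Fintype.card A : ℝ)
  else (∑ s', μ h s a s') / ∑ a', ∑ s', μ h s a' s'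

/-! ### Parameters -/

/-- The logarithm `ln (|S| |A| H / (δ min {ε, 1}))`. -/
def logFactor (S A : Type*) [Fintype S] [Fintype A] (H : ℕ) (ε δ : ℝ) : ℝ :=
  Real.log (Fintype.card S * Fintype.card A * H / (δ * min ε 1))

/-- `c = 4 |S| H² ℓ`. -/
def regConst (S : Type*) [Fintype S] (H : ℕ) (ℓ : ℝ) : ℝ := 4 * Fintype.card S * (H : ℝ) ^ 2 * ℓ

/-- The significance level `ω = c_ω ε / (|S| |A| H² ℓ²)`. -/
def sigLevel (S A : Type*) [Fintype S] [Fintype A] (H : ℕ) (cω ℓ ε : ℝ) : ℝ :=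
  cω * ε / (Fintype.card S * Fintype.card A * (H : ℝ) ^ 2 * ℓ ^ 2)

/-- The number of exploration episodes `T = ⌈2 c / ω⌉`. -/
def numEpisodes (S A : Type*) [Fintype S] [Fintype A] (H : ℕ) (cω ℓ ε : ℝ) : ℕ :=
  ⌈2 * regConst S H ℓ / sigLevel S A H cω ℓ ε⌉₊

/-- The step size `η = √(4 H ln (|S| |A|) / (B G(T)))`, `B = 1 / c`, `G(T) = 4 |S| |A| H ln T`. -/
def stepSize (S A : Type*) [Fintype S] [Fintype A] (H : ℕ) (cω ℓ ε : ℝ) : ℝ :=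
  √(4 * H * Real.log (Fintype.card S * Fintype.card A) /
    (1 / regConst S H ℓ *
      (4 * Fintype.card S * Fintype.card A * H * Real.log (numEpisodes S A H cω ℓ ε))))

/-! ### The law of a run -/

/-- The policy played in exploration episode `t` (`t = 0, …, T - 1`) when `D` lists the exploration
trajectories; it depends on the trajectories `D i` with `i < t` only. -/
def explorePolicy {K : ℕ} (ρ : S → ℝ) (cω ℓ ε : ℝ) (D : Fin K → Traj S A H) (t : ℕ) :
    Fin H → S → A → ℝ :=
  inducedPolicy (occIterate ρ ℓ (regConst S H ℓ) (stepSize S A H cω ℓ ε) D t)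

/-- Joint probability that the exploration phase of `T` episodes produces the trajectories `E` and
that the estimation phase then produces the data set `D` of `N` trajectories. Given `E`, the data
set is i.i.d. from the exploration policy `π_exp`, the uniform mixture of the `T` policies played
(one of them is drawn at the start of each trajectory). -/
def runProb {T N : ℕ} (ρ : S → ℝ) (P : Fin H → S → A → S → ℝ) (cω ℓ ε : ℝ)
    (E : Fin T → Traj S A H) (D : Fin N → Traj S A H) : ℝ :=
  (∏ t : Fin T, trajProb ρ P (explorePolicy ρ cω ℓ ε E t) (E t)) *
    ∏ n : Fin N, 1 / (T : ℝ) * ∑ t : Fin T, trajProb ρ P (explorePolicy ρ cω ℓ ε E t) (D n)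

/-! ### Pessimistic model-based offline reinforcement learning -/

/-- `Var_p(V) = ∑ p V² - (∑ p V)²`. -/
def variance (p V : S → ℝ) : ℝ := ∑ s, p s * V s ^ 2 - (∑ s, p s * V s) ^ 2

/-- The `|S|`-inflated Bernstein penalty `b_h(s, a)`; it equals `H` if `N_h(s, a) = 0`, since the
first argument of the minimum is then infinite. -/
def penalty {N : ℕ} (cf ℓ : ℝ) (D : Fin N → Traj S A H) (V : S → ℝ) (h : Fin H) (s : S) (a : A) :
    ℝ :=
  if visitCount D N h s a = 0 then (H : ℝ)
  else min
    (√(cf * Fintype.card S * ℓ / visitCount D N h s a * variance (empKernel D N h s a) V)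
      + cf * Fintype.card S * H * (ℓ / visitCount D N h s a))
    H

/-- One backup: `max {r_h(s, a) + (P̂_h V)(s, a) - b_h(s, a), 0}`, for `V` the estimate at the next
step. -/
def pessBackup {N : ℕ} (cf ℓ : ℝ) (D : Fin N → Traj S A H) (r : Fin H → S → A → ℝ)
    (h : Fin H) (V : S → ℝ) (s : S) (a : A) : ℝ :=
  max (r h s a + (∑ s', empKernel D N h s a s' * V s') - penalty cf ℓ D V h s a) 0

/-- The pessimistic values `V̂_h`: zero after the last step, and `V̂_h(s) = max_a Q̂_h(s, a)`. -/
def pessV {N : ℕ} (cf ℓ : ℝ) (D : Fin N → Traj S A H) (r : Fin H → S → A → ℝ) :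
    Fin (H + 1) → S → ℝ :=
  Fin.reverseInduction (motive := fun _ => S → ℝ) (fun _ => 0)
    (fun h V s => ⨆ a, pessBackup cf ℓ D r h V s a)

/-- The pessimistic action values `Q̂_h`. -/
def pessQ {N : ℕ} (cf ℓ : ℝ) (D : Fin N → Traj S A H) (r : Fin H → S → A → ℝ)
    (h : Fin H) (s : S) (a : A) : ℝ :=
  pessBackup cf ℓ D r h (pessV cf ℓ D r h.succ) s a

/-- `f` is a possible output of the offline algorithm: `f h s ∈ argmax_a Q̂_h(s, a)`. -/
def IsPessOutput {N : ℕ} (cf ℓ : ℝ) (D : Fin N → Traj S A H) (r : Fin H → S → A → ℝ)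
    (f : Fin H → S → A) : Prop :=
  ∀ h s a, pessQ cf ℓ D r h s a ≤ pessQ cf ℓ D r h s (f h s)

/-- On the data set `D` the offline algorithm returns an `ε`-optimal policy for every reward
function with values in `[0, 1]`, however ties are broken. -/
def Succeeds {N : ℕ} (ρ : S → ℝ) (P : Fin H → S → A → S → ℝ) (cf ℓ ε : ℝ)
    (D : Fin N → Traj S A H) : Prop :=
  ∀ r : Fin H → S → A → ℝ, (∀ h s a, r h s a ∈ Set.Icc (0 : ℝ) 1) →
    ∀ f : Fin H → S → A, IsPessOutput cf ℓ D r f →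
      ∑ s, ρ s * (optValue P r s - value P r (detPolicy f) s) ≤ ε

open Classical in
/-- Probability that a run with `T` exploration episodes and `N` estimation trajectories
succeeds. -/
def successProb (T N : ℕ) (ρ : S → ℝ) (P : Fin H → S → A → S → ℝ) (cω cf ℓ ε : ℝ) : ℝ :=
  ∑ E : Fin T → Traj S A H, ∑ D : Fin N → Traj S A H,
    if Succeeds ρ P cf ℓ ε D then runProb ρ P cω ℓ ε E D else 0

end MDP

end RewardFree

end

/-!
The exploration phase is an online linear optimization problem whose solution forces coverage, and
the offline phase turns coverage into near-optimality for all rewards at once.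

*Coverage.* Mirror ascent with the intrinsic reward `1 / (c + n)` competes, up to a factor two and
an initial divergence `O(H ln (|S| |A|))`, with every feasible point of the confidence sets
(`occIterate_regret`); on the concentration event every occupancy measure `u` of the true kernel is
feasible. What the learner earns under its optimistic measure is at most a constant times what its
policy earns in the true kernel: the optimistic transition probabilities are at most `1 + 1 / H`
times the true ones plus a bonus of order `H ℓ / n`, so that over `H` steps the factor stays below
`e`, and `c = 4 |S| H² ℓ` absorbs the bonus (`confOccupancy_gain_le`). That reward in turn telescopes
to a logarithm, since the visit probabilities are summed against the reciprocals of their own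
partial sums (`sum_div_partial_sum_le`). As intrinsic rewards only decrease, the comparator `u` earns
at least its final reward in every episode, and hence `∑ u / (ω + 2 d) ≤ |S| |A| H ℓ²`, where `d`
is the occupancy measure of the mixture policy (`coverage`).

*Offline phase.* On the concentration event the penalty dominates the error of every one-step
expectation. Hence the estimated values are lower bounds for those of the returned policy
(`pessV_le_reward`), and no occupancy measure `u` beats them by more than twice its total penalty
(`reward_le_pessV`). The total penalty is bounded by coverage and by the sum of the one-step
variances along `u`, which the law of total variance bounds by `O(H²)` up to the total penalty
itself (`sum_variance_le`); with a small weight on the variance the resulting inequality can be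
solved for the total penalty (`totalPenalty_le`). As the optimal value is a supremum taken
separately for each initial state, comparators are mixtures of occupancy measures of policies; this
is why occupancy measures are handled as solutions of the flow equations.

*Concentration.* All events are unions of Chernoff bounds along an adaptive sequence
(`seqProb_tail_union`). The empirical Bernstein bound comes from exponential moments whose parameter
is tuned to the unknown mean, or to each of its possible proxies (`empirical_bernstein`). In the
estimation phase the mean visit counts are known numbers given the exploration data, so that no
union over their values is needed and the confidence level does not depend on `N`.
-/

open scoped BigOperators

noncomputable section

namespace RewardFree

/-! ### Occupancy measures and the law of a trajectory -/

section Occupancy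

variable {S A : Type*} [Fintype S] [Fintype A] {H : ℕ}

lemma sum_rotate {X Y Z : Type*} [Fintype X] [Fintype Y] [Fintype Z] (f : X → Y → Z → ℝ) :
    ∑ x, ∑ y, ∑ z, f x y z = ∑ z, ∑ x, ∑ y, f x y z := by
  rw [Finset.sum_comm (f := fun z x => ∑ y, f x y z)]
  exact Finset.sum_congr rfl fun x _ => Finset.sum_comm

/-- The law of the state at each step when the initial state is drawn from `ρ`, the kernel is `P`
and the policy is `π`. -/
def stateDist (ρ : S → ℝ) (P : Fin H → S → A → S → ℝ) (π : Fin H → S → A → ℝ) :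
    Fin (H + 1) → S → ℝ :=
  Fin.induction (motive := fun _ => S → ℝ) ρ
    (fun h ν s' => ∑ s, ∑ a, ν s * π h s a * P h s a s')

/-- The occupancy measure `d_h(s, a)` of the policy `π`. -/
def occ (ρ : S → ℝ) (P : Fin H → S → A → S → ℝ) (π : Fin H → S → A → ℝ)
    (h : Fin H) (s : S) (a : A) : ℝ :=
  stateDist ρ P π h.castSucc s * π h s a

/-- `μ_h(s, a, s')` is a unit flow through the layers `1, …, H` with initial distribution `ρ`. -/
structure IsFlow (ρ : S → ℝ) (μ : Fin H → S → A → S → ℝ) : Prop where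
  init : ∀ h : Fin H, (h : ℕ) = 0 → ∀ s, ∑ a, ∑ s', μ h s a s' = ρ s
  flow : ∀ h h' : Fin H, (h' : ℕ) = h + 1 → ∀ s,
    ∑ x, ∑ a, μ h x a s = ∑ a, ∑ s', μ h' s a s'

/-- `u_h(s, a)` is an occupancy measure of the kernel `P` with initial distribution `ρ`. Unlike the
occupancy measures of Markov policies with given initial state, these are closed under mixtures by
definition. -/
structure IsOccupancy (ρ : S → ℝ) (P : Fin H → S → A → S → ℝ) (u : Fin H → S → A → ℝ) : Prop where
  nonneg : ∀ h s a, 0 ≤ u h s a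
  isFlow : IsFlow ρ (fun h s a s' => u h s a * P h s a s')

@[simp] lemma stateDist_zero (ρ : S → ℝ) (P : Fin H → S → A → S → ℝ) (π : Fin H → S → A → ℝ) :
    stateDist ρ P π 0 = ρ := rfl

lemma stateDist_succ (ρ : S → ℝ) (P : Fin H → S → A → S → ℝ) (π : Fin H → S → A → ℝ)
    (h : Fin H) (s' : S) :
    stateDist ρ P π h.succ s' = ∑ s, ∑ a, occ ρ P π h s a * P h s a s' := by
  simp only [stateDist, occ, Fin.induction_succ]

lemma stateDist_castSucc (ρ : S → ℝ) (P : Fin (H + 1) → S → A → S → ℝ)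
    (π : Fin (H + 1) → S → A → ℝ) (h : Fin (H + 1)) :
    stateDist ρ P π h.castSucc
      = stateDist ρ (fun h => P h.castSucc) (fun h => π h.castSucc) h := by
  induction h using Fin.induction with
  | zero => rfl
  | succ i ih =>
    funext s'
    rw [← Fin.succ_castSucc, stateDist_succ, stateDist_succ]
    simp only [occ, ih]

lemma sum_traj_succ (F : Traj S A (H + 1) → ℝ) :
    ∑ z, F z = ∑ z : Traj S A H, ∑ a, ∑ s',
      F ((Fin.snoc z.1 s' : Fin (H + 2) → S), (Fin.snoc z.2 a : Fin (H + 1) → A)) := by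
  rw [Fintype.sum_prod_type, Fintype.sum_prod_type,
    ← (Fin.snocEquiv (fun _ : Fin (H + 2) => S)).sum_comp, Fintype.sum_prod_type, Finset.sum_comm]
  refine Finset.sum_congr rfl fun x _ => ?_
  simp_rw [← (Fin.snocEquiv (fun _ : Fin (H + 1) => A)).sum_comp, Fintype.sum_prod_type]
  rw [Finset.sum_comm]
  simp_rw [Finset.sum_comm (s := (Finset.univ : Finset S)) (t := (Finset.univ : Finset (Fin H → A)))]
  rw [Finset.sum_comm]
  refine Finset.sum_congr rfl fun y _ => Finset.sum_congr rfl fun a _ =>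
    Finset.sum_congr rfl fun s' _ => ?_
  rfl

omit [Fintype S] [Fintype A] in
lemma trajProb_snoc (ρ : S → ℝ) (P : Fin (H + 1) → S → A → S → ℝ) (π : Fin (H + 1) → S → A → ℝ)
    (z : Traj S A H) (a : A) (s' : S) :
    trajProb ρ P π ((Fin.snoc z.1 s' : Fin (H + 2) → S), (Fin.snoc z.2 a : Fin (H + 1) → A))
      = trajProb ρ (fun h => P h.castSucc) (fun h => π h.castSucc) z
        * (π (Fin.last H) (z.1 (Fin.last H)) a
          * P (Fin.last H) (z.1 (Fin.last H)) a s') := by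
  simp only [trajProb, Traj.state, Traj.action, Traj.next, Fin.prod_univ_castSucc]
  have h0 : (Fin.snoc z.1 s' : Fin (H + 2) → S) 0 = z.1 0 := by
    have := Fin.snoc_castSucc (α := fun _ => S) s' z.1 0
    exact this
  rw [h0]
  simp only [Fin.snoc_castSucc, Fin.succ_castSucc, Fin.snoc_last, Fin.succ_last]
  ring

lemma sum_trajProb_last (ρ : S → ℝ) : ∀ (H : ℕ) (P : Fin H → S → A → S → ℝ)
    (π : Fin H → S → A → ℝ) (g : S → ℝ),
    ∑ z, trajProb ρ P π z * g (z.1 (Fin.last H)) = ∑ s, stateDist ρ P π (Fin.last H) s * g s := by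
  intro H
  induction H with
  | zero =>
    intro P π g
    rw [Fintype.sum_prod_type]
    simp only [trajProb]
    rw [← (Equiv.funUnique (Fin 1) S).symm.sum_comp]
    simp
  | succ H ih =>
    intro P π g
    rw [sum_traj_succ]
    simp only [trajProb_snoc, Fin.snoc_last]
    have := ih (fun h => P h.castSucc) (fun h => π h.castSucc)
      (fun s => ∑ a, ∑ s', π (Fin.last H) s a * P (Fin.last H) s a s' * g s')
    simp only [Finset.mul_sum] at this
    simp only [mul_assoc] at this ⊢
    rw [this]
    rw [← Fin.succ_last]
    simp_rw [stateDist_succ, occ, stateDist_castSucc, Finset.sum_mul]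
    rw [sum_rotate]
    simp only [mul_assoc]

lemma sum_trajProb_step (ρ : S → ℝ) : ∀ (H : ℕ) (P : Fin H → S → A → S → ℝ)
    (π : Fin H → S → A → ℝ) (_ : IsKernel P) (_ : IsPolicy π) (h : Fin H) (g : S → A → S → ℝ),
    ∑ z : Traj S A H, trajProb ρ P π z * g (z.state h) (z.action h) (z.next h)
      = ∑ s, ∑ a, ∑ s', occ ρ P π h s a * P h s a s' * g s a s' := by
  intro H
  induction H with
  | zero => intro _ _ _ _ h; exact h.elim0
  | succ H ih =>
    intro P π hP hπ h g
    rw [sum_traj_succ]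
    simp only [trajProb_snoc, Traj.state, Traj.action, Traj.next]
    induction h using Fin.lastCases with
    | last =>
      simp only [Fin.snoc_last, Fin.snoc_castSucc, Fin.succ_last]
      have := sum_trajProb_last ρ H (fun h => P h.castSucc) (fun h => π h.castSucc)
        (fun s => ∑ a, ∑ s', π (Fin.last H) s a * P (Fin.last H) s a s' * g s a s')
      simp only [Finset.mul_sum] at this
      simp only [occ, stateDist_castSucc, mul_assoc] at this ⊢
      exact this
    | cast i =>
      simp only [Fin.snoc_castSucc, Fin.succ_castSucc]
      have := ih (fun h => P h.castSucc) (fun h => π h.castSucc) (fun h => hP _) (fun h => hπ _) i g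
      simp only [occ, stateDist_castSucc] at this ⊢
      rw [← this]
      refine Finset.sum_congr rfl fun z _ => ?_
      have h1 : ∑ a, ∑ s', π (Fin.last H) (z.1 (Fin.last H)) a
          * P (Fin.last H) (z.1 (Fin.last H)) a s' = 1 := by
        simp_rw [← Finset.mul_sum, (hP _ _ _).2, mul_one]
        exact (hπ _ _).2
      calc _ = trajProb ρ (fun h => P h.castSucc) (fun h => π h.castSucc) z
          * g (z.state i) (z.action i) (z.next i) * ∑ a, ∑ s', π (Fin.last H) (z.1 (Fin.last H)) a
          * P (Fin.last H) (z.1 (Fin.last H)) a s' := by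
            simp only [Finset.mul_sum, Traj.state, Traj.action, Traj.next]
            exact Finset.sum_congr rfl fun a _ => Finset.sum_congr rfl fun s' _ => by ring
        _ = _ := by rw [h1, mul_one]

lemma trajProb_nonneg {ρ : S → ℝ} (hρ : ∀ s, 0 ≤ ρ s) {P : Fin H → S → A → S → ℝ}
    (hP : IsKernel P) {π : Fin H → S → A → ℝ} (hπ : IsPolicy π) (z : Traj S A H) :
    0 ≤ trajProb ρ P π z :=
  mul_nonneg (hρ _) (Finset.prod_nonneg fun h _ => mul_nonneg ((hπ h _).1 _) ((hP h _ _).1 _))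

lemma stateDist_nonneg {ρ : S → ℝ} (hρ : ∀ s, 0 ≤ ρ s) {P : Fin H → S → A → S → ℝ}
    (hP : IsKernel P) {π : Fin H → S → A → ℝ} (hπ : IsPolicy π) (h : Fin (H + 1)) (s : S) :
    0 ≤ stateDist ρ P π h s := by
  induction h using Fin.induction generalizing s with
  | zero => exact hρ s
  | succ i ih =>
    rw [stateDist_succ]
    exact Finset.sum_nonneg fun x _ => Finset.sum_nonneg fun a _ =>
      mul_nonneg (mul_nonneg (ih x) ((hπ _ _).1 _)) ((hP _ _ _).1 _)

lemma occ_isOccupancy {ρ : S → ℝ} (hρ : ∀ s, 0 ≤ ρ s) {P : Fin H → S → A → S → ℝ}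
    (hP : IsKernel P) {π : Fin H → S → A → ℝ} (hπ : IsPolicy π) :
    IsOccupancy ρ P (occ ρ P π) := by
  have hsum : ∀ (h : Fin H) s, ∑ a, ∑ s', occ ρ P π h s a * P h s a s'
      = stateDist ρ P π h.castSucc s := by
    intro h s
    simp_rw [← Finset.mul_sum, (hP _ _ _).2, mul_one, occ, ← Finset.mul_sum, (hπ _ _).2, mul_one]
  refine ⟨fun h s a => mul_nonneg (stateDist_nonneg hρ hP hπ _ _) ((hπ _ _).1 _), ?_, ?_⟩
  · intro h h0 s
    rw [hsum]
    have : h.castSucc = 0 := Fin.ext h0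
    rw [this, stateDist_zero]
  · intro h h' hh s
    rw [hsum]
    have : h'.castSucc = h.succ := Fin.ext hh
    rw [this, stateDist_succ]

/-- Summation by parts along a flow. -/
lemma IsFlow.telescope {ρ : S → ℝ} {μ : Fin H → S → A → S → ℝ} (hμ : IsFlow ρ μ) (hH : 1 ≤ H)
    (V : Fin (H + 1) → S → ℝ) (hV : V (Fin.last H) = 0) :
    ∑ h, ∑ s, ∑ a, ∑ s', μ h s a s' * (V h.castSucc s - V h.succ s') = ∑ s, ρ s * V 0 s := by
  obtain ⟨n, rfl⟩ : ∃ n, H = n + 1 := ⟨H - 1, by omega⟩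
  simp only [mul_sub, Finset.sum_sub_distrib]
  rw [Fin.sum_univ_succ, Fin.sum_univ_castSucc
    (f := fun h => ∑ s, ∑ a, ∑ s', μ h s a s' * V h.succ s')]
  have h1 : ∑ s, ∑ a, ∑ s', μ (Fin.last n) s a s' * V (Fin.last n).succ s' = 0 := by
    rw [Fin.succ_last, hV]; simp
  have h2 : ∀ h : Fin (n + 1), ∑ s, ∑ a, ∑ s', μ h s a s' * V h.castSucc s
      = ∑ s, (∑ a, ∑ s', μ h s a s') * V h.castSucc s := by
    intro h; simp only [Finset.sum_mul]
  have h3 : ∀ i : Fin n, ∑ s, ∑ a, ∑ s', μ i.succ s a s' * V i.succ.castSucc s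
      = ∑ s, ∑ a, ∑ s', μ i.castSucc s a s' * V i.castSucc.succ s' := by
    intro i
    rw [h2, ← Fin.succ_castSucc]
    simp_rw [← hμ.flow i.castSucc i.succ (by simp), Finset.sum_mul]
    rw [Finset.sum_comm]
    refine Finset.sum_congr rfl fun s _ => ?_
    rw [Finset.sum_comm]
  rw [h1, Finset.sum_congr rfl fun i _ => h3 i, h2]
  simp_rw [hμ.init 0 rfl]
  simp

/-- Summation by parts for an occupancy measure, with the next state averaged out. -/
lemma IsOccupancy.telescope {ρ : S → ℝ} {P : Fin H → S → A → S → ℝ} (hP : IsKernel P)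
    {u : Fin H → S → A → ℝ} (hu : IsOccupancy ρ P u) (hH : 1 ≤ H)
    (V : Fin (H + 1) → S → ℝ) (hV : V (Fin.last H) = 0) :
    ∑ h, ∑ s, ∑ a, u h s a * (V h.castSucc s - ∑ s', P h s a s' * V h.succ s')
      = ∑ s, ρ s * V 0 s := by
  rw [← hu.isFlow.telescope hH V hV]
  refine Finset.sum_congr rfl fun h _ => Finset.sum_congr rfl fun s _ =>
    Finset.sum_congr rfl fun a _ => ?_
  simp_rw [mul_sub, Finset.sum_sub_distrib, ← Finset.sum_mul, ← Finset.mul_sum, (hP _ _ _).2,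
    Finset.mul_sum]
  simp [mul_assoc]

lemma IsFlow.total {ρ : S → ℝ} (hρ : ∑ s, ρ s = 1) {μ : Fin H → S → A → S → ℝ}
    (hμ : IsFlow ρ μ) (h : Fin H) : ∑ s, ∑ a, ∑ s', μ h s a s' = 1 := by
  obtain ⟨k, hk⟩ := h
  induction k with
  | zero => rw [← hρ]; exact Finset.sum_congr rfl fun s _ => hμ.init _ rfl s
  | succ k ih =>
    rw [← ih (by omega)]
    simp_rw [← hμ.flow ⟨k, by omega⟩ ⟨k + 1, hk⟩ rfl]
    rw [Finset.sum_comm]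
    exact Finset.sum_congr rfl fun s _ => Finset.sum_comm

lemma IsOccupancy.total {ρ : S → ℝ} (hρ : ∑ s, ρ s = 1) {P : Fin H → S → A → S → ℝ}
    (hP : IsKernel P) {u : Fin H → S → A → ℝ} (hu : IsOccupancy ρ P u) (h : Fin H) :
    ∑ s, ∑ a, u h s a = 1 := by
  rw [← hu.isFlow.total hρ h]
  simp_rw [← Finset.mul_sum, (hP _ _ _).2, mul_one]

lemma IsOccupancy.le_one {ρ : S → ℝ} (hρ : ∑ s, ρ s = 1) {P : Fin H → S → A → S → ℝ}
    (hP : IsKernel P) {u : Fin H → S → A → ℝ} (hu : IsOccupancy ρ P u) (h : Fin H) (s : S) (a : A) :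
    u h s a ≤ 1 := by
  rw [← hu.total hρ hP h]
  exact (Finset.single_le_sum (fun a _ => hu.nonneg h s a) (Finset.mem_univ a)).trans
    (Finset.single_le_sum (f := fun s => ∑ a, u h s a)
      (fun s _ => Finset.sum_nonneg fun a _ => hu.nonneg h s a) (Finset.mem_univ s))

lemma sum_trajProb (ρ : S → ℝ) (hρ : ∑ s, ρ s = 1) (hH : 1 ≤ H) {P : Fin H → S → A → S → ℝ}
    (hρ0 : ∀ s, 0 ≤ ρ s)
    (hP : IsKernel P) {π : Fin H → S → A → ℝ} (hπ : IsPolicy π) :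
    ∑ z, trajProb ρ P π z = 1 := by
  have := sum_trajProb_step ρ H P π hP hπ ⟨0, hH⟩ (fun _ _ _ => 1)
  simp only [mul_one] at this
  rw [this]
  exact (occ_isOccupancy hρ0 hP hπ).isFlow.total hρ _

omit [Fintype S] in
lemma single_nonneg [DecidableEq S] (s x : S) : 0 ≤ (Pi.single s 1 : S → ℝ) x := by
  rw [Pi.single_apply]; split_ifs <;> norm_num

lemma value_eq_sum_occ [DecidableEq S] {P : Fin H → S → A → S → ℝ} (hP : IsKernel P)
    {π : Fin H → S → A → ℝ} (hπ : IsPolicy π) (r : Fin H → S → A → ℝ) (s : S) :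
    value P r π s = ∑ h, ∑ x, ∑ a, occ (Pi.single s 1) P π h x a * r h x a := by
  simp only [value, Finset.mul_sum]
  rw [Finset.sum_comm]
  refine Finset.sum_congr rfl fun h _ => ?_
  rw [sum_trajProb_step _ H P π hP hπ h (fun x a _ => r h x a)]
  refine Finset.sum_congr rfl fun x _ => Finset.sum_congr rfl fun a _ => ?_
  rw [← Finset.sum_mul, ← Finset.mul_sum, (hP _ _ _).2, mul_one]

/-- Mixing over the initial state occupancy measures of policies that may depend on that state
gives an occupancy measure. -/
lemma isOccupancy_mix [DecidableEq S] {ρ : S → ℝ} (hρ : ∀ s, 0 ≤ ρ s)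
    {P : Fin H → S → A → S → ℝ} (hP : IsKernel P) {π : S → Fin H → S → A → ℝ}
    (hπ : ∀ s, IsPolicy (π s)) :
    IsOccupancy ρ P (fun h x a => ∑ s, ρ s * occ (Pi.single s 1) P (π s) h x a) := by
  have hs := fun s => occ_isOccupancy (single_nonneg s) hP (hπ s)
  refine ⟨fun h x a => Finset.sum_nonneg fun s _ => mul_nonneg (hρ s) ((hs s).nonneg _ _ _), ?_, ?_⟩
  · intro h h0 x
    have h1 : ∀ s, ∑ a, ∑ s', occ (Pi.single s 1) P (π s) h x a * P h x a s'
        = (Pi.single s 1 : S → ℝ) x := fun s => (hs s).isFlow.init h h0 x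
    calc _ = ∑ s, ρ s * ∑ a, ∑ s', occ (Pi.single s 1) P (π s) h x a * P h x a s' := by
          simp only [Finset.sum_mul, Finset.mul_sum]
          rw [sum_rotate]
          simp only [mul_assoc]
      _ = ρ x := by simp [h1, Pi.single_apply]
  · intro h h' hh x
    have h1 : ∀ s, _ := fun s => (hs s).isFlow.flow h h' hh x
    calc _ = ∑ s, ρ s * ∑ y, ∑ a, occ (Pi.single s 1) P (π s) h y a * P h y a x := by
          simp only [Finset.sum_mul, Finset.mul_sum]
          rw [sum_rotate]
          simp only [mul_assoc]
      _ = _ := by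
          simp only [h1, Finset.sum_mul, Finset.mul_sum]
          rw [← sum_rotate]
          simp only [mul_assoc]

end Occupancy

/-! ### Chernoff bounds along adaptive sequences -/

section Sequential

variable {Ω : Type*}

/-- The entries of `D` before `t`. -/
def hist {K : ℕ} (D : Fin K → Ω) (t : Fin K) : Fin t → Ω := fun i => D (i.castLE t.2.le)

/-- The probability of the sequence `D` when the entry `t` is drawn from `q t`, which may depend on
the earlier entries. -/
def seqProb (q : (t : ℕ) → (Fin t → Ω) → Ω → ℝ) {K : ℕ} (D : Fin K → Ω) : ℝ :=
  ∏ t : Fin K, q t (hist D t) (D t)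

lemma seqProb_snoc (q : (t : ℕ) → (Fin t → Ω) → Ω → ℝ) {K : ℕ} (D : Fin K → Ω) (z : Ω) :
    seqProb q (Fin.snoc D z : Fin (K + 1) → Ω) = seqProb q D * q K D z := by
  have h1 : ∀ t : Fin K, hist (Fin.snoc D z : Fin (K + 1) → Ω) t.castSucc = hist D t := by
    intro t
    funext i
    exact Fin.snoc_castSucc (α := fun _ => Ω) z D (i.castLE t.2.le)
  have h2 : hist (Fin.snoc D z : Fin (K + 1) → Ω) (Fin.last K) = D := by
    funext i
    exact Fin.snoc_castSucc (α := fun _ => Ω) z D i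
  rw [seqProb, Fin.prod_univ_castSucc, h2, Fin.snoc_last]
  simp only [h1, Fin.snoc_castSucc]
  rfl

lemma seqProb_nonneg {q : (t : ℕ) → (Fin t → Ω) → Ω → ℝ} (hq : ∀ t D z, 0 ≤ q t D z) {K : ℕ}
    (D : Fin K → Ω) : 0 ≤ seqProb q D :=
  Finset.prod_nonneg fun _ _ => hq _ _ _

variable [Fintype Ω]

lemma sum_seqProb_succ (q : (t : ℕ) → (Fin t → Ω) → Ω → ℝ) (K : ℕ) :
    ∑ D : Fin (K + 1) → Ω, seqProb q D = ∑ D : Fin K → Ω, seqProb q D * ∑ z, q K D z := by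
  rw [← (Fin.snocEquiv (fun _ : Fin (K + 1) => Ω)).sum_comp, Fintype.sum_prod_type,
    Finset.sum_comm]
  refine Finset.sum_congr rfl fun D _ => ?_
  rw [Finset.mul_sum]
  exact Finset.sum_congr rfl fun z _ => seqProb_snoc q D z

lemma sum_seqProb {q : (t : ℕ) → (Fin t → Ω) → Ω → ℝ} (hq : ∀ t D, ∑ z, q t D z = 1) (K : ℕ) :
    ∑ D : Fin K → Ω, seqProb q D = 1 := by
  induction K with
  | zero => simp [seqProb]
  | succ K ih => rw [sum_seqProb_succ]; simpa [hq] using ih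

lemma sum_seqProb_le_one {q : (t : ℕ) → (Fin t → Ω) → Ω → ℝ} (hq0 : ∀ t D z, 0 ≤ q t D z)
    (hq : ∀ t D, ∑ z, q t D z ≤ 1) (K : ℕ) : ∑ D : Fin K → Ω, seqProb q D ≤ 1 := by
  induction K with
  | zero => simp [seqProb]
  | succ K ih =>
    rw [sum_seqProb_succ]
    exact (Finset.sum_le_sum fun D _ =>
      mul_le_of_le_one_right (seqProb_nonneg hq0 D) (hq K D)).trans ih

open Classical in
/-- Chernoff bound along an adaptive sequence: the exponential of a sum of increments with
conditional exponential moment at most one is a supermartingale. -/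
lemma seqProb_tail {q : (t : ℕ) → (Fin t → Ω) → Ω → ℝ} (hq0 : ∀ t D z, 0 ≤ q t D z)
    {y : (t : ℕ) → (Fin t → Ω) → Ω → ℝ}
    (hy : ∀ t D, ∑ z, q t D z * Real.exp (y t D z) ≤ 1) (L : ℝ) (K : ℕ) :
    ∑ D : Fin K → Ω, (if L < ∑ t : Fin K, y t (hist D t) (D t) then seqProb q D else 0)
      ≤ Real.exp (-L) := by
  have h1 := sum_seqProb_le_one (q := fun t D z => q t D z * Real.exp (y t D z))
    (fun t D z => mul_nonneg (hq0 t D z) (Real.exp_pos _).le) hy K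
  refine (Finset.sum_le_sum (g := fun D => Real.exp (-L) *
    seqProb (fun t D z => q t D z * Real.exp (y t D z)) D) fun D _ => ?_).trans ?_
  · have h2 : seqProb (fun t D z => q t D z * Real.exp (y t D z)) D
        = seqProb q D * Real.exp (∑ t : Fin K, y t (hist D t) (D t)) := by
      simp only [seqProb, Finset.prod_mul_distrib, Real.exp_sum]
    rw [h2]
    split_ifs with h
    · have h3 : 1 ≤ Real.exp (-L) * Real.exp (∑ t : Fin K, y t (hist D t) (D t)) := by
        rw [← Real.exp_add]; exact Real.one_le_exp (by linarith)
      calc seqProb q D = seqProb q D * 1 := (mul_one _).symm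
        _ ≤ seqProb q D * (Real.exp (-L) * Real.exp (∑ t : Fin K, y t (hist D t) (D t))) :=
          mul_le_mul_of_nonneg_left h3 (seqProb_nonneg hq0 D)
        _ = _ := by ring
    · exact mul_nonneg (Real.exp_pos _).le
        (mul_nonneg (seqProb_nonneg hq0 D) (Real.exp_pos _).le)
  · rw [← Finset.mul_sum]
    exact mul_le_of_le_one_right (Real.exp_pos _).le h1

open Classical in
/-- Union bound over a finite family of Chernoff bounds. -/
lemma seqProb_tail_union {q : (t : ℕ) → (Fin t → Ω) → Ω → ℝ} (hq0 : ∀ t D z, 0 ≤ q t D z)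
    {ι : Type*} [Fintype ι] {y : ι → (t : ℕ) → (Fin t → Ω) → Ω → ℝ}
    (hy : ∀ i t D, ∑ z, q t D z * Real.exp (y i t D z) ≤ 1) (L : ℝ) (K : ℕ)
    (good : (Fin K → Ω) → Prop)
    (hgood : ∀ D, (∀ i, ∑ t : Fin K, y i t (hist D t) (D t) ≤ L) → good D) :
    ∑ D : Fin K → Ω, (if good D then 0 else seqProb q D)
      ≤ Fintype.card ι * Real.exp (-L) := by
  calc _ ≤ ∑ D : Fin K → Ω, ∑ i,
        (if L < ∑ t : Fin K, y i t (hist D t) (D t) then seqProb q D else 0) := by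
        refine Finset.sum_le_sum fun D _ => ?_
        have hnn : ∀ i, 0 ≤ if L < ∑ t : Fin K, y i t (hist D t) (D t) then seqProb q D else 0 := by
          intro i; split_ifs
          exacts [seqProb_nonneg hq0 D, le_rfl]
        split_ifs with h
        · exact Finset.sum_nonneg fun i _ => hnn i
        · have : ∃ i, L < ∑ t : Fin K, y i t (hist D t) (D t) := by
            by_contra hc
            push Not at hc
            exact h (hgood D hc)
          obtain ⟨i, hi⟩ := this
          refine le_trans ?_ (Finset.single_le_sum (fun i _ => hnn i) (Finset.mem_univ i))
          rw [if_pos hi]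
    _ = ∑ i, ∑ D : Fin K → Ω,
        (if L < ∑ t : Fin K, y i t (hist D t) (D t) then seqProb q D else 0) := Finset.sum_comm
    _ ≤ ∑ _i : ι, Real.exp (-L) := Finset.sum_le_sum fun i _ => seqProb_tail hq0 (hy i) L K
    _ = _ := by simp

end Sequential

/-! ### Exponential moments of visits and transitions -/

section ModelLaw

variable {S A : Type*} [Fintype S] [Fintype A] [DecidableEq S] [DecidableEq A] {H : ℕ}

/-- Indicator of the trajectories that play `a` in `s` at step `h`. -/
def visitInd (h : Fin H) (s : S) (a : A) (z : Traj S A H) : ℝ :=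
  if z.state h = s ∧ z.action h = a then 1 else 0

/-- Indicator of the trajectories that play `a` in `s` at step `h` and move to `s'`. -/
def transInd (h : Fin H) (s : S) (a : A) (s' : S) (z : Traj S A H) : ℝ :=
  if z.state h = s ∧ z.action h = a ∧ z.next h = s' then 1 else 0

/-- Probability under the trajectory law `q` of playing `a` in `s` at step `h`. -/
def visitProb (q : Traj S A H → ℝ) (h : Fin H) (s : S) (a : A) : ℝ :=
  ∑ z, q z * visitInd h s a z

/-- `q` is the law of a trajectory whose transitions follow the kernel `P`, whatever rule selects
the actions. Mixtures of Markov policies have such laws. -/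
structure IsModelLaw (P : Fin H → S → A → S → ℝ) (q : Traj S A H → ℝ) : Prop where
  nonneg : ∀ z, 0 ≤ q z
  sum_one : ∑ z, q z = 1
  trans : ∀ h s a s', ∑ z, q z * transInd h s a s' z = visitProb q h s a * P h s a s'

omit [Fintype S] [Fintype A] in
lemma visitInd_nonneg (h : Fin H) (s : S) (a : A) (z : Traj S A H) : 0 ≤ visitInd h s a z := by
  unfold visitInd; split_ifs <;> norm_num

omit [Fintype S] [Fintype A] in
lemma visitInd_le_one (h : Fin H) (s : S) (a : A) (z : Traj S A H) : visitInd h s a z ≤ 1 := by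
  unfold visitInd; split_ifs <;> norm_num

lemma trajProb_isModelLaw {ρ : S → ℝ} (hρ : ρ ∈ stdSimplex ℝ S) (hH : 1 ≤ H)
    {P : Fin H → S → A → S → ℝ} (hP : IsKernel P) {π : Fin H → S → A → ℝ} (hπ : IsPolicy π) :
    IsModelLaw P (trajProb ρ P π) ∧ ∀ h s a, visitProb (trajProb ρ P π) h s a = occ ρ P π h s a := by
  have hv : ∀ h s a, visitProb (trajProb ρ P π) h s a = occ ρ P π h s a := by
    intro h s a
    have := sum_trajProb_step ρ H P π hP hπ h (fun x y _ => if x = s ∧ y = a then 1 else 0)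
    simp only [visitProb, visitInd]
    rw [this]
    simp_rw [← Finset.sum_mul, ← Finset.mul_sum, (hP _ _ _).2, ite_and]
    simp
  refine ⟨⟨trajProb_nonneg hρ.1 hP hπ, sum_trajProb ρ hρ.2 hH hρ.1 hP hπ, ?_⟩, hv⟩
  intro h s a s'
  rw [hv]
  have := sum_trajProb_step ρ H P π hP hπ h
    (fun x y x' => if x = s ∧ y = a ∧ x' = s' then 1 else 0)
  simp only [transInd]
  rw [this]
  simp [ite_and]

lemma visitProb_nonneg {P : Fin H → S → A → S → ℝ} {q : Traj S A H → ℝ} (hq : IsModelLaw P q)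
    (h : Fin H) (s : S) (a : A) : 0 ≤ visitProb q h s a :=
  Finset.sum_nonneg fun z _ => mul_nonneg (hq.nonneg z) (visitInd_nonneg h s a z)

/-- Exponential moment of a function of a Bernoulli indicator. -/
lemma sum_law_exp_visitInd {P : Fin H → S → A → S → ℝ} {q : Traj S A H → ℝ} (hq : IsModelLaw P q)
    (h : Fin H) (s : S) (a : A) (σ : ℝ) :
    ∑ z, q z * Real.exp (σ * visitInd h s a z)
      = 1 + visitProb q h s a * (Real.exp σ - 1) := by
  have h1 : ∀ z, q z * Real.exp (σ * visitInd h s a z)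
      = q z + (q z * visitInd h s a z) * (Real.exp σ - 1) := by
    intro z
    unfold visitInd
    split_ifs <;> simp
    ring
  simp_rw [h1, Finset.sum_add_distrib, hq.sum_one, ← Finset.sum_mul]
  rfl

lemma exp_moment_lower {P : Fin H → S → A → S → ℝ} {q : Traj S A H → ℝ} (hq : IsModelLaw P q)
    (h : Fin H) (s : S) (a : A) :
    ∑ z, q z * Real.exp (visitProb q h s a / 2 - visitInd h s a z) ≤ 1 := by
  have h1 : ∀ z, q z * Real.exp (visitProb q h s a / 2 - visitInd h s a z)
      = Real.exp (visitProb q h s a / 2) * (q z * Real.exp ((-1) * visitInd h s a z)) := by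
    intro z; rw [sub_eq_add_neg, Real.exp_add]; ring_nf
  simp_rw [h1, ← Finset.mul_sum, sum_law_exp_visitInd hq]
  set d := visitProb q h s a
  have hd : 0 ≤ d := visitProb_nonneg hq h s a
  have h2 : Real.exp (-1) ≤ 1 / 2 := by
    have := Real.exp_one_gt_d9
    rw [Real.exp_neg, ← one_div]
    exact one_div_le_one_div_of_le (by norm_num) (by linarith)
  have h3 : 1 + d * (Real.exp (-1) - 1) ≤ Real.exp (-(d / 2)) := by
    have := Real.add_one_le_exp (-(d / 2))
    nlinarith
  calc _ ≤ Real.exp (d / 2) * Real.exp (-(d / 2)) :=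
        mul_le_mul_of_nonneg_left h3 (Real.exp_pos _).le
    _ = 1 := by rw [← Real.exp_add]; simp

lemma exp_moment_upper {P : Fin H → S → A → S → ℝ} {q : Traj S A H → ℝ} (hq : IsModelLaw P q)
    (h : Fin H) (s : S) (a : A) :
    ∑ z, q z * Real.exp (visitInd h s a z - 2 * visitProb q h s a) ≤ 1 := by
  have h1 : ∀ z, q z * Real.exp (visitInd h s a z - 2 * visitProb q h s a)
      = Real.exp (-(2 * visitProb q h s a)) * (q z * Real.exp (1 * visitInd h s a z)) := by
    intro z; rw [sub_eq_add_neg, Real.exp_add]; ring_nf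
  simp_rw [h1, ← Finset.mul_sum, sum_law_exp_visitInd hq]
  set d := visitProb q h s a
  have hd : 0 ≤ d := visitProb_nonneg hq h s a
  have h2 : 1 + d * (Real.exp 1 - 1) ≤ Real.exp (2 * d) := by
    have := Real.add_one_le_exp (2 * d)
    have := Real.exp_one_lt_d9
    nlinarith
  calc _ ≤ Real.exp (-(2 * d)) * Real.exp (2 * d) :=
        mul_le_mul_of_nonneg_left h2 (Real.exp_pos _).le
    _ = 1 := by rw [← Real.exp_add]; simp

/-- Bernstein-type exponential moment of a centred transition indicator. -/
lemma exp_moment_transition {P : Fin H → S → A → S → ℝ} (hP : IsKernel P) {q : Traj S A H → ℝ}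
    (hq : IsModelLaw P q) (h : Fin H) (s : S) (a : A) (s' : S) {σ : ℝ} (hσ : |σ| ≤ 1) :
    ∑ z, q z * Real.exp (σ * (transInd h s a s' z - visitInd h s a z * P h s a s')
      - visitInd h s a z * P h s a s' * σ ^ 2) ≤ 1 := by
  set p := P h s a s'
  set d := visitProb q h s a with hd_def
  have hd : 0 ≤ d := visitProb_nonneg hq h s a
  have hp : 0 ≤ p := (hP h s a).1 s'
  set B := Real.exp (-(σ * p) - p * σ ^ 2) with hB
  have h1 : ∀ z, q z * Real.exp (σ * (transInd h s a s' z - visitInd h s a z * p)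
      - visitInd h s a z * p * σ ^ 2)
      = q z + (q z * visitInd h s a z) * (B - 1)
        + (q z * transInd h s a s' z) * (B * (Real.exp σ - 1)) := by
    intro z
    have hA : Real.exp (σ * (1 - p) - p * σ ^ 2) = B * Real.exp σ := by
      rw [hB, ← Real.exp_add]; ring_nf
    unfold visitInd transInd
    by_cases h2 : z.state h = s ∧ z.action h = a
    · by_cases h3 : z.next h = s'
      · rw [if_pos h2, if_pos ⟨h2.1, h2.2, h3⟩, one_mul, hA]; ring
      · rw [if_pos h2, if_neg (fun hc => h3 hc.2.2)]
        have : σ * (0 - 1 * p) - 1 * p * σ ^ 2 = -(σ * p) - p * σ ^ 2 := by ring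
        rw [this]; ring
    · rw [if_neg h2, if_neg (fun hc => h2 ⟨hc.1, hc.2.1⟩)]; simp
  simp_rw [h1, Finset.sum_add_distrib, hq.sum_one, ← Finset.sum_mul, hq.trans]
  have h4 : B * (1 + p * (Real.exp σ - 1)) ≤ 1 := by
    have h5 := (abs_le.1 (Real.abs_exp_sub_one_sub_id_le hσ)).2
    have h6 : 1 + p * (Real.exp σ - 1) ≤ Real.exp (σ * p + p * σ ^ 2) := by
      have := Real.add_one_le_exp (σ * p + p * σ ^ 2)
      nlinarith
    calc _ ≤ B * Real.exp (σ * p + p * σ ^ 2) :=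
          mul_le_mul_of_nonneg_left h6 (Real.exp_pos _).le
      _ = 1 := by rw [hB, ← Real.exp_add]; ring_nf; simp
  change 1 + d * (B - 1) + d * p * (B * (Real.exp σ - 1)) ≤ 1
  nlinarith

omit [Fintype S] [Fintype A] in
lemma transCount_eq_sum {K : ℕ} (D : Fin K → Traj S A H) (m : ℕ) (h : Fin H) (s : S) (a : A)
    (s' : S) : (transCount D m h s a s' : ℝ)
      = ∑ t : Fin K, if (t : ℕ) < m then transInd h s a s' (D t) else 0 := by
  rw [transCount, Finset.card_filter]
  push_cast
  refine Finset.sum_congr rfl fun t _ => ?_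
  unfold transInd
  rw [ite_and]

omit [Fintype A] in
lemma visitCount_eq_sum {K : ℕ} (D : Fin K → Traj S A H) (m : ℕ) (h : Fin H) (s : S) (a : A) :
    (visitCount D m h s a : ℝ)
      = ∑ t : Fin K, if (t : ℕ) < m then visitInd h s a (D t) else 0 := by
  rw [visitCount]
  push_cast
  simp_rw [transCount_eq_sum]
  rw [Finset.sum_comm]
  refine Finset.sum_congr rfl fun t _ => ?_
  split_ifs
  · unfold transInd visitInd
    simp [ite_and]
  · simp

omit [Fintype A] in
lemma transCount_le_visitCount {K : ℕ} (D : Fin K → Traj S A H) (m : ℕ) (h : Fin H) (s : S) (a : A)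
    (s' : S) : transCount D m h s a s' ≤ visitCount D m h s a :=
  Finset.single_le_sum (f := fun s' => transCount D m h s a s') (fun _ _ => Nat.zero_le _)
    (Finset.mem_univ s')

/-- From a Bernstein bound with a tuned parameter `θ` to an empirical Bernstein bound: here `q` is
the mean, `k` the count, and `q'` a proxy for `q` that tunes `θ`. -/
lemma empirical_bernstein {L k q q' : ℝ} (hL : 0 < L) (hk : 0 ≤ k)
    (h1 : q' ≤ 2 * q + 2 * L) (h2 : q ≤ 2 * q' + L)
    (hb : ∀ σ : ℝ, |σ| = √(L / max L q') → σ * (k - q) - q * σ ^ 2 ≤ L) :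
    |k - q| ≤ 2 * √(100 * L * k) + 14 * (100 * L) / 3 := by
  set M := max L q' with hM
  have hLM : L ≤ M := le_max_left _ _
  have hMpos : 0 < M := hL.trans_le hLM
  set θ := √(L / M) with hθ
  set R := √(L * M) with hR
  have hθpos : 0 < θ := Real.sqrt_pos.2 (div_pos hL hMpos)
  have hRpos : 0 < R := Real.sqrt_pos.2 (mul_pos hL hMpos)
  have hR2 : R ^ 2 = L * M := Real.sq_sqrt (mul_pos hL hMpos).le
  have hθM : θ * M = R := by
    have : R = √(L / M * M ^ 2) := by rw [hR]; congr 1; field_simp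
    rw [this, Real.sqrt_mul (div_pos hL hMpos).le, Real.sqrt_sq hMpos.le]
  have hθR : θ * R = L := by
    rw [hθ, hR, ← Real.sqrt_mul (div_pos hL hMpos).le]
    have : L / M * (L * M) = L ^ 2 := by field_simp
    rw [this, Real.sqrt_sq hL.le]
  have hq3 : q ≤ 3 * M := by
    have : q' ≤ M := le_max_right _ _
    linarith
  have hM2 : M ≤ 2 * max q 0 + 2 * L := by
    refine max_le ?_ ?_
    · have := le_max_right q 0; linarith
    · have := le_max_left q 0; linarith
  -- both signs of the parameter give the two-sided bound
  have hθ2 : q * θ ^ 2 ≤ 3 * L := by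
    calc q * θ ^ 2 ≤ 3 * M * θ ^ 2 := mul_le_mul_of_nonneg_right hq3 (sq_nonneg _)
      _ = 3 * (θ * (θ * M)) := by ring
      _ = 3 * L := by rw [hθM, hθR]
  have hdev : |k - q| ≤ 4 * R := by
    have e1 := hb θ (abs_of_pos hθpos)
    have e2 := hb (-θ) (by rw [abs_neg, abs_of_pos hθpos])
    have key : ∀ x : ℝ, θ * x ≤ 4 * L → x ≤ 4 * R := by
      intro x hx
      have : θ * x ≤ θ * (4 * R) := by nlinarith
      exact le_of_mul_le_mul_left this hθpos
    rw [abs_le]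
    constructor
    · have := key (-(k - q)) (by nlinarith)
      linarith
    · exact key _ (by nlinarith)
  set w := √(L * k) with hw
  have hw0 : 0 ≤ w := Real.sqrt_nonneg _
  have hw2 : w ^ 2 = L * k := Real.sq_sqrt (mul_nonneg hL.le hk)
  have h100 : √(100 * L * k) = 10 * w := by
    rw [show 100 * L * k = 10 ^ 2 * (L * k) by ring, Real.sqrt_mul (by norm_num),
      Real.sqrt_sq (by norm_num)]
  rw [h100]
  have hqk : max q 0 ≤ k + 4 * R := by
    refine max_le ?_ (by positivity)
    have := (abs_le.1 hdev).1
    linarith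
  have hquad : R ^ 2 ≤ 2 * w ^ 2 + 8 * L * R + 2 * L ^ 2 := by
    rw [hR2, hw2]
    nlinarith
  have hRb : R ≤ 5 * w + 10 * L := by
    by_contra hc
    push Not at hc
    nlinarith [mul_nonneg hw0 hL.le]
  linarith

omit [Fintype A] in
lemma conf_of_count {K : ℕ} {P : Fin H → S → A → S → ℝ} (hP : IsKernel P) {ℓ : ℝ} (hℓ : 1 ≤ ℓ)
    (D : Fin K → Traj S A H) (m : ℕ) (h : Fin H) (s : S) (a : A) (s' : S)
    (hc : |(transCount D m h s a s' : ℝ) - visitCount D m h s a * P h s a s'|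
      ≤ 2 * √(ℓ * transCount D m h s a s') + 14 * ℓ / 3) :
    |empKernel D m h s a s' - P h s a s'| ≤ confRadius ℓ D m h s a s' := by
  have hp0 := (hP h s a).1 s'
  have hp1 : P h s a s' ≤ 1 := by
    rw [← (hP h s a).2]
    exact Finset.single_le_sum (fun x _ => (hP h s a).1 x) (Finset.mem_univ s')
  have hkn := transCount_le_visitCount D m h s a s'
  unfold confRadius empKernel
  set n := visitCount D m h s a
  set k := transCount D m h s a s'
  set p := P h s a s'
  rw [max_comm]
  rcases Nat.eq_zero_or_pos n with hn | hn
  · have hk : k = 0 := by omega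
    rw [hn, hk]
    simp only [Nat.cast_zero, zero_div, zero_mul, Real.sqrt_zero, mul_zero, zero_add, zero_sub,
      abs_neg, abs_of_nonneg hp0]
    rw [max_eq_right (by norm_num)]
    linarith
  · have hn1 : (1 : ℝ) ≤ n := by exact_mod_cast hn
    have hn0 : (0 : ℝ) < n := by linarith
    rw [max_eq_left hn1]
    have e1 : (k : ℝ) / n - p = (k - n * p) / n := by field_simp
    have e2 : (k : ℝ) / n * ℓ / n = ℓ * k / n ^ 2 := by field_simp
    rw [e1, e2, Real.sqrt_div' _ (sq_nonneg _), Real.sqrt_sq hn0.le, abs_div, abs_of_pos hn0]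
    rw [div_le_iff₀ hn0]
    refine hc.trans (le_of_eq ?_)
    field_simp

end ModelLaw

/-! ### The concentration events -/

section Events

variable {S A : Type*} [Fintype S] [Fintype A] [DecidableEq S] [DecidableEq A] {H : ℕ}

/-- The concentration event of the exploration phase, for episodes drawn from the adaptive laws
`q`: up to constant factors and an additive `L`, visit counts dominate the sums of visit
probabilities at all times and are dominated by them at the end, and the confidence sets contain
the true kernel at all times. -/
structure ExploreGood (P : Fin H → S → A → S → ℝ)
    (q : (t : ℕ) → (Fin t → Traj S A H) → Traj S A H → ℝ) (L : ℝ) {K : ℕ}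
    (D : Fin K → Traj S A H) : Prop where
  lower : ∀ m ≤ K, ∀ h s a,
    ∑ t : Fin K, (if (t : ℕ) < m then visitProb (q t (hist D t)) h s a else 0)
      ≤ 2 * visitCount D m h s a + 2 * L
  upper : ∀ h s a, (visitCount D K h s a : ℝ)
    ≤ 2 * ∑ t : Fin K, visitProb (q t (hist D t)) h s a + L
  conf : ∀ m ≤ K, ∀ h s a s',
    |empKernel D m h s a s' - P h s a s'| ≤ confRadius (100 * L) D m h s a s'

/-- The concentration event of the estimation phase, for independent trajectories with law `q`. -/
structure EstimGood (P : Fin H → S → A → S → ℝ) (q : Traj S A H → ℝ) (L : ℝ) {N : ℕ}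
    (D : Fin N → Traj S A H) : Prop where
  lower : ∀ h s a, N * visitProb q h s a ≤ 2 * visitCount D N h s a + 2 * L
  conf : ∀ h s a s',
    |empKernel D N h s a s' - P h s a s'| ≤ confRadius (100 * L) D N h s a s'

lemma abs_sign_mul_sqrt_le_one {L x : ℝ} (hL : 0 < L) (b : Bool) :
    |(if b then 1 else -1) * √(L / max L x)| ≤ 1 := by
  have h1 : √(L / max L x) ≤ 1 := by
    rw [Real.sqrt_le_one]
    exact div_le_one_of_le₀ (le_max_left _ _) (hL.le.trans (le_max_left _ _))
  cases b <;> simpa [abs_of_nonneg (Real.sqrt_nonneg (L / max L x))] using h1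

lemma exists_sign_of_abs_eq {σ θ : ℝ} (hθ : |σ| = θ) :
    ∃ b : Bool, σ = (if b then 1 else -1) * θ := by
  rcases abs_choice σ with h | h
  · exact ⟨true, by simp; linarith⟩
  · exact ⟨false, by simp; linarith⟩

open Classical in
/-- The visit count that tunes the Bernstein moment is random, so the union runs over its `K + 1`
possible values as well as over the times. -/
lemma prob_not_exploreGood {P : Fin H → S → A → S → ℝ} (hP : IsKernel P)
    {q : (t : ℕ) → (Fin t → Traj S A H) → Traj S A H → ℝ} (hq : ∀ t D, IsModelLaw P (q t D))
    {L : ℝ} (hL : 1 ≤ L) (hS : 1 ≤ Fintype.card S) (K : ℕ) :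
    ∑ D : Fin K → Traj S A H, (if ExploreGood P q L D then 0 else seqProb q D)
      ≤ 4 * ((K : ℝ) + 1) ^ 2 * ((Fintype.card S : ℝ) ^ 2 * Fintype.card A * H)
        * Real.exp (-L) := by
  have hL0 : 0 < L := by linarith
  -- the parameter of the Bernstein moment is tuned for each possible value of the visit count
  let y : ((Fin (K + 1) × Fin H × S × A) ⊕ (Fin H × S × A) ⊕
      (Bool × Fin (K + 1) × Fin (K + 1) × Fin H × S × A × S)) →
      (t : ℕ) → (Fin t → Traj S A H) → Traj S A H → ℝ := fun i t D z => match i with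
    | .inl (m, h, s, a) => if t < (m : ℕ) then visitProb (q t D) h s a / 2 - visitInd h s a z else 0
    | .inr (.inl (h, s, a)) => visitInd h s a z - 2 * visitProb (q t D) h s a
    | .inr (.inr (b, m, n, h, s, a, s')) => if t < (m : ℕ) then
        ((if b then 1 else -1) * √(L / max L ((n : ℕ) * P h s a s')))
          * (transInd h s a s' z - visitInd h s a z * P h s a s')
        - visitInd h s a z * P h s a s'
          * ((if b then 1 else -1) * √(L / max L ((n : ℕ) * P h s a s'))) ^ 2 else 0
  refine (seqProb_tail_union (y := y) (fun t D => (hq t D).nonneg) ?_ L K _ ?_).trans ?_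
  · have h0 : ∀ t (D : Fin t → Traj S A H), ∑ z, q t D z * Real.exp 0 ≤ 1 := by
      intro t D; simp [(hq t D).sum_one]
    rintro (⟨m, h, s, a⟩ | ⟨h, s, a⟩ | ⟨b, m, n, h, s, a, s'⟩) t D
    · by_cases htm : t < (m : ℕ)
      · simp only [y, htm, if_true]; exact exp_moment_lower (hq t D) h s a
      · simp only [y, htm, if_false]; exact h0 t D
    · exact exp_moment_upper (hq t D) h s a
    · by_cases htm : t < (m : ℕ)
      · simp only [y, htm, if_true]
        exact exp_moment_transition hP (hq t D) h s a s' (abs_sign_mul_sqrt_le_one hL0 b)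
      · simp only [y, htm, if_false]; exact h0 t D
  · intro D hD
    refine ⟨?_, ?_, ?_⟩
    · intro m hm h s a
      have := hD (.inl (⟨m, by omega⟩, h, s, a))
      simp only [y] at this
      rw [visitCount_eq_sum]
      have e : ∀ t : Fin K, (if (t : ℕ) < m then visitProb (q t (hist D t)) h s a / 2
            - visitInd h s a (D t) else 0)
          = (if (t : ℕ) < m then visitProb (q t (hist D t)) h s a else 0) / 2
            - if (t : ℕ) < m then visitInd h s a (D t) else 0 := by
        intro t; split_ifs <;> simp
      simp_rw [e, Finset.sum_sub_distrib, ← Finset.sum_div] at this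
      linarith
    · intro h s a
      have := hD (.inr (.inl (h, s, a)))
      simp only [y, Finset.sum_sub_distrib, ← Finset.mul_sum] at this
      rw [visitCount_eq_sum]
      simp only [Fin.is_lt, if_true]
      linarith
    · intro m hm h s a s'
      refine conf_of_count hP (by linarith) D m h s a s' ?_
      have hn : visitCount D m h s a ≤ K := by
        have : (visitCount D m h s a : ℝ) ≤ K := by
          rw [visitCount_eq_sum]
          refine (Finset.sum_le_sum (g := fun _ => (1 : ℝ)) fun t _ => ?_).trans (by simp)
          split_ifs
          exacts [visitInd_le_one _ _ _ _, zero_le_one]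
        exact_mod_cast this
      have hp := (hP h s a).1 s'
      have hnp : 0 ≤ (visitCount D m h s a : ℝ) * P h s a s' := mul_nonneg (Nat.cast_nonneg _) hp
      refine empirical_bernstein (q' := visitCount D m h s a * P h s a s') hL0 (Nat.cast_nonneg _)
        (by linarith) (by linarith) ?_
      intro σ hσ
      obtain ⟨b, hb⟩ := exists_sign_of_abs_eq hσ
      have := hD (.inr (.inr (b, ⟨m, by omega⟩, ⟨visitCount D m h s a, by omega⟩, h, s, a, s')))
      simp only [y] at this
      rw [← hb] at this
      have e : ∀ t : Fin K, (if (t : ℕ) < m then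
            σ * (transInd h s a s' (D t) - visitInd h s a (D t) * P h s a s')
              - visitInd h s a (D t) * P h s a s' * σ ^ 2 else 0)
          = σ * ((if (t : ℕ) < m then transInd h s a s' (D t) else 0)
            - (if (t : ℕ) < m then visitInd h s a (D t) else 0) * P h s a s')
            - (if (t : ℕ) < m then visitInd h s a (D t) else 0) * P h s a s' * σ ^ 2 := by
        intro t; split_ifs <;> simp
      simp_rw [e, Finset.sum_sub_distrib, ← Finset.mul_sum, Finset.sum_sub_distrib,
        ← Finset.sum_mul, ← transCount_eq_sum, ← visitCount_eq_sum] at this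
      exact this
  · refine mul_le_mul_of_nonneg_right ?_ (Real.exp_pos _).le
    simp only [Fintype.card_sum, Fintype.card_prod, Fintype.card_fin, Fintype.card_bool]
    push_cast
    have hS' : (1 : ℝ) ≤ Fintype.card S := by exact_mod_cast hS
    set x : ℝ := (H : ℝ) * (Fintype.card S * Fintype.card A) with hx
    have hx0 : 0 ≤ x := by positivity
    have hK : (1 : ℝ) ≤ (K : ℝ) + 1 := by have := Nat.cast_nonneg (α := ℝ) K; linarith
    have h1 : x ≤ x * Fintype.card S := by nlinarith
    have h2 : ((K : ℝ) + 1) * x ≤ ((K : ℝ) + 1) ^ 2 * (x * Fintype.card S) := by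
      rw [sq]
      have : x ≤ ((K : ℝ) + 1) * (x * Fintype.card S) := by nlinarith
      nlinarith
    have h3 : x ≤ ((K : ℝ) + 1) ^ 2 * (x * Fintype.card S) := by nlinarith
    calc _ = ((K : ℝ) + 1) * x + (x + 2 * (((K : ℝ) + 1) ^ 2 * (x * Fintype.card S))) := by
          rw [hx]; ring
      _ ≤ 4 * (((K : ℝ) + 1) ^ 2 * (x * Fintype.card S)) := by linarith
      _ = _ := by rw [hx]; ring

open Classical in
/-- Only the final counts matter here and their means are known, so the number of events, and with
it the bound, does not depend on `N`. -/
lemma prob_not_estimGood {P : Fin H → S → A → S → ℝ} (hP : IsKernel P)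
    {q : Traj S A H → ℝ} (hq : IsModelLaw P q)
    {L : ℝ} (hL : 1 ≤ L) (hS : 1 ≤ Fintype.card S) (N : ℕ) :
    ∑ D : Fin N → Traj S A H, (if EstimGood P q L D then 0 else ∏ n, q (D n))
      ≤ 4 * ((Fintype.card S : ℝ) ^ 2 * Fintype.card A * H) * Real.exp (-L) := by
  have hL0 : 0 < L := by linarith
  -- independence pins the visit count near its mean, which tunes the Bernstein moment
  let y : ((Fin H × S × A) ⊕ (Fin H × S × A) ⊕ (Bool × Fin H × S × A × S)) →
      (t : ℕ) → (Fin t → Traj S A H) → Traj S A H → ℝ := fun i _ _ z => match i with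
    | .inl (h, s, a) => visitProb q h s a / 2 - visitInd h s a z
    | .inr (.inl (h, s, a)) => visitInd h s a z - 2 * visitProb q h s a
    | .inr (.inr (b, h, s, a, s')) =>
        ((if b then 1 else -1) * √(L / max L (N * visitProb q h s a * P h s a s')))
          * (transInd h s a s' z - visitInd h s a z * P h s a s')
        - visitInd h s a z * P h s a s'
          * ((if b then 1 else -1) * √(L / max L (N * visitProb q h s a * P h s a s'))) ^ 2
  refine (seqProb_tail_union (q := fun _ _ => q) (y := y) (fun _ _ => hq.nonneg) ?_ L N _ ?_).trans
    ?_
  · rintro (⟨h, s, a⟩ | ⟨h, s, a⟩ | ⟨b, h, s, a, s'⟩) t D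
    · exact exp_moment_lower hq h s a
    · exact exp_moment_upper hq h s a
    · exact exp_moment_transition hP hq h s a s' (abs_sign_mul_sqrt_le_one hL0 b)
  · intro D hD
    have hcount : ∀ h s a, (visitCount D N h s a : ℝ) = ∑ t, visitInd h s a (D t) := by
      intro h s a; rw [visitCount_eq_sum]; simp
    have hlow : ∀ h s a, N * visitProb q h s a ≤ 2 * visitCount D N h s a + 2 * L := by
      intro h s a
      have := hD (.inl (h, s, a))
      simp only [y, Finset.sum_sub_distrib, Finset.sum_const, Finset.card_univ, Fintype.card_fin,
        nsmul_eq_mul] at this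
      rw [hcount]
      linarith
    have hupp : ∀ h s a, (visitCount D N h s a : ℝ) ≤ 2 * (N * visitProb q h s a) + L := by
      intro h s a
      have := hD (.inr (.inl (h, s, a)))
      simp only [y, Finset.sum_sub_distrib, Finset.sum_const, Finset.card_univ, Fintype.card_fin,
        nsmul_eq_mul] at this
      rw [hcount]
      linarith
    refine ⟨hlow, ?_⟩
    intro h s a s'
    refine conf_of_count hP (by linarith) D N h s a s' ?_
    have hp := (hP h s a).1 s'
    have hp1 : P h s a s' ≤ 1 := by
      rw [← (hP h s a).2]
      exact Finset.single_le_sum (fun x _ => (hP h s a).1 x) (Finset.mem_univ s')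
    have hl := mul_le_mul_of_nonneg_right (hlow h s a) hp
    have hu := mul_le_mul_of_nonneg_right (hupp h s a) hp
    refine empirical_bernstein (q' := N * visitProb q h s a * P h s a s') hL0 (Nat.cast_nonneg _)
      (by nlinarith) (by nlinarith) ?_
    intro σ hσ
    obtain ⟨b, hb⟩ := exists_sign_of_abs_eq hσ
    have := hD (.inr (.inr (b, h, s, a, s')))
    simp only [y] at this
    rw [← hb] at this
    have e : (transCount D N h s a s' : ℝ) = ∑ t, transInd h s a s' (D t) := by
      rw [transCount_eq_sum]; simp
    rw [hcount, e]
    simp_rw [Finset.sum_sub_distrib, ← Finset.mul_sum, Finset.sum_sub_distrib,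
      ← Finset.sum_mul] at this
    exact this
  · refine mul_le_mul_of_nonneg_right ?_ (Real.exp_pos _).le
    simp only [Fintype.card_sum, Fintype.card_prod, Fintype.card_fin, Fintype.card_bool]
    push_cast
    have hS' : (1 : ℝ) ≤ Fintype.card S := by exact_mod_cast hS
    set x : ℝ := (H : ℝ) * (Fintype.card S * Fintype.card A) with hx
    have hx0 : 0 ≤ x := by positivity
    have h1 : x ≤ x * Fintype.card S := by nlinarith
    calc _ = x + (x + 2 * (x * Fintype.card S)) := by rw [hx]; ring
      _ ≤ 4 * (x * Fintype.card S) := by linarith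
      _ = _ := by rw [hx]; ring

end Events

/-! ### Mirror ascent with the unnormalized entropy -/

section Mirror

/-- The summand `y ln (y / v) - y + v` of the unnormalized relative entropy. -/
def klTerm (y v : ℝ) : ℝ := y * Real.log (y / v) - y + v

lemma klTerm_nonneg {y v : ℝ} (hy : 0 ≤ y) (hv : 0 ≤ v) (h : v = 0 → y = 0) : 0 ≤ klTerm y v := by
  unfold klTerm
  rcases hy.eq_or_lt with rfl | hy
  · simpa using hv
  · have hv' : 0 < v := lt_of_le_of_ne hv fun h0 => hy.ne' (h h0.symm)
    have h1 := Real.one_sub_inv_le_log_of_pos (div_pos hy hv')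
    have h2 : y * (1 - (y / v)⁻¹) = y - v := by field_simp
    nlinarith [mul_le_mul_of_nonneg_left h1 hy.le]

/-- The gain of one coordinate is at most that of the unconstrained exponential update. -/
lemma gain_sub_klTerm_le {b y v : ℝ} (hy : 0 ≤ y) (hv : 0 ≤ v) (h : v = 0 → y = 0) :
    b * y - klTerm y v ≤ v * (Real.exp b - 1) := by
  unfold klTerm
  rcases hy.eq_or_lt with rfl | hy
  · have := mul_nonneg hv (Real.exp_pos b).le
    simp; linarith
  · have hv' : 0 < v := lt_of_le_of_ne hv fun h0 => hy.ne' (h h0.symm)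
    have h1 := Real.add_one_le_exp (b - Real.log (y / v))
    rw [Real.exp_sub, Real.exp_log (div_pos hy hv')] at h1
    have h2 : y * (Real.exp b / (y / v)) = v * Real.exp b := by field_simp
    nlinarith [mul_le_mul_of_nonneg_left h1 hy.le]

/-- The relative entropy is its own Bregman divergence. -/
lemma klTerm_convexComb {α y u v : ℝ} (hα0 : 0 < α) (hα1 : α < 1) (hy : 0 ≤ y) (hu : 0 ≤ u)
    (h : v = 0 → y = 0 ∧ u = 0) :
    (1 - α) * klTerm y v + α * klTerm u v
      = klTerm ((1 - α) * y + α * u) v + (1 - α) * klTerm y ((1 - α) * y + α * u)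
        + α * klTerm u ((1 - α) * y + α * u) := by
  set z := (1 - α) * y + α * u with hz
  have key : ∀ c : ℝ, 0 ≤ c → (z = 0 → c = 0) →
      c * Real.log (c / v) = c * Real.log (c / z) + c * Real.log (z / v) := by
    intro c hc hcz
    rcases hc.eq_or_lt with rfl | hc
    · simp
    · have hz0 : z ≠ 0 := fun h0 => hc.ne' (hcz h0)
      by_cases hv0 : v = 0
      · obtain ⟨rfl, rfl⟩ := h hv0
        exact absurd (by simp [hz]) hz0
      · rw [← mul_add, ← Real.log_mul (div_ne_zero hc.ne' hz0) (div_ne_zero hz0 hv0)]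
        congr 2; field_simp
  have hα1' : 0 < 1 - α := by linarith
  have hy1 : 0 ≤ (1 - α) * y := mul_nonneg hα1'.le hy
  have hu1 : 0 ≤ α * u := mul_nonneg hα0.le hu
  have h1 := key y hy fun h0 => by
    have : (1 - α) * y = 0 := by linarith
    exact (mul_eq_zero.1 this).resolve_left hα1'.ne'
  have h2 := key u hu fun h0 => by
    have : α * u = 0 := by linarith
    exact (mul_eq_zero.1 this).resolve_left hα0.ne'
  unfold klTerm
  rw [h1, h2]
  have : z * Real.log (z / v)
      = (1 - α) * (y * Real.log (z / v)) + α * (u * Real.log (z / v)) := by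
    nth_rewrite 1 [hz]; ring
  rw [this, hz]
  ring

variable {ι : Type*} [Fintype ι]

/-- Three-point inequality of mirror ascent: at a maximizer `μ` over the segment from `μ` to `u`,
the objective exceeds its value at `u` by the divergence from `u` to `μ`. The divergence can only
be finite if `μ` charges every coordinate that `u` charges. -/
lemma mirror_three_point {b ν μ u : ι → ℝ} (hμ : ∀ x, 0 ≤ μ x)
    (hu : ∀ x, 0 ≤ u x) (hsupp : ∀ x, ν x = 0 → μ x = 0 ∧ u x = 0)
    (hmax : ∀ α : ℝ, 0 < α → α < 1 →
      ∑ x, (b x * ((1 - α) * μ x + α * u x) - klTerm ((1 - α) * μ x + α * u x) (ν x))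
        ≤ ∑ x, (b x * μ x - klTerm (μ x) (ν x))) :
    (∀ x, 0 < u x → 0 < μ x) ∧
      ∑ x, (b x * u x - klTerm (u x) (ν x)) + ∑ x, klTerm (u x) (μ x)
        ≤ ∑ x, (b x * μ x - klTerm (μ x) (ν x)) := by
  set C := ∑ x, (b x * μ x - klTerm (μ x) (ν x)) - ∑ x, (b x * u x - klTerm (u x) (ν x)) with hC
  have hknn : ∀ α : ℝ, 0 < α → α < 1 → ∀ x,
      0 ≤ klTerm (u x) ((1 - α) * μ x + α * u x) ∧ 0 ≤ klTerm (μ x) ((1 - α) * μ x + α * u x) := by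
    intro α h0 h1 x
    have h1' : 0 < 1 - α := by linarith
    have hm := mul_nonneg h1'.le (hμ x)
    have hm' := mul_nonneg h0.le (hu x)
    refine ⟨klTerm_nonneg (hu x) (by linarith) fun hz => ?_,
      klTerm_nonneg (hμ x) (by linarith) fun hz => ?_⟩
    · have : α * u x = 0 := by linarith
      exact (mul_eq_zero.1 this).resolve_left h0.ne'
    · have : (1 - α) * μ x = 0 := by linarith
      exact (mul_eq_zero.1 this).resolve_left h1'.ne'
  have hkey : ∀ α : ℝ, 0 < α → α < 1 → ∑ x, klTerm (u x) ((1 - α) * μ x + α * u x) ≤ C := by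
    intro α h0 h1
    have h2 := hmax α h0 h1
    have h3 : (1 - α) * ∑ x, (b x * μ x - klTerm (μ x) (ν x))
          + α * ∑ x, (b x * u x - klTerm (u x) (ν x))
          + α * ∑ x, klTerm (u x) ((1 - α) * μ x + α * u x)
        ≤ ∑ x, (b x * ((1 - α) * μ x + α * u x) - klTerm ((1 - α) * μ x + α * u x) (ν x)) := by
      simp only [Finset.mul_sum, ← Finset.sum_add_distrib]
      refine Finset.sum_le_sum fun x _ => ?_
      have e := klTerm_convexComb h0 h1 (hμ x) (hu x) (hsupp x)
      have := mul_nonneg (sub_nonneg.2 h1.le) (hknn α h0 h1 x).2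
      linarith
    have h4 : α * ∑ x, klTerm (u x) ((1 - α) * μ x + α * u x) ≤ α * C := by
      rw [hC]; linarith
    exact le_of_mul_le_mul_left h4 h0
  have hpos : ∀ x, 0 < u x → 0 < μ x := by
    intro x hx
    refine lt_of_le_of_ne (hμ x) fun h0 => ?_
    -- at a coordinate lost by `μ` the divergence grows like `u ln (1 / α)`
    set M := |C| / u x + 2 with hM
    have hM0 : 0 < M := by positivity
    have hM1 : Real.exp (-M) < 1 := by simpa using hM0
    have h1 := hkey (Real.exp (-M)) (Real.exp_pos _) hM1
    have h2 := (Finset.single_le_sum (f := fun x => klTerm (u x)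
      ((1 - Real.exp (-M)) * μ x + Real.exp (-M) * u x)) (fun x _ =>
      (hknn _ (Real.exp_pos _) hM1 x).1) (Finset.mem_univ x)).trans h1
    have h3 : u x / (Real.exp (-M) * u x) = Real.exp M := by
      rw [Real.exp_neg]; field_simp
    simp only [klTerm, ← h0, mul_zero, zero_add, h3, Real.log_exp] at h2
    have h4 : u x * M = |C| + 2 * u x := by rw [hM]; field_simp
    have h5 := mul_pos (Real.exp_pos (-M)) hx
    have := le_abs_self C
    linarith
  refine ⟨hpos, ?_⟩
  have hlim : Filter.Tendsto (fun α : ℝ => ∑ x, klTerm (u x) ((1 - α) * μ x + α * u x))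
      (nhdsWithin 0 (Set.Ioi 0)) (nhds (∑ x, klTerm (u x) (μ x))) := by
    refine tendsto_finsetSum _ fun x _ => ?_
    have hcont : ContinuousAt (fun α : ℝ => klTerm (u x) ((1 - α) * μ x + α * u x)) 0 := by
      unfold klTerm
      rcases (hu x).eq_or_lt with h0 | h0
      · simp only [← h0, zero_mul]
        fun_prop
      · have hm := hpos x h0
        have hz : (1 - (0 : ℝ)) * μ x + 0 * u x ≠ 0 := by simpa using hm.ne'
        have hd : u x / ((1 - (0 : ℝ)) * μ x + 0 * u x) ≠ 0 := div_ne_zero h0.ne' hz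
        have hc : ContinuousAt (fun α : ℝ => u x / ((1 - α) * μ x + α * u x)) 0 :=
          ContinuousAt.div (by fun_prop) (by fun_prop) hz
        exact ((continuousAt_const.mul (hc.log hd)).sub continuousAt_const).add (by fun_prop)
    have := hcont.tendsto
    simp only [sub_zero, one_mul, zero_mul, add_zero] at this
    exact this.mono_left nhdsWithin_le_nhds
  have hle := le_of_tendsto hlim (b := C) (by
    filter_upwards [Ioo_mem_nhdsGT (zero_lt_one (α := ℝ))] with α hα
    exact hkey α hα.1 hα.2)
  linarith

/-- One step of mirror ascent with gains in `[0, 1]`. -/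
lemma mirror_step_regret {b ν μ u : ι → ℝ} (hν : ∀ x, 0 ≤ ν x) (hμ : ∀ x, 0 ≤ μ x)
    (hu : ∀ x, 0 ≤ u x) (hsupp : ∀ x, ν x = 0 → μ x = 0 ∧ u x = 0)
    (hb : ∀ x, 0 ≤ b x ∧ b x ≤ 1)
    (hmax : ∀ α : ℝ, 0 < α → α < 1 →
      ∑ x, (b x * ((1 - α) * μ x + α * u x) - klTerm ((1 - α) * μ x + α * u x) (ν x))
        ≤ ∑ x, (b x * μ x - klTerm (μ x) (ν x))) :
    ∑ x, b x * u x + ∑ x, klTerm (u x) (μ x) ≤ 2 * ∑ x, b x * ν x + ∑ x, klTerm (u x) (ν x) := by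
  have h1 := (mirror_three_point hμ hu hsupp hmax).2
  have h2 : ∑ x, (b x * μ x - klTerm (μ x) (ν x)) ≤ 2 * ∑ x, b x * ν x := by
    rw [Finset.mul_sum]
    refine Finset.sum_le_sum fun x _ => ?_
    refine (gain_sub_klTerm_le (hμ x) (hν x) fun h => (hsupp x h).1).trans ?_
    have h3 : Real.exp (b x) - 1 ≤ 2 * b x := by
      have := (abs_le.1 (Real.abs_exp_sub_one_sub_id_le
        (abs_le.2 ⟨by linarith [(hb x).1], (hb x).2⟩))).2
      nlinarith [(hb x).1, (hb x).2]
    nlinarith [hν x]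
  rw [Finset.sum_sub_distrib] at h1
  linarith

end Mirror

/-! ### Regret of the exploration algorithm -/

section Iterates

variable {S A : Type*} [Fintype S] [Fintype A] {H : ℕ}

lemma sum_quad (f : Fin H → S → A → S → ℝ) :
    ∑ h, ∑ s, ∑ a, ∑ s', f h s a s'
      = ∑ x : Fin H × S × A × S, f x.1 x.2.1 x.2.2.1 x.2.2.2 := by
  simp only [Fintype.sum_prod_type]

lemma entropyDiv_eq_sum_klTerm (μ ν : Fin H → S → A → S → ℝ) :
    entropyDiv μ ν = ∑ x : Fin H × S × A × S,
      klTerm (μ x.1 x.2.1 x.2.2.1 x.2.2.2) (ν x.1 x.2.1 x.2.2.1 x.2.2.2) := by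
  simp only [entropyDiv, klTerm, Finset.sum_add_distrib, Finset.sum_sub_distrib,
    Fintype.sum_prod_type]

lemma omdObjective_eq_sum (η : ℝ) (r : Fin H → S → A → ℝ) (ν μ : Fin H → S → A → S → ℝ) :
    omdObjective η r ν μ = ∑ x : Fin H × S × A × S,
      (η * r x.1 x.2.1 x.2.2.1 * μ x.1 x.2.1 x.2.2.1 x.2.2.2
        - klTerm (μ x.1 x.2.1 x.2.2.1 x.2.2.2) (ν x.1 x.2.1 x.2.2.1 x.2.2.2)) := by
  rw [Finset.sum_sub_distrib, omdObjective, entropyDiv_eq_sum_klTerm, sum_quad, Finset.mul_sum]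
  congr 1
  exact Finset.sum_congr rfl fun x _ => by ring

lemma continuous_klTerm_left (v : ℝ) : Continuous fun y => klTerm y v := by
  unfold klTerm
  by_cases hv : v = 0
  · simp only [hv, div_zero, Real.log_zero, mul_zero]; fun_prop
  · have h : (fun y : ℝ => y * Real.log (y / v)) = fun y => v * (y / v * Real.log (y / v)) := by
      funext y; field_simp
    have h1 : Continuous fun y : ℝ => y * Real.log (y / v) := by
      rw [h]
      exact continuous_const.mul (Real.continuous_mul_log.comp (continuous_id.div_const v))
    exact (h1.sub continuous_id).add continuous_const

lemma continuous_omdObjective (η : ℝ) (r : Fin H → S → A → ℝ) (ν : Fin H → S → A → S → ℝ) :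
    Continuous (omdObjective η r ν) := by
  have : omdObjective η r ν = fun μ => ∑ x : Fin H × S × A × S,
      (η * r x.1 x.2.1 x.2.2.1 * μ x.1 x.2.1 x.2.2.1 x.2.2.2
        - klTerm (μ x.1 x.2.1 x.2.2.1 x.2.2.2) (ν x.1 x.2.1 x.2.2.1 x.2.2.2)) :=
    funext fun μ => omdObjective_eq_sum η r ν μ
  rw [this]
  refine continuous_finsetSum _ fun x _ => ?_
  have h : Continuous fun μ : Fin H → S → A → S → ℝ => μ x.1 x.2.1 x.2.2.1 x.2.2.2 := by fun_prop
  exact (continuous_const.mul h).sub ((continuous_klTerm_left _).comp h)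

/-- Over a nonempty compact set the maximum in the mirror-ascent step is attained, so the step does
not fall back on its default value. -/
lemma omdStep_spec {Λ : Set (Fin H → S → A → S → ℝ)} (hc : IsCompact Λ) (hne : Λ.Nonempty) (η : ℝ)
    (r : Fin H → S → A → ℝ) (ν : Fin H → S → A → S → ℝ) :
    omdStep Λ η r ν ∈ Λ ∧ IsMaxOn (omdObjective η r ν) Λ (omdStep Λ η r ν) := by
  have hex : ∃ μ ∈ Λ, IsMaxOn (omdObjective η r ν) Λ μ :=
    hc.exists_isMaxOn hne (continuous_omdObjective η r ν).continuousOn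
  rw [omdStep, dif_pos hex]
  exact hex.choose_spec

variable [DecidableEq S] [DecidableEq A]

lemma IsConfOccupancy.isFlow {K : ℕ} {ρ : S → ℝ} {ℓ : ℝ} {D : Fin K → Traj S A H} {t : ℕ}
    {μ : Fin H → S → A → S → ℝ} (hμ : IsConfOccupancy ρ ℓ D t μ) : IsFlow ρ μ :=
  ⟨hμ.init, hμ.flow⟩

lemma IsConfOccupancy.le_one {K : ℕ} {ρ : S → ℝ} {ℓ : ℝ} {D : Fin K → Traj S A H} {t : ℕ}
    {μ : Fin H → S → A → S → ℝ} (hμ : IsConfOccupancy ρ ℓ D t μ) (h : Fin H) (s : S) (a : A)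
    (s' : S) : μ h s a s' ≤ 1 := by
  rw [← hμ.total h]
  have h1 := Finset.single_le_sum (fun x _ => hμ.nonneg h s a x) (Finset.mem_univ s')
  have h2 := Finset.single_le_sum (f := fun a => ∑ s', μ h s a s')
    (fun x _ => Finset.sum_nonneg fun y _ => hμ.nonneg h s x y) (Finset.mem_univ a)
  have h3 := Finset.single_le_sum (f := fun s => ∑ a, ∑ s', μ h s a s')
    (fun w _ => Finset.sum_nonneg fun x _ => Finset.sum_nonneg fun y _ => hμ.nonneg h w x y)
    (Finset.mem_univ s)
  exact h1.trans (h2.trans h3)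

lemma isCompact_confOccupancy {K : ℕ} (ρ : S → ℝ) (ℓ : ℝ) (D : Fin K → Traj S A H) (t : ℕ) :
    IsCompact {μ | IsConfOccupancy ρ ℓ D t μ} := by
  refine IsCompact.of_isClosed_subset (isCompact_Icc (a := (0 : Fin H → S → A → S → ℝ)) (b := 1))
    ?_ ?_
  · have heq : {μ | IsConfOccupancy ρ ℓ D t μ}
        = {μ | ∀ h s a s', 0 ≤ μ h s a s'} ∩ {μ | ∀ h, ∑ s, ∑ a, ∑ s', μ h s a s' = 1}
          ∩ {μ | ∀ h : Fin H, (h : ℕ) = 0 → ∀ s, ∑ a, ∑ s', μ h s a s' = ρ s}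
          ∩ {μ | ∀ h h' : Fin H, (h' : ℕ) = h + 1 → ∀ s,
              ∑ x, ∑ a, μ h x a s = ∑ a, ∑ s', μ h' s a s'}
          ∩ {μ | ∀ h s a s', μ h s a s'
              ≤ (empKernel D t h s a s' + confRadius ℓ D t h s a s') * ∑ x, μ h s a x}
          ∩ {μ | ∀ h s a s', (empKernel D t h s a s' - confRadius ℓ D t h s a s')
              * ∑ x, μ h s a x ≤ μ h s a s'} := by
      ext μ
      constructor
      · rintro ⟨h1, h2, h3, h4, h5, h6⟩
        exact ⟨⟨⟨⟨⟨h1, h2⟩, h3⟩, h4⟩, h5⟩, h6⟩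
      · rintro ⟨⟨⟨⟨⟨h1, h2⟩, h3⟩, h4⟩, h5⟩, h6⟩
        exact ⟨h1, h2, h3, h4, h5, h6⟩
    rw [heq]
    simp only [Set.ofPred_forall]
    refine ((((IsClosed.inter ?_ ?_).inter ?_).inter ?_).inter ?_).inter ?_
    · exact isClosed_iInter fun h => isClosed_iInter fun s => isClosed_iInter fun a =>
        isClosed_iInter fun s' => isClosed_le (by fun_prop) (by fun_prop)
    · exact isClosed_iInter fun h => isClosed_eq (by fun_prop) (by fun_prop)
    · exact isClosed_iInter fun h => isClosed_iInter fun _ => isClosed_iInter fun s =>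
        isClosed_eq (by fun_prop) (by fun_prop)
    · exact isClosed_iInter fun h => isClosed_iInter fun h' => isClosed_iInter fun _ =>
        isClosed_iInter fun s => isClosed_eq (by fun_prop) (by fun_prop)
    · exact isClosed_iInter fun h => isClosed_iInter fun s => isClosed_iInter fun a =>
        isClosed_iInter fun s' => isClosed_le (by fun_prop) (by fun_prop)
    · exact isClosed_iInter fun h => isClosed_iInter fun s => isClosed_iInter fun a =>
        isClosed_iInter fun s' => isClosed_le (by fun_prop) (by fun_prop)
  · intro μ hμ
    exact ⟨fun h s a s' => hμ.nonneg h s a s', fun h s a s' => hμ.le_one h s a s'⟩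

lemma IsConfOccupancy.convexComb {K : ℕ} {ρ : S → ℝ} {ℓ : ℝ} {D : Fin K → Traj S A H} {t : ℕ}
    {μ u : Fin H → S → A → S → ℝ} (hμ : IsConfOccupancy ρ ℓ D t μ) (hu : IsConfOccupancy ρ ℓ D t u)
    {α : ℝ} (h0 : 0 ≤ α) (h1 : α ≤ 1) :
    IsConfOccupancy ρ ℓ D t (fun h s a s' => (1 - α) * μ h s a s' + α * u h s a s') := by
  have h1' : 0 ≤ 1 - α := by linarith
  constructor
  · intro h s a s'
    exact add_nonneg (mul_nonneg h1' (hμ.nonneg h s a s')) (mul_nonneg h0 (hu.nonneg h s a s'))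
  · intro h
    simp only [Finset.sum_add_distrib, ← Finset.mul_sum, hμ.total, hu.total]; ring
  · intro h hh s
    simp only [Finset.sum_add_distrib, ← Finset.mul_sum, hμ.init h hh, hu.init h hh]; ring
  · intro h h' hh s
    simp only [Finset.sum_add_distrib, ← Finset.mul_sum, hμ.flow h h' hh, hu.flow h h' hh]
  · intro h s a s'
    simp only [Finset.sum_add_distrib, ← Finset.mul_sum]
    have e1 := mul_le_mul_of_nonneg_left (hμ.upper h s a s') h1'
    have e2 := mul_le_mul_of_nonneg_left (hu.upper h s a s') h0
    linarith
  · intro h s a s'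
    simp only [Finset.sum_add_distrib, ← Finset.mul_sum]
    have e1 := mul_le_mul_of_nonneg_left (hμ.lower h s a s') h1'
    have e2 := mul_le_mul_of_nonneg_left (hu.lower h s a s') h0
    linarith

/-- An occupancy measure of a kernel that lies in the confidence set is feasible. -/
lemma IsOccupancy.isConfOccupancy {K : ℕ} {ρ : S → ℝ} (hρ : ∑ s, ρ s = 1) {ℓ : ℝ}
    {D : Fin K → Traj S A H} {t : ℕ} {P : Fin H → S → A → S → ℝ} (hP : IsKernel P)
    {u : Fin H → S → A → ℝ} (hu : IsOccupancy ρ P u)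
    (hconf : ∀ h s a s', |empKernel D t h s a s' - P h s a s'| ≤ confRadius ℓ D t h s a s') :
    IsConfOccupancy ρ ℓ D t (fun h s a s' => u h s a * P h s a s') := by
  have hsum : ∀ h s a, ∑ s', u h s a * P h s a s' = u h s a := by
    intro h s a; rw [← Finset.mul_sum, (hP _ _ _).2, mul_one]
  refine ⟨fun h s a s' => mul_nonneg (hu.nonneg h s a) ((hP _ _ _).1 _), hu.isFlow.total hρ,
    hu.isFlow.init, hu.isFlow.flow, ?_, ?_⟩
  · intro h s a s'
    rw [hsum, mul_comm]
    exact mul_le_mul_of_nonneg_right (by linarith [(abs_le.1 (hconf h s a s')).1])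
      (hu.nonneg h s a)
  · intro h s a s'
    rw [hsum, mul_comm (u h s a)]
    exact mul_le_mul_of_nonneg_right (by linarith [(abs_le.1 (hconf h s a s')).2])
      (hu.nonneg h s a)

/-- The empirical kernel mixed with the uniform one. The weight `1 / max {n, 1}` of the latter is
within the confidence radius, and is one where there are no data and the empirical kernel, being
zero, is not a probability distribution. -/
def smoothKernel {K : ℕ} (D : Fin K → Traj S A H) (t : ℕ) (h : Fin H) (s : S) (a : A) (s' : S) :
    ℝ :=
  (1 - 1 / max (visitCount D t h s a : ℝ) 1) * empKernel D t h s a s'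
    + 1 / max (visitCount D t h s a : ℝ) 1 * (1 / Fintype.card S)

omit [Fintype A] in
lemma empKernel_nonneg {K : ℕ} (D : Fin K → Traj S A H) (t : ℕ) (h : Fin H) (s : S) (a : A)
    (s' : S) : 0 ≤ empKernel D t h s a s' := by
  unfold empKernel; positivity

omit [Fintype A] in
lemma sum_empKernel_eq_one {K : ℕ} (D : Fin K → Traj S A H) (t : ℕ) (h : Fin H) (s : S) (a : A)
    (hn : visitCount D t h s a ≠ 0) : ∑ s', empKernel D t h s a s' = 1 := by
  have hn1 : (1 : ℝ) ≤ visitCount D t h s a := by exact_mod_cast Nat.one_le_iff_ne_zero.2 hn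
  simp only [empKernel]
  rw [← Finset.sum_div, max_eq_right hn1, visitCount]
  rw [visitCount] at hn1
  push_cast at hn1 ⊢
  exact div_self (by linarith)

omit [Fintype A] in
lemma sum_empKernel_le_one {K : ℕ} (D : Fin K → Traj S A H) (t : ℕ) (h : Fin H) (s : S) (a : A) :
    ∑ s', empKernel D t h s a s' ≤ 1 := by
  by_cases hn : visitCount D t h s a = 0
  · have : ∀ s', transCount D t h s a s' = 0 := fun s' => by
      have := transCount_le_visitCount D t h s a s'; omega
    simp [empKernel, this]
  · exact (sum_empKernel_eq_one D t h s a hn).le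

omit [Fintype A] in
lemma empKernel_le_one {K : ℕ} (D : Fin K → Traj S A H) (t : ℕ) (h : Fin H) (s : S) (a : A)
    (s' : S) : empKernel D t h s a s' ≤ 1 :=
  (Finset.single_le_sum (fun x _ => empKernel_nonneg D t h s a x) (Finset.mem_univ s')).trans
    (sum_empKernel_le_one D t h s a)

omit [Fintype A] in
lemma smoothKernel_spec [Nonempty S] {K : ℕ} (D : Fin K → Traj S A H) (t : ℕ) {ℓ : ℝ}
    (hℓ : 1 ≤ ℓ) :
    IsKernel (smoothKernel D t) ∧ (∀ h s a s', 0 < smoothKernel D t h s a s') ∧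
      ∀ h s a s', |empKernel D t h s a s' - smoothKernel D t h s a s'|
        ≤ confRadius ℓ D t h s a s' := by
  have hS : (0 : ℝ) < Fintype.card S := by exact_mod_cast Fintype.card_pos
  have hS1 : (1 : ℝ) / Fintype.card S ≤ 1 := by
    rw [div_le_one hS]; exact_mod_cast Fintype.card_pos
  have hpos : ∀ h s a s', 0 < smoothKernel D t h s a s' := by
    intro h s a s'
    have hm : (1 : ℝ) ≤ max (visitCount D t h s a : ℝ) 1 := le_max_right _ _
    have h1 : 1 / max (visitCount D t h s a : ℝ) 1 ≤ 1 := by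
      rw [div_le_one (by linarith)]; exact hm
    exact add_pos_of_nonneg_of_pos (mul_nonneg (by linarith) (empKernel_nonneg D t h s a s'))
      (by positivity)
  refine ⟨fun h s a => ⟨fun s' => (hpos h s a s').le, ?_⟩, hpos, ?_⟩
  · simp only [smoothKernel, Finset.sum_add_distrib, ← Finset.mul_sum]
    have : ∑ _s' : S, (1 : ℝ) / Fintype.card S = 1 := by
      simp
    rw [this]
    by_cases hn : visitCount D t h s a = 0
    · simp [hn]
    · rw [sum_empKernel_eq_one D t h s a hn]; ring
  · intro h s a s'
    have hm : (1 : ℝ) ≤ max (visitCount D t h s a : ℝ) 1 := le_max_right _ _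
    unfold smoothKernel confRadius
    set m := max (visitCount D t h s a : ℝ) 1
    have e : empKernel D t h s a s'
        - ((1 - 1 / m) * empKernel D t h s a s' + 1 / m * (1 / Fintype.card S))
        = 1 / m * (empKernel D t h s a s' - 1 / Fintype.card S) := by ring
    have h0 : 0 < 1 / m := by positivity
    rw [e, abs_mul, abs_of_pos h0]
    have h1 : |empKernel D t h s a s' - 1 / Fintype.card S| ≤ 1 := by
      have := empKernel_nonneg D t h s a s'
      have := empKernel_le_one D t h s a s'
      have : (0 : ℝ) ≤ 1 / Fintype.card S := by positivity
      rw [abs_le]; constructor <;> linarith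
    have h2 : 1 / m ≤ 14 * ℓ / (3 * m) := by
      rw [div_le_div_iff₀ (by linarith) (by linarith)]
      nlinarith
    have h3 : 0 ≤ 2 * √(empKernel D t h s a s' * ℓ / m) := by positivity
    nlinarith

omit [Fintype S] [DecidableEq S] [DecidableEq A] in
lemma uniform_isPolicy [Nonempty A] :
    IsPolicy (fun (_ : Fin H) (_ : S) (_ : A) => 1 / (Fintype.card A : ℝ)) := by
  intro h s
  refine ⟨fun a => by positivity, by simp⟩

omit [DecidableEq S] [DecidableEq A] in
lemma stateDist_pos {ρ : S → ℝ} (hρ : ρ ∈ stdSimplex ℝ S) {P : Fin H → S → A → S → ℝ}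
    (hP : IsKernel P) (hPpos : ∀ h s a s', 0 < P h s a s') {π : Fin H → S → A → ℝ}
    (hπ : IsPolicy π) (hπpos : ∀ h s a, 0 < π h s a) [Nonempty S] [Nonempty A]
    (h : Fin (H + 1)) (s : S) (hs : (h : ℕ) = 0 → 0 < ρ s) : 0 < stateDist ρ P π h s := by
  have hsucc : ∀ (i : Fin H), (∃ x, 0 < stateDist ρ P π i.castSucc x) →
      ∀ s', 0 < stateDist ρ P π i.succ s' := by
    rintro i ⟨x, hx⟩ s'
    rw [stateDist_succ]
    have hnn : ∀ y a, 0 ≤ occ ρ P π i y a * P i y a s' := fun y a =>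
      mul_nonneg (mul_nonneg (stateDist_nonneg hρ.1 hP hπ _ _) (hπpos _ _ _).le)
        (hPpos _ _ _ _).le
    obtain ⟨a⟩ := ‹Nonempty A›
    refine Finset.sum_pos' (fun y _ => Finset.sum_nonneg fun a _ => hnn y a)
      ⟨x, Finset.mem_univ x, Finset.sum_pos' (fun a _ => hnn x a) ⟨a, Finset.mem_univ a, ?_⟩⟩
    exact mul_pos (mul_pos hx (hπpos _ _ _)) (hPpos _ _ _ _)
  have hex : ∀ h : Fin (H + 1), ∃ x, 0 < stateDist ρ P π h x := by
    intro h
    induction h using Fin.induction with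
    | zero =>
      by_contra hc
      push Not at hc
      have : ∑ s, ρ s ≤ 0 := Finset.sum_nonpos fun s _ => hc s
      rw [hρ.2] at this
      linarith
    | succ i ih =>
      obtain ⟨x⟩ := ‹Nonempty S›
      exact ⟨x, hsucc i ih x⟩
  induction h using Fin.cases with
  | zero => exact hs rfl
  | succ i => exact hsucc i (hex _) s

/-- Every confidence set contains an occupancy measure that charges every coordinate not excluded
by the initial distribution. -/
lemma exists_pos_confOccupancy [Nonempty S] [Nonempty A] {ρ : S → ℝ} (hρ : ρ ∈ stdSimplex ℝ S)
    {ℓ : ℝ} (hℓ : 1 ≤ ℓ) {K : ℕ} (D : Fin K → Traj S A H) (t : ℕ) :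
    ∃ w, IsConfOccupancy ρ ℓ D t w ∧
      ∀ (h : Fin H) s a s', ((h : ℕ) = 0 → 0 < ρ s) → 0 < w h s a s' := by
  obtain ⟨hP, hPpos, hconf⟩ := smoothKernel_spec D t hℓ
  have hApos : 0 < 1 / (Fintype.card A : ℝ) := by
    have : (0 : ℝ) < Fintype.card A := by exact_mod_cast Fintype.card_pos
    positivity
  refine ⟨_, (occ_isOccupancy hρ.1 hP uniform_isPolicy).isConfOccupancy hρ.2 hP hconf, ?_⟩
  intro h s a s' hs
  exact mul_pos (mul_pos (stateDist_pos hρ hP hPpos uniform_isPolicy (fun _ _ _ => hApos) _ _ hs)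
    hApos) (hPpos _ _ _ _)

lemma IsConfOccupancy.eq_zero {K : ℕ} {ρ : S → ℝ} {ℓ : ℝ} {D : Fin K → Traj S A H} {t : ℕ}
    {μ : Fin H → S → A → S → ℝ} (hμ : IsConfOccupancy ρ ℓ D t μ) {h : Fin H} {s : S}
    (hs : ¬ ((h : ℕ) = 0 → 0 < ρ s)) (a : A) (s' : S) : μ h s a s' = 0 := by
  push Not at hs
  have h1 := hμ.init h hs.1 s
  refine le_antisymm ?_ (hμ.nonneg h s a s')
  calc μ h s a s' ≤ ∑ s', μ h s a s' :=
        Finset.single_le_sum (fun x _ => hμ.nonneg h s a x) (Finset.mem_univ s')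
    _ ≤ ∑ a, ∑ s', μ h s a s' :=
        Finset.single_le_sum (f := fun a => ∑ s', μ h s a s')
          (fun x _ => Finset.sum_nonneg fun y _ => hμ.nonneg h s x y) (Finset.mem_univ a)
    _ ≤ 0 := h1.le.trans hs.2

/-- The iterates charge every coordinate not excluded by the initial distribution, so that the
divergences of the algorithm are genuine; from the second one on they are feasible. -/
lemma occIterate_spec [Nonempty S] [Nonempty A] {ρ : S → ℝ} (hρ : ρ ∈ stdSimplex ℝ S)
    {ℓ : ℝ} (hℓ : 1 ≤ ℓ) (c η : ℝ) {K : ℕ} (D : Fin K → Traj S A H) (t : ℕ) :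
    (∀ h s a s', 0 ≤ occIterate ρ ℓ c η D t h s a s') ∧
    (∀ (h : Fin H) s a s', ((h : ℕ) = 0 → 0 < ρ s) → 0 < occIterate ρ ℓ c η D t h s a s') ∧
    (∀ h, ∑ s, ∑ a, ∑ s', occIterate ρ ℓ c η D t h s a s' = 1) ∧
    (t ≠ 0 → IsConfOccupancy ρ ℓ D t (occIterate ρ ℓ c η D t)) := by
  induction t with
  | zero =>
    have hS : (0 : ℝ) < Fintype.card S := by exact_mod_cast Fintype.card_pos
    have hA : (0 : ℝ) < Fintype.card A := by exact_mod_cast Fintype.card_pos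
    have hp : (0 : ℝ) < 1 / ((Fintype.card S : ℝ) ^ 2 * Fintype.card A) := by positivity
    refine ⟨fun _ _ _ _ => hp.le, fun _ _ _ _ _ => hp, fun _ => ?_, fun h => absurd rfl h⟩
    simp only [occIterate, Finset.sum_const, Finset.card_univ, nsmul_eq_mul]
    field_simp
  | succ t ih =>
    obtain ⟨w, hw, hwpos⟩ := exists_pos_confOccupancy hρ hℓ D (t + 1)
    obtain ⟨hmem, hmax⟩ := omdStep_spec (isCompact_confOccupancy ρ ℓ D (t + 1)) ⟨w, hw⟩ η
      (intrinsicReward c D t) (occIterate ρ ℓ c η D t)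
    change IsConfOccupancy ρ ℓ D (t + 1) (occIterate ρ ℓ c η D (t + 1)) at hmem
    refine ⟨hmem.nonneg, ?_, hmem.total, fun _ => hmem⟩
    intro h s a s' hs
    refine (mirror_three_point (ι := Fin H × S × A × S)
      (b := fun x => η * intrinsicReward c D t x.1 x.2.1 x.2.2.1)
      (ν := fun x => occIterate ρ ℓ c η D t x.1 x.2.1 x.2.2.1 x.2.2.2)
      (μ := fun x => occIterate ρ ℓ c η D (t + 1) x.1 x.2.1 x.2.2.1 x.2.2.2)
      (u := fun x => w x.1 x.2.1 x.2.2.1 x.2.2.2)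
      (fun x => hmem.nonneg _ _ _ _) (fun x => hw.nonneg _ _ _ _)
      ?_ ?_).1 (h, s, a, s') (hwpos h s a s' hs)
    · intro x hx
      have : ¬ ((x.1 : ℕ) = 0 → 0 < ρ x.2.1) := fun hc =>
        (ih.2.1 x.1 x.2.1 x.2.2.1 x.2.2.2 hc).ne' hx
      exact ⟨hmem.eq_zero this _ _, hw.eq_zero this _ _⟩
    · intro α h0 h1
      have := hmax (hmem.convexComb hw h0.le h1.le)
      simp only [Set.mem_ofPred_eq, omdObjective_eq_sum] at this
      exact this

/-- One step of the online algorithm against a feasible comparator. -/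
lemma occIterate_step_regret [Nonempty S] [Nonempty A] {ρ : S → ℝ} (hρ : ρ ∈ stdSimplex ℝ S)
    {ℓ : ℝ} (hℓ : 1 ≤ ℓ) {c η : ℝ} {K : ℕ} (D : Fin K → Traj S A H) (t : ℕ)
    (hη : ∀ h s a, 0 ≤ η * intrinsicReward c D t h s a ∧ η * intrinsicReward c D t h s a ≤ 1)
    {u : Fin H → S → A → S → ℝ} (hu : IsConfOccupancy ρ ℓ D (t + 1) u) :
    η * (∑ h, ∑ s, ∑ a, ∑ s', u h s a s' * intrinsicReward c D t h s a)
        + entropyDiv u (occIterate ρ ℓ c η D (t + 1))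
      ≤ 2 * (η * ∑ h, ∑ s, ∑ a, ∑ s',
          occIterate ρ ℓ c η D t h s a s' * intrinsicReward c D t h s a)
        + entropyDiv u (occIterate ρ ℓ c η D t) := by
  obtain ⟨hmem, hmax⟩ := omdStep_spec (isCompact_confOccupancy ρ ℓ D (t + 1)) ⟨u, hu⟩ η
    (intrinsicReward c D t) (occIterate ρ ℓ c η D t)
  change IsConfOccupancy ρ ℓ D (t + 1) (occIterate ρ ℓ c η D (t + 1)) at hmem
  have ih := occIterate_spec hρ hℓ c η D t
  have key := mirror_step_regret (ι := Fin H × S × A × S)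
      (b := fun x => η * intrinsicReward c D t x.1 x.2.1 x.2.2.1)
      (ν := fun x => occIterate ρ ℓ c η D t x.1 x.2.1 x.2.2.1 x.2.2.2)
      (μ := fun x => occIterate ρ ℓ c η D (t + 1) x.1 x.2.1 x.2.2.1 x.2.2.2)
      (u := fun x => u x.1 x.2.1 x.2.2.1 x.2.2.2)
      (fun x => ih.1 _ _ _ _) (fun x => hmem.nonneg _ _ _ _) (fun x => hu.nonneg _ _ _ _)
      (by
        intro x hx
        have : ¬ ((x.1 : ℕ) = 0 → 0 < ρ x.2.1) := fun hc =>
          (ih.2.1 x.1 x.2.1 x.2.2.1 x.2.2.2 hc).ne' hx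
        exact ⟨hmem.eq_zero this _ _, hu.eq_zero this _ _⟩)
      (fun x => hη _ _ _)
      (by
        intro α h0 h1
        have := hmax (hmem.convexComb hu h0.le h1.le)
        simp only [Set.mem_ofPred_eq, omdObjective_eq_sum] at this
        exact this)
  simp only [sum_quad, entropyDiv_eq_sum_klTerm, Finset.mul_sum]
  simp only [Finset.mul_sum] at key
  convert key using 2
  · exact Finset.sum_congr rfl fun x _ => by ring
  · exact Finset.sum_congr rfl fun x _ => by ring

/-- The regret of the online algorithm over `T` episodes. -/
lemma occIterate_regret [Nonempty S] [Nonempty A] {ρ : S → ℝ} (hρ : ρ ∈ stdSimplex ℝ S)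
    {ℓ : ℝ} (hℓ : 1 ≤ ℓ) {c η : ℝ} {T : ℕ} (D : Fin T → Traj S A H)
    (hη : ∀ t h s a, 0 ≤ η * intrinsicReward c D t h s a ∧ η * intrinsicReward c D t h s a ≤ 1)
    {P : Fin H → S → A → S → ℝ} (hP : IsKernel P)
    (hconf : ∀ m ≤ T, ∀ h s a s',
      |empKernel D m h s a s' - P h s a s'| ≤ confRadius ℓ D m h s a s')
    {u : Fin H → S → A → ℝ} (hu : IsOccupancy ρ P u) :
    η * (∑ t : Fin T, ∑ h, ∑ s, ∑ a, u h s a * intrinsicReward c D t h s a)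
      ≤ 2 * (η * ∑ t : Fin T, ∑ h, ∑ s, ∑ a, ∑ s',
          occIterate ρ ℓ c η D t h s a s' * intrinsicReward c D t h s a)
        + H * Real.log ((Fintype.card S : ℝ) ^ 2 * Fintype.card A) := by
  set u' : Fin H → S → A → S → ℝ := fun h s a s' => u h s a * P h s a s' with hu'
  have hfeas : ∀ m ≤ T, IsConfOccupancy ρ ℓ D m u' := fun m hm =>
    hu.isConfOccupancy hρ.2 hP (hconf m hm)
  have hsum : ∀ t h s a, ∑ s', u' h s a s' * intrinsicReward c D t h s a
      = u h s a * intrinsicReward c D t h s a := by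
    intro t h s a
    rw [← Finset.sum_mul, hu', ← Finset.mul_sum, (hP _ _ _).2, mul_one]
  have htel : ∀ m ≤ T, η * (∑ t ∈ Finset.range m, ∑ h, ∑ s, ∑ a,
        u h s a * intrinsicReward c D t h s a) + entropyDiv u' (occIterate ρ ℓ c η D m)
      ≤ 2 * (η * ∑ t ∈ Finset.range m, ∑ h, ∑ s, ∑ a, ∑ s',
          occIterate ρ ℓ c η D t h s a s' * intrinsicReward c D t h s a)
        + entropyDiv u' (occIterate ρ ℓ c η D 0) := by
    intro m
    induction m with
    | zero => simp
    | succ m ih =>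
      intro hm
      have h1 := ih (by omega)
      have h2 := occIterate_step_regret hρ hℓ D m (hη m) (hfeas (m + 1) hm)
      simp only [hsum] at h2
      simp only [Finset.sum_range_succ, mul_add]
      linarith
  have h1 := htel T le_rfl
  simp only [Finset.sum_range] at h1
  have hnn : 0 ≤ entropyDiv u' (occIterate ρ ℓ c η D T) := by
    rw [entropyDiv_eq_sum_klTerm]
    have hspec := occIterate_spec hρ hℓ c η D T
    refine Finset.sum_nonneg fun x _ => klTerm_nonneg ((hfeas T le_rfl).nonneg _ _ _ _)
      (hspec.1 _ _ _ _) fun hx => ?_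
    exact (hfeas T le_rfl).eq_zero (fun hc => (hspec.2.1 _ _ _ _ hc).ne' hx) _ _
  have hdiv : entropyDiv u' (occIterate ρ ℓ c η D 0)
      ≤ H * Real.log ((Fintype.card S : ℝ) ^ 2 * Fintype.card A) := by
    have hS : (0 : ℝ) < Fintype.card S := by exact_mod_cast Fintype.card_pos
    have hA : (0 : ℝ) < Fintype.card A := by exact_mod_cast Fintype.card_pos
    have hspec := occIterate_spec hρ hℓ c η D 0
    unfold entropyDiv
    rw [Finset.sum_congr rfl fun h _ => hspec.2.2.1 h,
      Finset.sum_congr rfl fun h _ => (hfeas T le_rfl).total h]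
    have : ∑ h, ∑ s, ∑ a, ∑ s', u' h s a s'
          * Real.log (u' h s a s' / occIterate ρ ℓ c η D 0 h s a s')
        ≤ ∑ h, ∑ s, ∑ a, ∑ s', u' h s a s'
          * Real.log ((Fintype.card S : ℝ) ^ 2 * Fintype.card A) := by
      refine Finset.sum_le_sum fun h _ => Finset.sum_le_sum fun s _ => Finset.sum_le_sum fun a _ =>
        Finset.sum_le_sum fun s' _ => ?_
      have h0 := (hfeas T le_rfl).nonneg h s a s'
      refine mul_le_mul_of_nonneg_left ?_ h0
      rcases h0.eq_or_lt with h0 | h0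
      · rw [← h0, zero_div, Real.log_zero]
        refine Real.log_nonneg ?_
        have h3 : (1 : ℝ) ≤ Fintype.card S := by exact_mod_cast Fintype.card_pos
        have h4 : (1 : ℝ) ≤ Fintype.card A := by exact_mod_cast Fintype.card_pos
        nlinarith
      · simp only [occIterate, div_div_eq_mul_div, div_one]
        refine Real.log_le_log (by positivity) ?_
        exact mul_le_of_le_one_left (by positivity) ((hfeas T le_rfl).le_one h s a s')
    simp only [← Finset.sum_mul, (hfeas T le_rfl).total] at this
    simp only [Finset.sum_const, Finset.card_univ, Fintype.card_fin, nsmul_eq_mul, mul_one] at this ⊢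
    linarith
  linarith

end Iterates

/-! ### Values in optimistic models -/

section Simulation

variable {S A : Type*} [Fintype S] [Fintype A] {H : ℕ}

/-- The value functions of the policy `π` with rewards `r` in the (possibly defective) kernel
`Q`. -/
def polValue (Q : Fin H → S → A → S → ℝ) (r : Fin H → S → A → ℝ) (π : Fin H → S → A → ℝ) :
    Fin (H + 1) → S → ℝ :=
  Fin.reverseInduction (motive := fun _ => S → ℝ) (fun _ => 0)
    (fun h V s => ∑ a, π h s a * (r h s a + ∑ s', Q h s a s' * V s'))

lemma polValue_last (Q : Fin H → S → A → S → ℝ) (r : Fin H → S → A → ℝ) (π : Fin H → S → A → ℝ) :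
    polValue Q r π (Fin.last H) = 0 := by
  simp only [polValue, Fin.reverseInduction_last]; rfl

lemma polValue_castSucc (Q : Fin H → S → A → S → ℝ) (r : Fin H → S → A → ℝ)
    (π : Fin H → S → A → ℝ) (h : Fin H) (s : S) :
    polValue Q r π h.castSucc s
      = ∑ a, π h s a * (r h s a + ∑ s', Q h s a s' * polValue Q r π h.succ s') := by
  simp only [polValue, Fin.reverseInduction_castSucc]

lemma polValue_bounds {Q : Fin H → S → A → S → ℝ} (hQ0 : ∀ h s a s', 0 ≤ Q h s a s')
    (hQ1 : ∀ h s a, ∑ s', Q h s a s' ≤ 1) {r : Fin H → S → A → ℝ} {b : ℝ}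
    (hr : ∀ h s a, 0 ≤ r h s a ∧ r h s a ≤ b) {π : Fin H → S → A → ℝ} (hπ : IsPolicy π)
    (h : Fin (H + 1)) (s : S) :
    0 ≤ polValue Q r π h s ∧ polValue Q r π h s ≤ ((H : ℝ) - (h : ℕ)) * b := by
  induction h using Fin.reverseInduction generalizing s with
  | last => simp [polValue_last]
  | cast i ih =>
    have hcoe : ((i.succ : Fin (H + 1)) : ℕ) = (i : ℕ) + 1 := rfl
    rw [polValue_castSucc]
    have hb0 : ∀ a : A, 0 ≤ b := fun a => (hr i s a).1.trans (hr i s a).2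
    have hnext : ∀ a, 0 ≤ ∑ s', Q i s a s' * polValue Q r π i.succ s' ∧
        ∑ s', Q i s a s' * polValue Q r π i.succ s' ≤ ((H : ℝ) - ((i : ℕ) + 1)) * b := by
      intro a
      refine ⟨Finset.sum_nonneg fun s' _ => mul_nonneg (hQ0 _ _ _ _) (ih s').1, ?_⟩
      have hi : ((i : ℕ) : ℝ) + 1 ≤ H := by exact_mod_cast i.2
      have hM : 0 ≤ ((H : ℝ) - ((i : ℕ) + 1)) * b := mul_nonneg (by linarith) (hb0 a)
      calc _ ≤ ∑ s', Q i s a s' * (((H : ℝ) - ((i : ℕ) + 1)) * b) := by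
            refine Finset.sum_le_sum fun s' _ => mul_le_mul_of_nonneg_left ?_ (hQ0 _ _ _ _)
            have := (ih s').2
            rw [hcoe] at this
            push_cast at this
            exact this
        _ ≤ _ := by
            rw [← Finset.sum_mul]
            exact mul_le_of_le_one_left hM (hQ1 _ _ _)
    constructor
    · exact Finset.sum_nonneg fun a _ => mul_nonneg ((hπ _ _).1 _)
        (add_nonneg (hr _ _ _).1 (hnext a).1)
    · calc _ ≤ ∑ a, π i s a * (((H : ℝ) - (i : ℕ)) * b) := by
            refine Finset.sum_le_sum fun a _ => mul_le_mul_of_nonneg_left ?_ ((hπ _ _).1 _)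
            have := (hnext a).2
            have := (hr i s a).2
            linarith
        _ = _ := by rw [← Finset.sum_mul, (hπ _ _).2, one_mul]; rfl

/-- If `Q ≤ α P + w`, the value of a policy in `Q` is at most `α ^ H` times its value in `P` with
`w` times a bound on the total value in `Q` added to the rewards. -/
lemma polValue_le_occ {ρ : S → ℝ} (hρ : ∀ s, 0 ≤ ρ s) (hH : 1 ≤ H)
    {P : Fin H → S → A → S → ℝ} (hP : IsKernel P) {Q : Fin H → S → A → S → ℝ}
    {r w : Fin H → S → A → ℝ} (hr : ∀ h s a, 0 ≤ r h s a) (hw : ∀ h s a, 0 ≤ w h s a)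
    {π : Fin H → S → A → ℝ} (hπ : IsPolicy π) {α M : ℝ} (hα : 1 ≤ α) (hM0 : 0 ≤ M)
    (hQ : ∀ h s a s', Q h s a s' ≤ α * P h s a s' + w h s a)
    (hM : ∀ h s, 0 ≤ polValue Q r π h s ∧ polValue Q r π h s ≤ M) :
    ∑ s, ρ s * polValue Q r π 0 s
      ≤ α ^ H * ∑ h, ∑ s, ∑ a, occ ρ P π h s a * (r h s a + w h s a * (Fintype.card S * M)) := by
  set V := polValue Q r π with hV
  have hocc := occ_isOccupancy hρ hP hπ
  have htel := hocc.telescope hP hH (fun h s => α ^ (h : ℕ) * V h s) (by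
    funext s; simp [hV, polValue_last])
  simp only [Fin.val_zero, pow_zero, one_mul] at htel
  rw [← htel, Finset.mul_sum]
  refine Finset.sum_le_sum fun h _ => ?_
  have hpow : α ^ (h : ℕ) ≤ α ^ H := pow_le_pow_right₀ hα h.2.le
  have hα0 : 0 ≤ α ^ (h : ℕ) := by positivity
  have hself : ∑ s, ∑ a, occ ρ P π h s a * V h.castSucc s
      = ∑ s, ∑ a, occ ρ P π h s a * (r h s a + ∑ s', Q h s a s' * V h.succ s') := by
    refine Finset.sum_congr rfl fun s _ => ?_
    rw [← Finset.sum_mul]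
    simp only [occ]
    rw [← Finset.mul_sum, (hπ _ _).2, mul_one, hV, polValue_castSucc, Finset.mul_sum]
    exact Finset.sum_congr rfl fun a _ => by ring
  calc ∑ s, ∑ a, occ ρ P π h s a * (α ^ (h.castSucc : ℕ) * V h.castSucc s
          - ∑ s', P h s a s' * (α ^ (h.succ : ℕ) * V h.succ s'))
      = α ^ (h : ℕ) * (∑ s, ∑ a, occ ρ P π h s a * V h.castSucc s
          - ∑ s, ∑ a, occ ρ P π h s a * (α * ∑ s', P h s a s' * V h.succ s')) := by
        simp only [← Finset.sum_sub_distrib, Finset.mul_sum]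
        refine Finset.sum_congr rfl fun s _ => Finset.sum_congr rfl fun a _ => ?_
        simp only [Fin.val_castSucc, Fin.val_succ, pow_succ, mul_sub, Finset.mul_sum]
        congr 1
        · ring
        · exact Finset.sum_congr rfl fun s' _ => by ring
    _ = α ^ (h : ℕ) * ∑ s, ∑ a, occ ρ P π h s a * (r h s a
          + ∑ s', (Q h s a s' - α * P h s a s') * V h.succ s') := by
        rw [hself]
        simp only [← Finset.sum_sub_distrib]
        congr 1
        refine Finset.sum_congr rfl fun s _ => Finset.sum_congr rfl fun a _ => ?_
        rw [← mul_sub, add_sub_assoc, Finset.mul_sum, ← Finset.sum_sub_distrib]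
        congr 2
        exact Finset.sum_congr rfl fun s' _ => by ring
    _ ≤ α ^ (h : ℕ) * ∑ s, ∑ a, occ ρ P π h s a * (r h s a + w h s a * (Fintype.card S * M)) := by
        refine mul_le_mul_of_nonneg_left (Finset.sum_le_sum fun s _ => Finset.sum_le_sum fun a _ =>
          mul_le_mul_of_nonneg_left ?_ (hocc.nonneg h s a)) hα0
        have : ∑ s', (Q h s a s' - α * P h s a s') * V h.succ s' ≤ ∑ _s' : S, w h s a * M := by
          refine Finset.sum_le_sum fun s' _ => ?_
          have h1 : Q h s a s' - α * P h s a s' ≤ w h s a := by linarith [hQ h s a s']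
          exact (mul_le_mul_of_nonneg_right h1 (hM _ _).1).trans
            (mul_le_mul_of_nonneg_left (hM _ _).2 (hw _ _ _))
        rw [Finset.sum_const, Finset.card_univ, nsmul_eq_mul] at this
        linarith
    _ ≤ _ := mul_le_mul_of_nonneg_right hpow (Finset.sum_nonneg fun s _ =>
        Finset.sum_nonneg fun a _ => mul_nonneg (hocc.nonneg h s a)
          (add_nonneg (hr _ _ _) (mul_nonneg (hw _ _ _) (by positivity))))

lemma inducedPolicy_isPolicy [Nonempty A] {μ : Fin H → S → A → S → ℝ}
    (hμ : ∀ h s a s', 0 ≤ μ h s a s') : IsPolicy (inducedPolicy μ) := by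
  intro h s
  have hnn : ∀ a, 0 ≤ ∑ s', μ h s a s' := fun a => Finset.sum_nonneg fun s' _ => hμ _ _ _ _
  by_cases h0 : ∑ a', ∑ s', μ h s a' s' = 0
  · refine ⟨fun a => ?_, ?_⟩
    · simp only [inducedPolicy, if_pos h0]; positivity
    · simp [inducedPolicy, if_pos h0]
  · refine ⟨fun a => ?_, ?_⟩
    · simp only [inducedPolicy, if_neg h0]
      exact div_nonneg (hnn a) (Finset.sum_nonneg fun a _ => hnn a)
    · simp only [inducedPolicy, if_neg h0]
      rw [← Finset.sum_div, div_self h0]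

/-- The kernel carried by an occupancy measure (zero where the measure vanishes). -/
def inducedKernel (μ : Fin H → S → A → S → ℝ) (h : Fin H) (s : S) (a : A) (s' : S) : ℝ :=
  μ h s a s' / ∑ x, μ h s a x

/-- The gain of a flow is the value of the policy and the kernel it carries. -/
lemma IsFlow.sum_eq_polValue {ρ : S → ℝ} (hH : 1 ≤ H) {μ : Fin H → S → A → S → ℝ}
    (hμ : IsFlow ρ μ) (hμ0 : ∀ h s a s', 0 ≤ μ h s a s') (r : Fin H → S → A → ℝ) :
    ∑ h, ∑ s, ∑ a, ∑ s', μ h s a s' * r h s a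
      = ∑ s, ρ s * polValue (inducedKernel μ) r (inducedPolicy μ) 0 s := by
  set V := polValue (inducedKernel μ) r (inducedPolicy μ) with hV
  rw [← hμ.telescope hH V (by rw [hV, polValue_last])]
  refine Finset.sum_congr rfl fun h _ => Finset.sum_congr rfl fun s _ => ?_
  have hnn : ∀ a, 0 ≤ ∑ s', μ h s a s' := fun a => Finset.sum_nonneg fun s' _ => hμ0 _ _ _ _
  have h1 : ∀ a, (∑ a', ∑ s', μ h s a' s') * inducedPolicy μ h s a = ∑ s', μ h s a s' := by
    intro a
    unfold inducedPolicy
    split_ifs with h0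
    · rw [h0, zero_mul]
      exact ((Finset.sum_eq_zero_iff_of_nonneg fun a _ => hnn a).1 h0 a (Finset.mem_univ a)).symm
    · field_simp
  have h2 : ∀ a s', (∑ x, μ h s a x) * inducedKernel μ h s a s' = μ h s a s' := by
    intro a s'
    unfold inducedKernel
    by_cases h0 : ∑ x, μ h s a x = 0
    · rw [h0, zero_mul]
      exact ((Finset.sum_eq_zero_iff_of_nonneg fun x _ => hμ0 _ _ _ _).1 h0 s'
        (Finset.mem_univ s')).symm
    · field_simp
  have h3 : ∑ a, ∑ s', μ h s a s' * V h.castSucc s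
      = ∑ a, ∑ s', (μ h s a s' * r h s a + μ h s a s' * V h.succ s') := by
    simp_rw [← Finset.sum_mul]
    rw [hV, polValue_castSucc, Finset.mul_sum]
    refine Finset.sum_congr rfl fun a _ => ?_
    rw [← mul_assoc, h1, Finset.sum_add_distrib, ← Finset.sum_mul, mul_add, Finset.mul_sum]
    congr 1
    exact Finset.sum_congr rfl fun s' _ => by rw [← mul_assoc, h2]
  simp only [mul_sub, Finset.sum_sub_distrib]
  rw [h3]
  simp only [Finset.sum_add_distrib]
  ring

end Simulation

/-! ### Cumulative intrinsic reward of a comparator -/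

section Coverage

variable {S A : Type*} [Fintype S] [Fintype A] [DecidableEq S] [DecidableEq A] {H : ℕ}

/-- Multiplicative form of the empirical Bernstein radius. -/
lemma conf_upper_multiplicative {p' p x y : ℝ} (hp' : 0 ≤ p') (hx : 0 ≤ x) (hy : 1 ≤ y)
    (h : |p' - p| ≤ 2 * √(p' * x) + 14 * x / 3) :
    p' + (2 * √(p' * x) + 14 * x / 3) ≤ (1 + 1 / y) * p + 24 * y * x := by
  have hsq : 2 * √(p' * x) ≤ p' / (2 * y + 1) + (2 * y + 1) * x := by
    have hz : 0 < 2 * y + 1 := by linarith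
    have h1 : √(p' * x) = √(p' / (2 * y + 1)) * √((2 * y + 1) * x) := by
      rw [← Real.sqrt_mul (by positivity)]
      congr 1; field_simp
    have h2 := Real.sq_sqrt (show 0 ≤ p' / (2 * y + 1) by positivity)
    have h3 := Real.sq_sqrt (show 0 ≤ (2 * y + 1) * x by positivity)
    rw [h1]
    nlinarith [sq_nonneg (√(p' / (2 * y + 1)) - √((2 * y + 1) * x))]
  have hxy : x ≤ y * x := by nlinarith
  have he : 2 * √(p' * x) + 14 * x / 3 ≤ p' / (2 * y + 1) + 8 * (y * x) := by linarith
  have h1 := (abs_le.1 h).2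
  have hz : 0 < 2 * y + 1 := by linarith
  have h2 : p' - p' / (2 * y + 1) = p' * (2 * y) / (2 * y + 1) := by field_simp; ring
  have h3 : p' * (2 * y) / (2 * y + 1) ≤ p + 8 * (y * x) := by linarith
  have h4 : p' + p' / (2 * y + 1) = (1 + 1 / y) * (p' * (2 * y) / (2 * y + 1)) := by
    field_simp; ring
  have h5 : 1 + 1 / y ≤ 2 := by
    have : 1 / y ≤ 1 := by rw [div_le_one (by linarith)]; exact hy
    linarith
  have h6 : (1 + 1 / y) * (p' * (2 * y) / (2 * y + 1)) ≤ (1 + 1 / y) * (p + 8 * (y * x)) :=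
    mul_le_mul_of_nonneg_left h3 (by positivity)
  have h7 : (1 + 1 / y) * (8 * (y * x)) ≤ 2 * (8 * (y * x)) :=
    mul_le_mul_of_nonneg_right h5 (by positivity)
  linarith

omit [Fintype A] in
lemma confRadius_eq {K : ℕ} (ℓ : ℝ) (D : Fin K → Traj S A H) (t : ℕ) (h : Fin H) (s : S) (a : A)
    (s' : S) : confRadius ℓ D t h s a s'
      = 2 * √(empKernel D t h s a s' * (ℓ / max (visitCount D t h s a : ℝ) 1))
        + 14 * (ℓ / max (visitCount D t h s a : ℝ) 1) / 3 := by
  have hm : (0 : ℝ) < max (visitCount D t h s a : ℝ) 1 := lt_of_lt_of_le one_pos (le_max_right _ _)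
  unfold confRadius
  rw [mul_div_assoc]
  congr 1
  field_simp

/-- An optimistic occupancy measure overestimates the total intrinsic reward of its policy by at
most a constant factor, up to a bonus that decays with the visit counts. The constant
`c = 4 |S| H² ℓ` makes the bonus independent of `|S|`, `H` and `ℓ`. -/
lemma confOccupancy_gain_le [Nonempty S] [Nonempty A] {ρ : S → ℝ} (hρ : ρ ∈ stdSimplex ℝ S)
    (hH : 1 ≤ H) {P : Fin H → S → A → S → ℝ} (hP : IsKernel P) {ℓ : ℝ} (hℓ : 1 ≤ ℓ) {K : ℕ}
    (D : Fin K → Traj S A H) (t : ℕ)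
    (hconf : ∀ h s a s', |empKernel D t h s a s' - P h s a s'| ≤ confRadius ℓ D t h s a s')
    {μ : Fin H → S → A → S → ℝ} (hμ : IsConfOccupancy ρ ℓ D t μ) :
    ∑ h, ∑ s, ∑ a, ∑ s', μ h s a s' * intrinsicReward (regConst S H ℓ) D t h s a
      ≤ 21 * ∑ h, ∑ s, ∑ a,
          occ ρ P (inducedPolicy μ) h s a * (1 / max (visitCount D t h s a : ℝ) 1) := by
  have hS : (1 : ℝ) ≤ Fintype.card S := by exact_mod_cast Fintype.card_pos
  have hH' : (1 : ℝ) ≤ H := by exact_mod_cast hH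
  set c := regConst S H ℓ with hc
  have hc1 : 1 ≤ c := by
    rw [hc, regConst]
    have : (1 : ℝ) ≤ (H : ℝ) ^ 2 := by nlinarith
    have h2 : (1 : ℝ) ≤ Fintype.card S * (H : ℝ) ^ 2 := by nlinarith
    nlinarith
  have hπ := inducedPolicy_isPolicy (μ := μ) hμ.nonneg
  have hn : ∀ h s a, (0 : ℝ) ≤ visitCount D t h s a := fun h s a => Nat.cast_nonneg _
  have hm : ∀ h s a, (1 : ℝ) ≤ max (visitCount D t h s a : ℝ) 1 := fun h s a => le_max_right _ _
  have hr : ∀ h s a, 0 ≤ intrinsicReward c D t h s a ∧ intrinsicReward c D t h s a ≤ 1 / c := by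
    intro h s a
    have := hn h s a
    unfold intrinsicReward
    exact ⟨by positivity, one_div_le_one_div_of_le (by linarith) (by linarith)⟩
  have hsum0 : ∀ h s a, 0 ≤ ∑ x, μ h s a x := fun h s a =>
    Finset.sum_nonneg fun x _ => hμ.nonneg h s a x
  have hQ0 : ∀ h s a s', 0 ≤ inducedKernel μ h s a s' := fun h s a s' =>
    div_nonneg (hμ.nonneg _ _ _ _) (hsum0 h s a)
  have hQ1 : ∀ h s a, ∑ s', inducedKernel μ h s a s' ≤ 1 := by
    intro h s a
    simp only [inducedKernel]
    rw [← Finset.sum_div]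
    exact div_self_le_one _
  set w : Fin H → S → A → ℝ := fun h s a => 24 * H * (ℓ / max (visitCount D t h s a : ℝ) 1) with hw
  have hw0 : ∀ h s a, 0 ≤ w h s a := by
    intro h s a
    have := hm h s a
    positivity
  have hQ : ∀ h s a s', inducedKernel μ h s a s' ≤ (1 + 1 / (H : ℝ)) * P h s a s' + w h s a := by
    intro h s a s'
    have hx : 0 ≤ ℓ / max (visitCount D t h s a : ℝ) 1 := by
      have := hm h s a
      positivity
    have hb := hconf h s a s'
    rw [confRadius_eq] at hb
    have h1 := conf_upper_multiplicative (empKernel_nonneg D t h s a s') hx hH' hb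
    rw [← confRadius_eq] at h1
    rcases (hsum0 h s a).eq_or_lt with h0 | h0
    · rw [inducedKernel, ← h0, div_zero]
      have := hw0 h s a
      have := (hP h s a).1 s'
      positivity
    · refine le_trans ?_ h1
      rw [inducedKernel, div_le_iff₀ h0]
      exact hμ.upper h s a s'
  have hV := polValue_bounds hQ0 hQ1 hr hπ
  have hM : ∀ h s, 0 ≤ polValue (inducedKernel μ) (intrinsicReward c D t) (inducedPolicy μ) h s ∧
      polValue (inducedKernel μ) (intrinsicReward c D t) (inducedPolicy μ) h s
        ≤ H * (1 / c) := by
    intro h s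
    refine ⟨(hV h s).1, (hV h s).2.trans ?_⟩
    refine mul_le_mul_of_nonneg_right ?_ (by positivity)
    have : (0 : ℝ) ≤ (h : ℕ) := Nat.cast_nonneg _
    linarith
  rw [hμ.isFlow.sum_eq_polValue hH hμ.nonneg]
  have hα : 1 ≤ 1 + 1 / (H : ℝ) := by
    have : 0 ≤ 1 / (H : ℝ) := by positivity
    linarith
  refine (polValue_le_occ hρ.1 hH hP (fun h s a => (hr h s a).1) hw0 hπ hα
    (by positivity) hQ hM).trans ?_
  have hexp : (1 + 1 / (H : ℝ)) ^ H ≤ 3 := by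
    have h1 : 1 + 1 / (H : ℝ) ≤ Real.exp (1 / H) := by
      have := Real.add_one_le_exp (1 / (H : ℝ)); linarith
    calc _ ≤ Real.exp (1 / H) ^ H := pow_le_pow_left₀ (by positivity) h1 H
      _ = Real.exp 1 := by
        rw [← Real.exp_nat_mul]; congr 1; field_simp
      _ ≤ 3 := by have := Real.exp_one_lt_d9; linarith
  have hocc := occ_isOccupancy hρ.1 hP hπ
  have h7 : ∑ h, ∑ s, ∑ a, occ ρ P (inducedPolicy μ) h s a * (intrinsicReward c D t h s a
        + w h s a * (Fintype.card S * (H * (1 / c))))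
      ≤ 7 * ∑ h, ∑ s, ∑ a,
          occ ρ P (inducedPolicy μ) h s a * (1 / max (visitCount D t h s a : ℝ) 1) := by
    simp only [Finset.mul_sum]
    refine Finset.sum_le_sum fun h _ => Finset.sum_le_sum fun s _ => Finset.sum_le_sum fun a _ => ?_
    have h1 : w h s a * (Fintype.card S * (H * (1 / c)))
        = 6 * (1 / max (visitCount D t h s a : ℝ) 1) := by
      have := hm h s a
      have : max (visitCount D t h s a : ℝ) 1 ≠ 0 := by linarith
      rw [hw, hc, regConst]
      field_simp
      norm_num
    have h2 : intrinsicReward c D t h s a ≤ 1 / max (visitCount D t h s a : ℝ) 1 := by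
      unfold intrinsicReward
      refine one_div_le_one_div_of_le (by linarith [hm h s a]) (max_le ?_ ?_)
      · linarith
      · linarith [hn h s a]
    rw [h1]
    have := mul_le_mul_of_nonneg_left h2 (hocc.nonneg h s a)
    linarith
  have hnn : 0 ≤ ∑ h, ∑ s, ∑ a,
      occ ρ P (inducedPolicy μ) h s a * (1 / max (visitCount D t h s a : ℝ) 1) :=
    Finset.sum_nonneg fun h _ => Finset.sum_nonneg fun s _ => Finset.sum_nonneg fun a _ =>
      mul_nonneg (hocc.nonneg h s a) (by have := hm h s a; positivity)
  calc _ ≤ (1 + 1 / (H : ℝ)) ^ H * (7 * ∑ h, ∑ s, ∑ a,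
          occ ρ P (inducedPolicy μ) h s a * (1 / max (visitCount D t h s a : ℝ) 1)) :=
        mul_le_mul_of_nonneg_left h7 (by positivity)
    _ ≤ 3 * (7 * ∑ h, ∑ s, ∑ a,
          occ ρ P (inducedPolicy μ) h s a * (1 / max (visitCount D t h s a : ℝ) 1)) :=
        mul_le_mul_of_nonneg_right hexp (by positivity)
    _ = _ := by ring

/-- A sum of increments relative to their partial sums grows logarithmically. -/
lemma sum_div_partial_sum_le (x : ℕ → ℝ) (hx : ∀ t, 0 ≤ x t ∧ x t ≤ 1) (T : ℕ) :
    ∑ t ∈ Finset.range T, x t / (1 + ∑ i ∈ Finset.range t, x i)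
      ≤ 2 * Real.log (1 + ∑ t ∈ Finset.range T, x t) := by
  induction T with
  | zero => simp
  | succ T ih =>
    rw [Finset.sum_range_succ, Finset.sum_range_succ]
    set X := ∑ i ∈ Finset.range T, x i
    have hX : 0 ≤ X := Finset.sum_nonneg fun i _ => (hx i).1
    obtain ⟨h0, h1⟩ := hx T
    have hpos : 0 < 1 + X := by linarith
    have hpos' : 0 < 1 + (X + x T) := by linarith
    have h2 := Real.one_sub_inv_le_log_of_pos (div_pos hpos' hpos)
    rw [Real.log_div hpos'.ne' hpos.ne'] at h2
    have h3 : x T / (1 + X) ≤ 2 * (1 - ((1 + (X + x T)) / (1 + X))⁻¹) := by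
      have : 1 - ((1 + (X + x T)) / (1 + X))⁻¹ = x T / (1 + (X + x T)) := by
        field_simp; ring
      rw [this, ← mul_div_assoc, div_le_div_iff₀ hpos hpos']
      nlinarith
    linarith

/-- Cumulative reward of a comparator occupancy measure, with the final visit counts. -/
lemma comparator_gain_le [Nonempty S] [Nonempty A] {ρ : S → ℝ} (hρ : ρ ∈ stdSimplex ℝ S)
    (hH : 1 ≤ H) {P : Fin H → S → A → S → ℝ} (hP : IsKernel P) {L ℓ η : ℝ} (hL : 1 ≤ L)
    (hℓ : 1 ≤ ℓ) (hη0 : 0 < η) (hη1 : η ≤ regConst S H ℓ)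
    (hη2 : H * Real.log ((Fintype.card S : ℝ) ^ 2 * Fintype.card A)
      ≤ η * (Fintype.card S * Fintype.card A)) {T : ℕ} (D : Fin T → Traj S A H)
    (hconf : ∀ m ≤ T, ∀ h s a s',
      |empKernel D m h s a s' - P h s a s'| ≤ confRadius ℓ D m h s a s')
    (hlow : ∀ m ≤ T, ∀ h s a, ∑ t ∈ Finset.range m,
      occ ρ P (inducedPolicy (occIterate ρ ℓ (regConst S H ℓ) η D t)) h s a
        ≤ 2 * visitCount D m h s a + 2 * L)
    {u : Fin H → S → A → ℝ} (hu : IsOccupancy ρ P u) :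
    T * ∑ h, ∑ s, ∑ a, u h s a * (1 / (regConst S H ℓ + visitCount D T h s a))
      ≤ 84 * (Fintype.card S * Fintype.card A * H) * (2 * L + 3) * Real.log (1 + T)
        + Fintype.card S * Fintype.card A := by
  have hS : (1 : ℝ) ≤ Fintype.card S := by exact_mod_cast Fintype.card_pos
  have hA : (1 : ℝ) ≤ Fintype.card A := by exact_mod_cast Fintype.card_pos
  have hH' : (1 : ℝ) ≤ H := by exact_mod_cast hH
  set c := regConst S H ℓ with hc
  have hc1 : 1 ≤ c := by
    rw [hc, regConst]
    have : (1 : ℝ) ≤ (H : ℝ) ^ 2 := by nlinarith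
    have h2 : (1 : ℝ) ≤ Fintype.card S * (H : ℝ) ^ 2 := by nlinarith
    nlinarith
  set pol : ℕ → Fin H → S → A → ℝ := fun t => inducedPolicy (occIterate ρ ℓ c η D t) with hpol
  have hspec := fun t => occIterate_spec hρ hℓ c η D t
  have hπ : ∀ t, IsPolicy (pol t) := fun t => inducedPolicy_isPolicy (hspec t).1
  have hocc := fun t => occ_isOccupancy hρ.1 hP (hπ t)
  have hm : ∀ t h s a, (1 : ℝ) ≤ max (visitCount D t h s a : ℝ) 1 := fun t h s a => le_max_right _ _
  have hn : ∀ t h s a, (0 : ℝ) ≤ visitCount D t h s a := fun t h s a => Nat.cast_nonneg _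
  have hr : ∀ t h s a, 0 ≤ intrinsicReward c D t h s a ∧ intrinsicReward c D t h s a ≤ 1 / c := by
    intro t h s a
    have := hn t h s a
    unfold intrinsicReward
    exact ⟨by positivity, one_div_le_one_div_of_le (by linarith) (by linarith)⟩
  have hηr : ∀ t h s a, 0 ≤ η * intrinsicReward c D t h s a ∧
      η * intrinsicReward c D t h s a ≤ 1 := by
    intro t h s a
    refine ⟨mul_nonneg hη0.le (hr t h s a).1, ?_⟩
    calc _ ≤ η * (1 / c) := mul_le_mul_of_nonneg_left (hr t h s a).2 hη0.le
      _ ≤ 1 := by rw [mul_one_div, div_le_one (by linarith)]; exact hη1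
  have hreg := occIterate_regret hρ hℓ D hηr hP hconf hu
  -- the learner's optimistic gain in each episode
  have hgain : ∀ t : Fin T, ∑ h, ∑ s, ∑ a, ∑ s',
      occIterate ρ ℓ c η D t h s a s' * intrinsicReward c D t h s a
      ≤ 21 * ∑ h, ∑ s, ∑ a, occ ρ P (pol t) h s a * (1 / max (visitCount D t h s a : ℝ) 1) := by
    intro t
    by_cases ht : (t : ℕ) = 0
    · rw [ht]
      have h1 : ∑ h, ∑ s, ∑ a, ∑ s', occIterate ρ ℓ c η D 0 h s a s'
          * intrinsicReward c D 0 h s a ≤ ∑ h : Fin H, (1 : ℝ) := by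
        refine Finset.sum_le_sum fun h _ => ?_
        rw [← (hspec 0).2.2.1 h]
        refine Finset.sum_le_sum fun s _ => Finset.sum_le_sum fun a _ =>
          Finset.sum_le_sum fun s' _ => mul_le_of_le_one_right ((hspec 0).1 _ _ _ _) ?_
        exact (hr 0 h s a).2.trans (by rw [div_le_one (by linarith)]; exact hc1)
      have h2 : ∑ h, ∑ s, ∑ a, occ ρ P (pol 0) h s a * (1 / max (visitCount D 0 h s a : ℝ) 1)
          = ∑ h : Fin H, (1 : ℝ) := by
        refine Finset.sum_congr rfl fun h _ => ?_
        refine Eq.trans ?_ ((hocc 0).total hρ.2 hP h)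
        simp [visitCount, transCount]
      rw [h2]
      have : (0 : ℝ) ≤ ∑ h : Fin H, (1 : ℝ) := Finset.sum_nonneg fun _ _ => zero_le_one
      linarith
    · exact confOccupancy_gain_le hρ hH hP hℓ D t (hconf t t.2.le) ((hspec t).2.2.2 ht)
  -- per state-action pair the bonuses sum to a logarithm
  have hpair : ∀ h s a, ∑ t : Fin T, occ ρ P (pol t) h s a
      * (1 / max (visitCount D t h s a : ℝ) 1) ≤ (2 * L + 3) * (2 * Real.log (1 + T)) := by
    intro h s a
    have hx : ∀ t : ℕ, 0 ≤ occ ρ P (pol t) h s a ∧ occ ρ P (pol t) h s a ≤ 1 := fun t =>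
      ⟨(hocc t).nonneg h s a, (hocc t).le_one hρ.2 hP h s a⟩
    have h1 := sum_div_partial_sum_le (fun t => occ ρ P (pol t) h s a) hx T
    have hXT : ∑ t ∈ Finset.range T, occ ρ P (pol t) h s a ≤ T :=
      (Finset.sum_le_sum fun t _ => (hx t).2).trans (by simp)
    have hX0 : ∀ m, 0 ≤ ∑ t ∈ Finset.range m, occ ρ P (pol t) h s a := fun m =>
      Finset.sum_nonneg fun t _ => (hx t).1
    rw [← Finset.sum_range (fun t => occ ρ P (pol t) h s a
      * (1 / max (visitCount D t h s a : ℝ) 1))]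
    calc _ ≤ ∑ t ∈ Finset.range T, (2 * L + 3) * (occ ρ P (pol t) h s a
          / (1 + ∑ i ∈ Finset.range t, occ ρ P (pol i) h s a)) := by
          refine Finset.sum_le_sum fun t ht => ?_
          have hl := hlow t (Finset.mem_range.1 ht).le h s a
          have hmt := hm t h s a
          have hle : 1 + ∑ i ∈ Finset.range t, occ ρ P (pol i) h s a
              ≤ (2 * L + 3) * max (visitCount D t h s a : ℝ) 1 := by
            have := le_max_left (visitCount D t h s a : ℝ) 1
            nlinarith
          have hpos : 0 < 1 + ∑ i ∈ Finset.range t, occ ρ P (pol i) h s a := by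
            linarith [hX0 t]
          rw [mul_div_left_comm (2 * L + 3)]
          refine mul_le_mul_of_nonneg_left ?_ (hx t).1
          rw [div_le_div_iff₀ (by linarith) hpos]
          linarith
      _ ≤ _ := by
          rw [← Finset.mul_sum]
          refine mul_le_mul_of_nonneg_left (h1.trans ?_) (by linarith)
          have := Real.log_le_log (by linarith [hX0 T])
            (show 1 + ∑ t ∈ Finset.range T, occ ρ P (pol t) h s a ≤ 1 + T by linarith)
          linarith
  have htotal : ∑ t : Fin T, ∑ h, ∑ s, ∑ a, ∑ s',
      occIterate ρ ℓ c η D t h s a s' * intrinsicReward c D t h s a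
      ≤ 21 * ((Fintype.card S * Fintype.card A * H) * ((2 * L + 3) * (2 * Real.log (1 + T)))) := by
    refine (Finset.sum_le_sum fun t _ => hgain t).trans ?_
    rw [← Finset.mul_sum]
    refine mul_le_mul_of_nonneg_left ?_ (by norm_num)
    rw [Finset.sum_comm]
    simp_rw [Finset.sum_comm (s := (Finset.univ : Finset (Fin T)))]
    calc _ ≤ ∑ _h : Fin H, ∑ _s : S, ∑ _a : A, (2 * L + 3) * (2 * Real.log (1 + T)) :=
          Finset.sum_le_sum fun h _ => Finset.sum_le_sum fun s _ => Finset.sum_le_sum fun a _ =>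
            hpair h s a
      _ = _ := by
          simp only [Finset.sum_const, Finset.card_univ, Fintype.card_fin, nsmul_eq_mul]
          ring
  -- rewards decrease in time, so the comparator keeps at least its final reward
  have hfinal : T * ∑ h, ∑ s, ∑ a, u h s a * (1 / (c + visitCount D T h s a))
      ≤ ∑ t : Fin T, ∑ h, ∑ s, ∑ a, u h s a * intrinsicReward c D t h s a := by
    have : (T : ℝ) * ∑ h, ∑ s, ∑ a, u h s a * (1 / (c + visitCount D T h s a))
        = ∑ _t : Fin T, ∑ h, ∑ s, ∑ a, u h s a * (1 / (c + visitCount D T h s a)) := by simp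
    rw [this]
    refine Finset.sum_le_sum fun t _ => Finset.sum_le_sum fun h _ => Finset.sum_le_sum fun s _ =>
      Finset.sum_le_sum fun a _ => mul_le_mul_of_nonneg_left ?_ (hu.nonneg h s a)
    unfold intrinsicReward
    refine one_div_le_one_div_of_le (by linarith [hn t h s a]) ?_
    have : (visitCount D t h s a : ℝ) ≤ visitCount D T h s a := by
      rw [visitCount_eq_sum, visitCount_eq_sum]
      refine Finset.sum_le_sum fun i _ => ?_
      simp only [i.2, if_true]
      split_ifs
      exacts [le_rfl, visitInd_nonneg _ _ _ _]
    linarith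
  refine hfinal.trans (le_of_mul_le_mul_left ?_ hη0)
  calc _ ≤ _ := hreg
    _ ≤ 2 * (η * (21 * ((Fintype.card S * Fintype.card A * H)
          * ((2 * L + 3) * (2 * Real.log (1 + T)))))) + η * (Fintype.card S * Fintype.card A) := by
        have := mul_le_mul_of_nonneg_left htotal hη0.le
        linarith
    _ = _ := by ring

omit [DecidableEq S] [DecidableEq A] in
/-- The tuned step size: small enough for the exponential updates to be stable, and large enough
for the initial divergence to be negligible. -/
lemma stepSize_bounds {cω ℓ ε : ℝ} (hH : 1 ≤ H) (hS : 1 ≤ Fintype.card S) (hA : 1 ≤ Fintype.card A)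
    (hSA : 2 ≤ Fintype.card S * Fintype.card A) (hℓ : 1 ≤ ℓ)
    (hT1 : 1 ≤ Real.log (numEpisodes S A H cω ℓ ε))
    (hT2 : Real.log (numEpisodes S A H cω ℓ ε) ≤ ℓ) :
    0 < stepSize S A H cω ℓ ε ∧ stepSize S A H cω ℓ ε ≤ regConst S H ℓ ∧
      H * Real.log ((Fintype.card S : ℝ) ^ 2 * Fintype.card A)
        ≤ stepSize S A H cω ℓ ε * (Fintype.card S * Fintype.card A) := by
  have hH' : (1 : ℝ) ≤ H := by exact_mod_cast hH
  have hS' : (1 : ℝ) ≤ Fintype.card S := by exact_mod_cast hS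
  have hA' : (1 : ℝ) ≤ Fintype.card A := by exact_mod_cast hA
  have hSA' : (2 : ℝ) ≤ Fintype.card S * Fintype.card A := by exact_mod_cast hSA
  unfold stepSize
  set s : ℝ := (Fintype.card S : ℝ)
  set b : ℝ := (Fintype.card A : ℝ)
  set lt := Real.log (numEpisodes S A H cω ℓ ε)
  set g := Real.log (s * b) with hg
  have hg0 : 0 < g := Real.log_pos (by linarith)
  have hgle : g ≤ s * b := by
    have := Real.log_le_sub_one_of_pos (show 0 < s * b by linarith)
    linarith
  set c := regConst S H ℓ with hc
  have hcdef : c = 4 * s * (H : ℝ) ^ 2 * ℓ := rfl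
  have hc1 : 1 ≤ c := by
    rw [hcdef]
    have : (1 : ℝ) ≤ (H : ℝ) ^ 2 := by nlinarith
    have h2 : (1 : ℝ) ≤ s * (H : ℝ) ^ 2 := by nlinarith
    nlinarith
  have hx : 4 * (H : ℝ) * g / (1 / c * (4 * s * b * H * lt)) = c * g / (s * b * lt) := by
    field_simp
  rw [hx]
  refine ⟨Real.sqrt_pos.2 (by positivity), ?_, ?_⟩
  · refine Real.sqrt_le_iff.2 ⟨by linarith, ?_⟩
    rw [div_le_iff₀ (by positivity)]
    have h1 : c * g ≤ c * (s * b) := mul_le_mul_of_nonneg_left hgle (by linarith)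
    have h2 : c * (s * b) ≤ c ^ 2 * (s * b) :=
      mul_le_mul_of_nonneg_right (by nlinarith) (by linarith)
    have h3 : c ^ 2 * (s * b) ≤ c ^ 2 * (s * b * lt) :=
      mul_le_mul_of_nonneg_left (by nlinarith) (by positivity)
    linarith
  · have h1 : Real.log (s ^ 2 * b) ≤ 2 * g := by
      rw [hg]
      have : (2 : ℝ) * Real.log (s * b) = Real.log ((s * b) ^ 2) := by
        rw [Real.log_pow]; norm_num
      rw [this]
      refine Real.log_le_log (by positivity) ?_
      have : b ≤ b ^ 2 := by nlinarith
      nlinarith [mul_le_mul_of_nonneg_left this (sq_nonneg s)]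
    have h2 : (H : ℝ) * (2 * g) / (s * b) ≤ √(c * g / (s * b * lt)) := by
      refine Real.le_sqrt_of_sq_le ?_
      rw [div_pow, div_le_div_iff₀ (by positivity) (by positivity), hcdef]
      have h3 : g * lt ≤ s * (s * b) * ℓ := by
        have : g ≤ s * (s * b) := by nlinarith
        exact mul_le_mul this hT2 (by linarith) (by positivity)
      have h4 : 0 ≤ 4 * (H : ℝ) ^ 2 * g * (s * b) := by positivity
      have := mul_le_mul_of_nonneg_left h3 h4
      nlinarith
    calc (H : ℝ) * Real.log (s ^ 2 * b) ≤ H * (2 * g) :=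
          mul_le_mul_of_nonneg_left h1 (by linarith)
      _ = H * (2 * g) / (s * b) * (s * b) := by field_simp
      _ ≤ _ := mul_le_mul_of_nonneg_right h2 (by positivity)

end Coverage

/-! ### Expectations and variances under an estimated law -/

section Variance

variable {S : Type*} [Fintype S]

lemma sum_mul_sub_sq {p : S → ℝ} (hp : ∑ s, p s = 1) (V : S → ℝ) (m : ℝ) :
    ∑ s, p s * (V s - m) ^ 2 = variance p V + (∑ s, p s * V s - m) ^ 2 := by
  have h : ∀ s, p s * (V s - m) ^ 2 = p s * V s ^ 2 - 2 * m * (p s * V s) + m ^ 2 * p s := by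
    intro s; ring
  simp_rw [h, Finset.sum_add_distrib, Finset.sum_sub_distrib, ← Finset.mul_sum, hp, variance]
  ring

lemma variance_nonneg {p : S → ℝ} (hp : p ∈ stdSimplex ℝ S) (V : S → ℝ) : 0 ≤ variance p V := by
  have h := sum_mul_sub_sq hp.2 V (∑ s, p s * V s)
  rw [sub_self, zero_pow two_ne_zero, add_zero] at h
  rw [← h]
  exact Finset.sum_nonneg fun s _ => mul_nonneg (hp.1 s) (sq_nonneg _)

lemma sum_mul_mem_Icc {p : S → ℝ} (hp0 : ∀ s, 0 ≤ p s) (hp1 : ∑ s, p s ≤ 1) {V : S → ℝ} {M : ℝ}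
    (hM : 0 ≤ M) (hV : ∀ s, 0 ≤ V s ∧ V s ≤ M) : 0 ≤ ∑ s, p s * V s ∧ ∑ s, p s * V s ≤ M := by
  refine ⟨Finset.sum_nonneg fun s _ => mul_nonneg (hp0 s) (hV s).1, ?_⟩
  calc _ ≤ ∑ s, p s * M := Finset.sum_le_sum fun s _ => mul_le_mul_of_nonneg_left (hV s).2 (hp0 s)
    _ ≤ M := by rw [← Finset.sum_mul]; exact mul_le_of_le_one_left hM hp1

/-- Entrywise Bernstein bounds control the error of an expectation for all `V` simultaneously, at
the price of a factor `|S|` in the variance term (Cauchy–Schwarz). -/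
lemma abs_sum_sub_mul_le {p q : S → ℝ} (hp : p ∈ stdSimplex ℝ S) (hq : q ∈ stdSimplex ℝ S)
    {x : ℝ} (hx : 0 ≤ x) (hconf : ∀ s, |p s - q s| ≤ 2 * √(p s * x) + 14 * x / 3) {V : S → ℝ}
    {M : ℝ} (hM : 0 ≤ M) (hV : ∀ s, 0 ≤ V s ∧ V s ≤ M) :
    |∑ s, p s * V s - ∑ s, q s * V s|
      ≤ √(5 * Fintype.card S * x * variance p V) + 5 * Fintype.card S * M * x := by
  set m := ∑ s, p s * V s with hm
  have hmb := sum_mul_mem_Icc hp.1 hp.2.le hM hV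
  have hdev : ∀ s, |V s - m| ≤ M := by
    intro s
    rw [abs_le]
    constructor <;> linarith [(hV s).1, (hV s).2, hmb.1, hmb.2]
  have e1 : m - ∑ s, q s * V s = ∑ s, (p s - q s) * (V s - m) := by
    simp only [sub_mul, mul_sub, Finset.sum_sub_distrib, ← Finset.sum_mul, hp.2, hq.2]
    rw [← hm]; ring
  have hvar : ∑ s, p s * (V s - m) ^ 2 = variance p V := by
    rw [sum_mul_sub_sq hp.2, ← hm]; ring
  have hcs : ∑ s, √(p s) * |V s - m| ≤ √(Fintype.card S * variance p V) := by
    refine Real.le_sqrt_of_sq_le ?_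
    have := sq_sum_le_card_mul_sum_sq (s := (Finset.univ : Finset S))
      (f := fun s => √(p s) * |V s - m|)
    refine this.trans (le_of_eq ?_)
    rw [Finset.card_univ, ← hvar]
    congr 1
    refine Finset.sum_congr rfl fun s _ => ?_
    rw [mul_pow, Real.sq_sqrt (hp.1 s), sq_abs]
  rw [e1]
  calc _ ≤ ∑ s, |(p s - q s) * (V s - m)| := Finset.abs_sum_le_sum_abs _ _
    _ ≤ ∑ s, (2 * √x * (√(p s) * |V s - m|) + 14 * x / 3 * M) := by
        refine Finset.sum_le_sum fun s _ => ?_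
        rw [abs_mul]
        have h1 := mul_le_mul_of_nonneg_right (hconf s) (abs_nonneg (V s - m))
        have h2 := mul_le_mul_of_nonneg_left (hdev s) (show 0 ≤ 14 * x / 3 by positivity)
        rw [Real.sqrt_mul (hp.1 s)] at h1
        linarith
    _ = 2 * √x * ∑ s, √(p s) * |V s - m| + Fintype.card S * (14 * x / 3 * M) := by
        rw [Finset.sum_add_distrib, ← Finset.mul_sum, Finset.sum_const, Finset.card_univ,
          nsmul_eq_mul]
    _ ≤ 2 * √x * √(Fintype.card S * variance p V) + Fintype.card S * (14 * x / 3 * M) := by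
        have := mul_le_mul_of_nonneg_left hcs (show 0 ≤ 2 * √x by positivity)
        linarith
    _ ≤ _ := by
        have h2 : 2 * √x * √(Fintype.card S * variance p V)
            ≤ √(5 * Fintype.card S * x * variance p V) := by
          refine Real.le_sqrt_of_sq_le ?_
          have hv := variance_nonneg hp V
          rw [mul_pow, mul_pow, Real.sq_sqrt hx, Real.sq_sqrt (by positivity)]
          have : 0 ≤ x * (Fintype.card S * variance p V) := by positivity
          linarith
        have h3 : 0 ≤ Fintype.card S * M * x := by positivity
        linarith

/-- The Bernstein penalty in terms of the variance under the true transition law `q`. -/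
lemma sqrt_variance_le {p q : S → ℝ} (hp : p ∈ stdSimplex ℝ S) (hq : q ∈ stdSimplex ℝ S)
    {x : ℝ} (hx : 0 ≤ x) (hconf : ∀ s, |p s - q s| ≤ 2 * √(p s * x) + 14 * x / 3) {V : S → ℝ}
    {M : ℝ} (hM : 0 ≤ M) (hV : ∀ s, 0 ≤ V s ∧ V s ≤ M) :
    √(5 * Fintype.card S * x * variance p V)
      ≤ √(10 * Fintype.card S * x * variance q V) + 9 * Fintype.card S * M * x := by
  set m := ∑ s, q s * V s with hm
  have hmb := sum_mul_mem_Icc hq.1 hq.2.le hM hV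
  have hpq : ∀ s, p s ≤ 2 * q s + 14 * x := by
    intro s
    have h1 := (abs_le.1 (hconf s)).2
    have h2 : 2 * √(p s * x) ≤ p s / 2 + 2 * x := by
      rw [Real.sqrt_mul (hp.1 s)]
      nlinarith [sq_nonneg (√(p s) - 2 * √x), Real.sq_sqrt (hp.1 s), Real.sq_sqrt hx]
    linarith
  have hvq : ∑ s, q s * (V s - m) ^ 2 = variance q V := by
    rw [sum_mul_sub_sq hq.2, ← hm]; ring
  have hvp : variance p V ≤ 2 * variance q V + 14 * Fintype.card S * M ^ 2 * x := by
    calc variance p V ≤ ∑ s, p s * (V s - m) ^ 2 := by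
          rw [sum_mul_sub_sq hp.2]; linarith [sq_nonneg (∑ s, p s * V s - m)]
      _ ≤ ∑ s, (2 * (q s * (V s - m) ^ 2) + 14 * M ^ 2 * x) := by
          refine Finset.sum_le_sum fun s _ => ?_
          have h1 := mul_le_mul_of_nonneg_right (hpq s) (sq_nonneg (V s - m))
          have h2 : (V s - m) ^ 2 ≤ M ^ 2 := by
            refine sq_le_sq' ?_ ?_ <;> linarith [(hV s).1, (hV s).2, hmb.1, hmb.2]
          nlinarith
      _ = _ := by
          rw [Finset.sum_add_distrib, ← Finset.mul_sum, hvq, Finset.sum_const, Finset.card_univ,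
            nsmul_eq_mul]
          ring
  have hv0 := variance_nonneg hq V
  rw [Real.sqrt_le_left (by positivity)]
  have hs := Real.sq_sqrt (show 0 ≤ 10 * Fintype.card S * x * variance q V by positivity)
  have h1 : 5 * Fintype.card S * x * variance p V
      ≤ 10 * Fintype.card S * x * variance q V + 70 * (Fintype.card S * M * x) ^ 2 := by
    have := mul_le_mul_of_nonneg_left hvp (show 0 ≤ 5 * (Fintype.card S : ℝ) * x by positivity)
    nlinarith
  have h2 : 0 ≤ √(10 * Fintype.card S * x * variance q V) * (Fintype.card S * M * x) := by
    positivity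
  nlinarith [sq_nonneg ((Fintype.card S : ℝ) * M * x)]

end Variance

/-! ### Pessimistic planning -/

section Offline

variable {S A : Type*} [Fintype S] [Fintype A] [DecidableEq S] [DecidableEq A] {H N : ℕ}

omit [Fintype A] in
lemma pessV_last (cf ℓ : ℝ) (D : Fin N → Traj S A H) (r : Fin H → S → A → ℝ) :
    pessV cf ℓ D r (Fin.last H) = 0 := by
  simp only [pessV, Fin.reverseInduction_last]; rfl

omit [Fintype A] in
lemma pessV_castSucc (cf ℓ : ℝ) (D : Fin N → Traj S A H) (r : Fin H → S → A → ℝ) (h : Fin H)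
    (s : S) : pessV cf ℓ D r h.castSucc s = ⨆ a, pessQ cf ℓ D r h s a := by
  simp only [pessV, pessQ, Fin.reverseInduction_castSucc]

omit [Fintype A] in
lemma penalty_nonneg {cf ℓ : ℝ} (hcf : 0 ≤ cf) (hℓ : 0 ≤ ℓ) (D : Fin N → Traj S A H) (V : S → ℝ)
    (h : Fin H) (s : S) (a : A) : 0 ≤ penalty cf ℓ D V h s a := by
  unfold penalty
  split_ifs
  · positivity
  · exact le_min (by positivity) (by positivity)

omit [Fintype A] in
lemma penalty_le_horizon (cf ℓ : ℝ) (D : Fin N → Traj S A H) (V : S → ℝ)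
    (h : Fin H) (s : S) (a : A) : penalty cf ℓ D V h s a ≤ H := by
  unfold penalty
  split_ifs
  exacts [le_rfl, min_le_right _ _]

lemma pessQ_le_pessV (cf ℓ : ℝ) (D : Fin N → Traj S A H) (r : Fin H → S → A → ℝ) (h : Fin H)
    (s : S) (a : A) : pessQ cf ℓ D r h s a ≤ pessV cf ℓ D r h.castSucc s := by
  rw [pessV_castSucc]
  exact le_ciSup (Set.finite_range _).bddAbove a

lemma pessV_bounds [Nonempty A] {cf ℓ : ℝ} (hcf : 0 ≤ cf) (hℓ : 0 ≤ ℓ) (D : Fin N → Traj S A H)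
    {r : Fin H → S → A → ℝ} (hr : ∀ h s a, r h s a ∈ Set.Icc (0 : ℝ) 1) (h : Fin (H + 1)) (s : S) :
    0 ≤ pessV cf ℓ D r h s ∧ pessV cf ℓ D r h s ≤ (H : ℝ) - (h : ℕ) := by
  induction h using Fin.reverseInduction generalizing s with
  | last => simp [pessV_last]
  | cast i ih =>
    obtain ⟨a₀⟩ := ‹Nonempty A›
    have hi : ((i : ℕ) : ℝ) + 1 ≤ H := by exact_mod_cast i.2
    constructor
    · exact (le_max_right _ _).trans (pessQ_le_pessV cf ℓ D r i s a₀)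
    · rw [pessV_castSucc]
      have : Nonempty A := ⟨a₀⟩
      refine ciSup_le fun a => ?_
      rw [Fin.val_castSucc]
      refine max_le ?_ (by linarith)
      have hV : ∀ s', 0 ≤ pessV cf ℓ D r i.succ s' ∧
          pessV cf ℓ D r i.succ s' ≤ (H : ℝ) - ((i : ℕ) + 1) := by
        intro s'
        have := ih s'
        rwa [Fin.val_succ, Nat.cast_add, Nat.cast_one] at this
      have h1 := (sum_mul_mem_Icc (fun s' => empKernel_nonneg D N i s a s')
        (sum_empKernel_le_one D N i s a) (by linarith) hV).2
      have h2 := penalty_nonneg hcf hℓ D (pessV cf ℓ D r i.succ) i s a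
      have h3 := (hr i s a).2
      linarith

omit [Fintype A] in
lemma conf_at_positive_count {ℓ : ℝ} {P : Fin H → S → A → S → ℝ} (D : Fin N → Traj S A H)
    (hconf : ∀ h s a s', |empKernel D N h s a s' - P h s a s'| ≤ confRadius ℓ D N h s a s')
    (h : Fin H) (s : S) (a : A) (hn : visitCount D N h s a ≠ 0) (s' : S) :
    |empKernel D N h s a s' - P h s a s'|
      ≤ 2 * √(empKernel D N h s a s' * (ℓ / visitCount D N h s a))
        + 14 * (ℓ / visitCount D N h s a) / 3 := by
  have := hconf h s a s'
  have hn1 : (1 : ℝ) ≤ visitCount D N h s a := by exact_mod_cast Nat.one_le_iff_ne_zero.2 hn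
  rwa [confRadius_eq, max_eq_left hn1] at this

omit [Fintype A] in
/-- The penalty dominates the estimation error of every expectation. -/
lemma abs_error_le_penalty {ℓ : ℝ} (hℓ : 0 ≤ ℓ) {P : Fin H → S → A → S → ℝ} (hP : IsKernel P)
    (D : Fin N → Traj S A H)
    (hconf : ∀ h s a s', |empKernel D N h s a s' - P h s a s'| ≤ confRadius ℓ D N h s a s')
    {V : S → ℝ} (hV : ∀ s, 0 ≤ V s ∧ V s ≤ H) (h : Fin H) (s : S) (a : A) :
    |∑ s', empKernel D N h s a s' * V s' - ∑ s', P h s a s' * V s'| ≤ penalty 5 ℓ D V h s a := by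
  have hH : (0 : ℝ) ≤ H := Nat.cast_nonneg _
  have h1 := sum_mul_mem_Icc (fun s' => empKernel_nonneg D N h s a s')
    (sum_empKernel_le_one D N h s a) hH hV
  have h2 := sum_mul_mem_Icc (hP h s a).1 (hP h s a).2.le hH hV
  have hbound : |∑ s', empKernel D N h s a s' * V s' - ∑ s', P h s a s' * V s'| ≤ H := by
    rw [abs_le]
    constructor <;> linarith [h1.1, h1.2, h2.1, h2.2]
  unfold penalty
  split_ifs with hn
  · exact hbound
  · refine le_min ?_ hbound
    have hx : 0 ≤ ℓ / (visitCount D N h s a : ℝ) := by positivity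
    refine (abs_sum_sub_mul_le ⟨fun s' => empKernel_nonneg D N h s a s',
      sum_empKernel_eq_one D N h s a hn⟩ (hP h s a) hx
      (conf_at_positive_count D hconf h s a hn) hH hV).trans (le_of_eq ?_)
    rw [mul_div_assoc]

omit [Fintype A] in
lemma penalty_le {ℓ : ℝ} (hℓ : 0 ≤ ℓ) {P : Fin H → S → A → S → ℝ} (hP : IsKernel P)
    (D : Fin N → Traj S A H)
    (hconf : ∀ h s a s', |empKernel D N h s a s' - P h s a s'| ≤ confRadius ℓ D N h s a s')
    {V : S → ℝ} (hV : ∀ s, 0 ≤ V s ∧ V s ≤ H) (h : Fin H) (s : S) (a : A)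
    (hn : visitCount D N h s a ≠ 0) :
    penalty 5 ℓ D V h s a
      ≤ √(10 * Fintype.card S * (ℓ / visitCount D N h s a) * variance (P h s a) V)
        + 14 * Fintype.card S * H * (ℓ / visitCount D N h s a) := by
  have hx : 0 ≤ ℓ / (visitCount D N h s a : ℝ) := by positivity
  have h1 := sqrt_variance_le ⟨fun s' => empKernel_nonneg D N h s a s',
      sum_empKernel_eq_one D N h s a hn⟩ (hP h s a) hx
      (conf_at_positive_count D hconf h s a hn) (Nat.cast_nonneg H) hV
  rw [penalty, if_neg hn]
  refine (min_le_left _ _).trans ?_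
  rw [mul_div_assoc]
  linarith

variable [Nonempty A] {ℓ : ℝ} {P : Fin H → S → A → S → ℝ} {D : Fin N → Traj S A H}
  {r : Fin H → S → A → ℝ}

lemma pessV_le_horizon (hℓ : 0 ≤ ℓ) (hr : ∀ h s a, r h s a ∈ Set.Icc (0 : ℝ) 1) (h : Fin (H + 1))
    (s : S) : 0 ≤ pessV 5 ℓ D r h s ∧ pessV 5 ℓ D r h s ≤ H := by
  have h1 := pessV_bounds (by norm_num : (0 : ℝ) ≤ 5) hℓ D hr h s
  have : (0 : ℝ) ≤ (h : ℕ) := Nat.cast_nonneg _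
  exact ⟨h1.1, by linarith [h1.2]⟩

/-- The pessimistic values satisfy the Bellman inequality up to twice the penalty. -/
lemma le_pessV_sub (hℓ : 0 ≤ ℓ) (hP : IsKernel P)
    (hconf : ∀ h s a s', |empKernel D N h s a s' - P h s a s'| ≤ confRadius ℓ D N h s a s')
    (hr : ∀ h s a, r h s a ∈ Set.Icc (0 : ℝ) 1) (h : Fin H) (s : S) (a : A) :
    r h s a - 2 * penalty 5 ℓ D (pessV 5 ℓ D r h.succ) h s a
      ≤ pessV 5 ℓ D r h.castSucc s - ∑ s', P h s a s' * pessV 5 ℓ D r h.succ s' := by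
  have h1 := (le_max_left _ _).trans (pessQ_le_pessV 5 ℓ D r h s a)
  have h2 := (abs_le.1 (abs_error_le_penalty hℓ hP D hconf
    (fun s' => pessV_le_horizon (D := D) hℓ hr h.succ s') h s a)).1
  linarith

/-- The total penalty along the occupancy measure `u`. -/
def totalPenalty (ℓ : ℝ) (D : Fin N → Traj S A H) (r : Fin H → S → A → ℝ) (u : Fin H → S → A → ℝ) :
    ℝ :=
  ∑ h, ∑ s, ∑ a, u h s a * penalty 5 ℓ D (pessV 5 ℓ D r h.succ) h s a

variable {ρ : S → ℝ} {u : Fin H → S → A → ℝ}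

/-- No occupancy measure beats the pessimistic value by more than twice its total penalty. -/
lemma reward_le_pessV (hH : 1 ≤ H) (hℓ : 0 ≤ ℓ) (hP : IsKernel P)
    (hconf : ∀ h s a s', |empKernel D N h s a s' - P h s a s'| ≤ confRadius ℓ D N h s a s')
    (hr : ∀ h s a, r h s a ∈ Set.Icc (0 : ℝ) 1) (hu : IsOccupancy ρ P u) :
    ∑ h, ∑ s, ∑ a, u h s a * r h s a
      ≤ ∑ s, ρ s * pessV 5 ℓ D r 0 s + 2 * totalPenalty ℓ D r u := by
  rw [← hu.telescope hP hH (pessV 5 ℓ D r) (pessV_last 5 ℓ D r), totalPenalty]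
  simp only [Finset.mul_sum, ← Finset.sum_add_distrib]
  refine Finset.sum_le_sum fun h _ => Finset.sum_le_sum fun s _ => Finset.sum_le_sum fun a _ => ?_
  have := mul_le_mul_of_nonneg_left (le_pessV_sub hℓ hP hconf hr h s a) (hu.nonneg h s a)
  linarith

/-- Pessimism: the value estimate is at most the true value of the returned policy. -/
lemma pessV_le_reward (hH : 1 ≤ H) (hℓ : 0 ≤ ℓ) (hP : IsKernel P)
    (hconf : ∀ h s a s', |empKernel D N h s a s' - P h s a s'| ≤ confRadius ℓ D N h s a s')
    (hr : ∀ h s a, r h s a ∈ Set.Icc (0 : ℝ) 1) (hu : IsOccupancy ρ P u) {f : Fin H → S → A}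
    (hf : IsPessOutput 5 ℓ D r f) (huf : ∀ h s a, a ≠ f h s → u h s a = 0) :
    ∑ s, ρ s * pessV 5 ℓ D r 0 s ≤ ∑ h, ∑ s, ∑ a, u h s a * r h s a := by
  rw [← hu.telescope hP hH (pessV 5 ℓ D r) (pessV_last 5 ℓ D r)]
  refine Finset.sum_le_sum fun h _ => Finset.sum_le_sum fun s _ => Finset.sum_le_sum fun a _ => ?_
  by_cases ha : a = f h s
  · refine mul_le_mul_of_nonneg_left ?_ (hu.nonneg h s a)
    have h1 : pessV 5 ℓ D r h.castSucc s ≤ pessQ 5 ℓ D r h s a := by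
      rw [pessV_castSucc, ha]
      exact ciSup_le fun b => hf h s b
    have hV := fun s' => pessV_le_horizon (D := D) hℓ hr h.succ s'
    have h2 := (abs_le.1 (abs_error_le_penalty hℓ hP D hconf hV h s a)).2
    have h3 := (sum_mul_mem_Icc (hP h s a).1 (hP h s a).2.le (Nat.cast_nonneg H) hV).1
    have h4 : pessQ 5 ℓ D r h s a
        ≤ r h s a + ∑ s', P h s a s' * pessV 5 ℓ D r h.succ s' := by
      refine max_le (by linarith) ?_
      linarith [(hr h s a).1]
    linarith
  · rw [huf h s a ha]; simp

/-- Law of total variance along an occupancy measure: the one-step variances of the pessimistic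
values add up to `O(H²)` rather than `H³`, up to the total penalty. -/
lemma sum_variance_le (hH : 1 ≤ H) (hℓ : 0 ≤ ℓ) (hP : IsKernel P)
    (hconf : ∀ h s a s', |empKernel D N h s a s' - P h s a s'| ≤ confRadius ℓ D N h s a s')
    (hr : ∀ h s a, r h s a ∈ Set.Icc (0 : ℝ) 1) (hρ : ρ ∈ stdSimplex ℝ S)
    (hu : IsOccupancy ρ P u) :
    ∑ h, ∑ s, ∑ a, u h s a * variance (P h s a) (pessV 5 ℓ D r h.succ)
      ≤ 2 * H * (H + 2 * totalPenalty ℓ D r u) := by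
  set V := pessV 5 ℓ D r with hV
  have hVb : ∀ h s, 0 ≤ V h s ∧ V h s ≤ H := fun h s => pessV_le_horizon hℓ hr h s
  have hlast : V (Fin.last H) = 0 := pessV_last 5 ℓ D r
  have t1 := hu.telescope hP hH V hlast
  have t2 := hu.telescope hP hH (fun h s => V h s ^ 2) (by funext s; simp [hlast])
  have h2 : 0 ≤ ∑ s, ρ s * V 0 s ^ 2 :=
    Finset.sum_nonneg fun s _ => mul_nonneg (hρ.1 s) (sq_nonneg _)
  have h1 : ∑ s, ρ s * V 0 s ≤ H :=
    (sum_mul_mem_Icc hρ.1 hρ.2.le (Nat.cast_nonneg H) (hVb 0)).2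
  have hpt : ∑ h, ∑ s, ∑ a, u h s a * variance (P h s a) (V h.succ)
      ≤ ∑ h, ∑ s, ∑ a, (2 * H * (u h s a * (V h.castSucc s - ∑ s', P h s a s' * V h.succ s'))
          + 4 * H * (u h s a * penalty 5 ℓ D (V h.succ) h s a)
          - u h s a * (V h.castSucc s ^ 2 - ∑ s', P h s a s' * V h.succ s' ^ 2)) := by
    refine Finset.sum_le_sum fun h _ => Finset.sum_le_sum fun s _ => Finset.sum_le_sum fun a _ => ?_
    have hx := le_pessV_sub hℓ hP hconf hr h s a
    have hr0 := (hr h s a).1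
    have hpv := sum_mul_mem_Icc (hP h s a).1 (hP h s a).2.le (Nat.cast_nonneg H) (hVb h.succ)
    have hvs := hVb h.castSucc s
    have hb := penalty_nonneg (by norm_num : (0 : ℝ) ≤ 5) hℓ D (V h.succ) h s a
    rw [← hV] at hx
    unfold variance
    set PV := ∑ s', P h s a s' * V h.succ s'
    set b := penalty 5 ℓ D (V h.succ) h s a
    set v := V h.castSucc s
    have key : v ^ 2 - PV ^ 2 ≤ 2 * H * (v - PV) + 4 * H * b := by
      have e1 : 0 ≤ v - PV + 2 * b := by linarith
      have e2 : v + PV ≤ 2 * H := by linarith [hvs.2, hpv.2]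
      have e3 : 0 ≤ v + PV := by linarith [hvs.1, hpv.1]
      have e4 := mul_le_mul_of_nonneg_left e2 e1
      nlinarith [mul_nonneg hb e3]
    have := mul_le_mul_of_nonneg_left key (hu.nonneg h s a)
    linarith
  refine hpt.trans ?_
  simp only [Finset.sum_sub_distrib, Finset.sum_add_distrib, ← Finset.mul_sum] at t1 t2 ⊢
  rw [t1, t2]
  change _ ≤ 2 * H * (H + 2 * ∑ h, ∑ s, ∑ a, u h s a * penalty 5 ℓ D (V h.succ) h s a)
  have hH0 : (0 : ℝ) ≤ H := Nat.cast_nonneg _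
  nlinarith

/-- Bound on the total penalty along an occupancy measure `u` that is covered by the visit
probabilities `d` of the data, with a free parameter `γ` that balances variance and coverage. -/
lemma totalPenalty_le (hH : 1 ≤ H) (hℓ : 0 ≤ ℓ) (hP : IsKernel P)
    (hconf : ∀ h s a s', |empKernel D N h s a s' - P h s a s'| ≤ confRadius ℓ D N h s a s')
    (hr : ∀ h s a, r h s a ∈ Set.Icc (0 : ℝ) 1) (hρ : ρ ∈ stdSimplex ℝ S)
    (hu : IsOccupancy ρ P u) {d : Fin H → S → A → ℝ} (hd : ∀ h s a, 0 ≤ d h s a) {L ω Γ γ : ℝ}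
    (hL : 0 < L) (hω : 0 < ω) (hγ : 0 < γ) (hNω : 4 * L ≤ N * ω)
    (hlow : ∀ h s a, N * d h s a ≤ 2 * visitCount D N h s a + 2 * L)
    (hcov : ∑ h, ∑ s, ∑ a, u h s a * (1 / (ω + 2 * d h s a)) ≤ Γ) :
    totalPenalty ℓ D r u
      ≤ (3 * H * ω + 60 * Fintype.card S * ℓ / (N * γ) + 168 * Fintype.card S * H * ℓ / N) * Γ
        + γ * H * (H + 2 * totalPenalty ℓ D r u) := by
  set V := pessV 5 ℓ D r with hV
  have hVb : ∀ h s, 0 ≤ V h s ∧ V h s ≤ H := fun h s => pessV_le_horizon hℓ hr h s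
  have hN : (0 : ℝ) < N := by
    by_contra hc
    have : (N : ℝ) = 0 := le_antisymm (not_lt.1 hc) (Nat.cast_nonneg N)
    rw [this, zero_mul] at hNω
    linarith
  have hH0 : (0 : ℝ) ≤ H := Nat.cast_nonneg _
  set κ := 3 * H * ω + 60 * Fintype.card S * ℓ / (N * γ) + 168 * Fintype.card S * H * ℓ / N
    with hκ
  have hκ0 : 0 ≤ κ := by rw [hκ]; positivity
  have hpt : ∀ h s a, penalty 5 ℓ D (V h.succ) h s a
      ≤ κ * (1 / (ω + 2 * d h s a)) + γ / 2 * variance (P h s a) (V h.succ) := by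
    intro h s a
    have hv := variance_nonneg (hP h s a) (V h.succ)
    have hdd := hd h s a
    set x := ω + 2 * d h s a with hx
    have hx0 : 0 < x := by linarith
    by_cases hdω : d h s a < ω
    · have h1 : (H : ℝ) ≤ 3 * H * ω * (1 / x) := by
        rw [mul_one_div, le_div_iff₀ hx0]
        nlinarith
      have h2 : 3 * H * ω * (1 / x) ≤ κ * (1 / x) := by
        refine mul_le_mul_of_nonneg_right ?_ (by positivity)
        have : 0 ≤ 60 * (Fintype.card S : ℝ) * ℓ / (N * γ)
          + 168 * Fintype.card S * H * ℓ / N := by positivity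
        rw [hκ]; linarith
      have := penalty_le_horizon 5 ℓ D (V h.succ) h s a
      have : 0 ≤ γ / 2 * variance (P h s a) (V h.succ) := by positivity
      linarith
    · push Not at hdω
      have h1 := hlow h s a
      have h2 : (N : ℝ) * ω ≤ N * d h s a := mul_le_mul_of_nonneg_left hdω hN.le
      have hnx : N * x ≤ 12 * visitCount D N h s a := by rw [hx]; nlinarith
      have hn0 : (0 : ℝ) < visitCount D N h s a := by
        have := mul_pos hN hx0
        linarith
      have hn : visitCount D N h s a ≠ 0 := by
        intro hc; rw [hc] at hn0; simp at hn0
      have hX : ℓ / visitCount D N h s a ≤ 12 * ℓ / (N * x) := by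
        rw [div_le_div_iff₀ hn0 (mul_pos hN hx0)]
        nlinarith
      have hp := penalty_le hℓ hP D hconf (hVb h.succ) h s a hn
      set X := ℓ / (visitCount D N h s a : ℝ)
      have hX0 : 0 ≤ X := by positivity
      have hsq : √(10 * Fintype.card S * X * variance (P h s a) (V h.succ))
          ≤ γ / 2 * variance (P h s a) (V h.succ) + 5 * Fintype.card S * X / γ := by
        refine Real.sqrt_le_iff.2 ⟨by positivity, ?_⟩
        have e : 10 * Fintype.card S * X * variance (P h s a) (V h.succ)
            = 4 * (γ / 2 * variance (P h s a) (V h.succ)) * (5 * Fintype.card S * X / γ) := by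
          field_simp; ring
        rw [e]
        nlinarith [sq_nonneg (γ / 2 * variance (P h s a) (V h.succ)
          - 5 * Fintype.card S * X / γ)]
      have h3 : 5 * Fintype.card S * X / γ + 14 * Fintype.card S * H * X ≤ κ * (1 / x) := by
        have h4 : 5 * Fintype.card S * X / γ + 14 * Fintype.card S * H * X
            = (5 * Fintype.card S / γ + 14 * Fintype.card S * H) * X := by ring
        have h5 : 3 * H * ω * (1 / x) + (5 * Fintype.card S / γ + 14 * Fintype.card S * H)
            * (12 * ℓ / (N * x)) = κ * (1 / x) := by
          rw [hκ]; field_simp; ring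
        have h6 : 0 ≤ 3 * H * ω * (1 / x) := by positivity
        have h7 := mul_le_mul_of_nonneg_left hX
          (show 0 ≤ 5 * (Fintype.card S : ℝ) / γ + 14 * Fintype.card S * H by positivity)
        linarith
      linarith
  have hvar := sum_variance_le hH hℓ hP hconf hr hρ hu
  calc totalPenalty ℓ D r u
      ≤ ∑ h, ∑ s, ∑ a, (κ * (u h s a * (1 / (ω + 2 * d h s a)))
        + γ / 2 * (u h s a * variance (P h s a) (V h.succ))) := by
        refine Finset.sum_le_sum fun h _ => Finset.sum_le_sum fun s _ =>
          Finset.sum_le_sum fun a _ => ?_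
        have := mul_le_mul_of_nonneg_left (hpt h s a) (hu.nonneg h s a)
        linarith
    _ = κ * ∑ h, ∑ s, ∑ a, u h s a * (1 / (ω + 2 * d h s a))
        + γ / 2 * ∑ h, ∑ s, ∑ a, u h s a * variance (P h s a) (V h.succ) := by
        simp only [Finset.sum_add_distrib, Finset.mul_sum]
    _ ≤ κ * Γ + γ / 2 * (2 * H * (H + 2 * totalPenalty ℓ D r u)) :=
        add_le_add (mul_le_mul_of_nonneg_left hcov hκ0)
          (mul_le_mul_of_nonneg_left hvar (by positivity))
    _ = _ := by ring

omit [Fintype S] [DecidableEq S] [Nonempty A] in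
lemma detPolicy_isPolicy (f : Fin H → S → A) : IsPolicy (detPolicy f) := by
  intro h s
  refine ⟨fun a => ?_, ?_⟩
  · simp only [detPolicy]; exact single_nonneg _ _
  · simp [detPolicy]

/-- If all total penalties are at most `ε / 2`, the offline algorithm succeeds. The supremum over
policies is taken separately for each initial state, so the comparator is a mixture. -/
lemma suboptimality_le (hH : 1 ≤ H) (hℓ : 0 ≤ ℓ) (hP : IsKernel P)
    (hconf : ∀ h s a s', |empKernel D N h s a s' - P h s a s'| ≤ confRadius ℓ D N h s a s')
    (hr : ∀ h s a, r h s a ∈ Set.Icc (0 : ℝ) 1) (hρ : ρ ∈ stdSimplex ℝ S) {ε : ℝ}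
    (hpen : ∀ u, IsOccupancy ρ P u → 2 * totalPenalty ℓ D r u ≤ ε) {f : Fin H → S → A}
    (hf : IsPessOutput 5 ℓ D r f) :
    ∑ s, ρ s * (optValue P r s - value P r (detPolicy f) s) ≤ ε := by
  have hmix : ∀ π : S → Fin H → S → A → ℝ, (∀ s, IsPolicy (π s)) →
      ∑ s, ρ s * value P r (π s) s = ∑ h, ∑ x, ∑ a,
        (∑ s, ρ s * occ (Pi.single s 1) P (π s) h x a) * r h x a := by
    intro π hπ
    simp_rw [value_eq_sum_occ hP (hπ _), Finset.sum_mul, Finset.mul_sum]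
    rw [Finset.sum_comm]
    refine Finset.sum_congr rfl fun h _ => ?_
    rw [← sum_rotate]
    simp only [mul_assoc]
  refine le_of_forall_pos_le_add fun ε' hε' => ?_
  have hex : ∀ s, ∃ π, IsPolicy π ∧ optValue P r s ≤ value P r π s + ε' := by
    intro s
    have : Nonempty {π : Fin H → S → A → ℝ // IsPolicy π} := ⟨⟨_, uniform_isPolicy⟩⟩
    obtain ⟨π, hπ⟩ := exists_lt_of_lt_ciSup
      (show optValue P r s - ε' < ⨆ π : {π : Fin H → S → A → ℝ // IsPolicy π}, value P r π.1 s by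
        rw [← optValue]; linarith)
    exact ⟨π.1, π.2, by linarith⟩
  choose π hπ hopt using hex
  have hu := isOccupancy_mix hρ.1 hP hπ
  have huf := isOccupancy_mix hρ.1 hP (fun _ : S => detPolicy_isPolicy f)
  have h1 := reward_le_pessV hH hℓ hP hconf hr hu
  have h2 := pessV_le_reward hH hℓ hP hconf hr huf hf (by
    intro h x a ha
    refine Finset.sum_eq_zero fun s _ => ?_
    simp [occ, detPolicy, Pi.single_eq_of_ne ha])
  rw [← hmix _ hπ] at h1
  rw [← hmix _ (fun _ => detPolicy_isPolicy f)] at h2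
  have h3 := hpen _ hu
  have h4 : ∑ s, ρ s * optValue P r s ≤ ∑ s, ρ s * value P r (π s) s + ε' := by
    calc _ ≤ ∑ s, (ρ s * value P r (π s) s + ρ s * ε') := by
          refine Finset.sum_le_sum fun s _ => ?_
          rw [← mul_add]
          exact mul_le_mul_of_nonneg_left (hopt s) (hρ.1 s)
      _ = _ := by rw [Finset.sum_add_distrib, ← Finset.sum_mul, hρ.2, one_mul]
  simp only [mul_sub, Finset.sum_sub_distrib]
  linarith

end Offline

/-! ### The law of a run -/

section Run

variable {S A : Type*} [Fintype S] [Fintype A] [DecidableEq S] [DecidableEq A] {H : ℕ}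

omit [Fintype S] [Fintype A] in
lemma transCount_hist {K : ℕ} (E : Fin K → Traj S A H) (t : Fin K) {m : ℕ} (hm : m ≤ t) :
    transCount (hist E t) m = transCount E m := by
  funext h s a s'
  have hmap : (Finset.univ.filter fun i : Fin K => (i : ℕ) < m ∧ (E i).state h = s ∧
        (E i).action h = a ∧ (E i).next h = s')
      = (Finset.univ.filter fun i : Fin t => (i : ℕ) < m ∧ (hist E t i).state h = s ∧
        (hist E t i).action h = a ∧ (hist E t i).next h = s').map (Fin.castLEEmb t.2.le) := by
    ext i
    simp only [Finset.mem_filter, Finset.mem_univ, true_and, Finset.mem_map]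
    constructor
    · rintro ⟨h1, h2⟩
      exact ⟨⟨i, by omega⟩, ⟨h1, h2⟩, rfl⟩
    · rintro ⟨j, ⟨h1, h2⟩, rfl⟩
      exact ⟨h1, h2⟩
  rw [transCount, transCount, hmap, Finset.card_map]

/-- The iterate `t` of the online algorithm depends on the first `t` trajectories only. -/
lemma occIterate_hist (ρ : S → ℝ) (ℓ c η : ℝ) {K : ℕ} (E : Fin K → Traj S A H) (t : Fin K) (m : ℕ)
    (hm : m ≤ t) : occIterate ρ ℓ c η (hist E t) m = occIterate ρ ℓ c η E m := by
  have hvisit : ∀ m ≤ (t : ℕ), visitCount (hist E t) m = visitCount E m := by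
    intro m hm
    funext h s a
    simp only [visitCount, transCount_hist E t hm]
  have hemp : ∀ m ≤ (t : ℕ), empKernel (hist E t) m = empKernel E m := by
    intro m hm
    funext h s a s'
    simp only [empKernel, transCount_hist E t hm, hvisit m hm]
  have hrad : ∀ m ≤ (t : ℕ), confRadius ℓ (hist E t) m = confRadius ℓ E m := by
    intro m hm
    funext h s a s'
    simp only [confRadius, hemp m hm, hvisit m hm]
  induction m with
  | zero => rfl
  | succ m ih =>
    have hset : {μ | IsConfOccupancy ρ ℓ (hist E t) (m + 1) μ}
        = {μ | IsConfOccupancy ρ ℓ E (m + 1) μ} := by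
      ext μ
      constructor
      · rintro ⟨h1, h2, h3, h4, h5, h6⟩
        rw [hemp _ hm, hrad _ hm] at h5 h6
        exact ⟨h1, h2, h3, h4, h5, h6⟩
      · rintro ⟨h1, h2, h3, h4, h5, h6⟩
        rw [← hemp _ hm, ← hrad _ hm] at h5 h6
        exact ⟨h1, h2, h3, h4, h5, h6⟩
    have hrew : intrinsicReward c (hist E t) m = intrinsicReward c E m := by
      funext h s a
      simp only [intrinsicReward, hvisit m (by omega)]
    simp only [occIterate]
    rw [hset, hrew, ih (by omega)]

lemma occIterate_nonneg (ρ : S → ℝ) (ℓ c η : ℝ) {K : ℕ} (E : Fin K → Traj S A H) (t : ℕ)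
    (h : Fin H) (s : S) (a : A) (s' : S) : 0 ≤ occIterate ρ ℓ c η E t h s a s' := by
  induction t with
  | zero => simp only [occIterate]; positivity
  | succ t ih =>
    simp only [occIterate, omdStep]
    split_ifs with hex
    · exact (hex.choose_spec.1 : IsConfOccupancy ρ ℓ E (t + 1) _).nonneg h s a s'
    · exact ih

lemma explorePolicy_isPolicy [Nonempty A] (ρ : S → ℝ) (cω ℓ ε : ℝ) {K : ℕ}
    (E : Fin K → Traj S A H) (t : ℕ) : IsPolicy (explorePolicy ρ cω ℓ ε E t) :=
  inducedPolicy_isPolicy (occIterate_nonneg ρ ℓ _ _ E t)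

/-- The law of exploration episode `t + 1` given the first `t` trajectories. -/
def episodeLaw (ρ : S → ℝ) (P : Fin H → S → A → S → ℝ) (cω ℓ ε : ℝ) (t : ℕ)
    (E : Fin t → Traj S A H) : Traj S A H → ℝ :=
  trajProb ρ P (explorePolicy ρ cω ℓ ε E t)

/-- The law of a trajectory of the mixture policy `π_exp`. -/
def mixtureLaw (ρ : S → ℝ) (P : Fin H → S → A → S → ℝ) (cω ℓ ε : ℝ) {T : ℕ}
    (E : Fin T → Traj S A H) (z : Traj S A H) : ℝ :=
  1 / (T : ℝ) * ∑ t : Fin T, trajProb ρ P (explorePolicy ρ cω ℓ ε E t) z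

lemma episodeLaw_hist (ρ : S → ℝ) (P : Fin H → S → A → S → ℝ) (cω ℓ ε : ℝ) {T : ℕ}
    (E : Fin T → Traj S A H) (t : Fin T) :
    episodeLaw ρ P cω ℓ ε t (hist E t) = trajProb ρ P (explorePolicy ρ cω ℓ ε E t) := by
  rw [episodeLaw, explorePolicy, occIterate_hist _ _ _ _ E t t le_rfl, explorePolicy]

lemma runProb_eq (ρ : S → ℝ) (P : Fin H → S → A → S → ℝ) (cω ℓ ε : ℝ) {T N : ℕ}
    (E : Fin T → Traj S A H) (D : Fin N → Traj S A H) :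
    runProb ρ P cω ℓ ε E D
      = seqProb (episodeLaw ρ P cω ℓ ε) E * ∏ n, mixtureLaw ρ P cω ℓ ε E (D n) := by
  simp only [runProb, seqProb, episodeLaw_hist, mixtureLaw]

variable [Nonempty A]

lemma episodeLaw_isModelLaw {ρ : S → ℝ} (hρ : ρ ∈ stdSimplex ℝ S) (hH : 1 ≤ H)
    {P : Fin H → S → A → S → ℝ} (hP : IsKernel P) (cω ℓ ε : ℝ) (t : ℕ)
    (E : Fin t → Traj S A H) : IsModelLaw P (episodeLaw ρ P cω ℓ ε t E) :=
  (trajProb_isModelLaw hρ hH hP (explorePolicy_isPolicy ρ cω ℓ ε E t)).1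

lemma mixtureLaw_isModelLaw {ρ : S → ℝ} (hρ : ρ ∈ stdSimplex ℝ S) (hH : 1 ≤ H)
    {P : Fin H → S → A → S → ℝ} (hP : IsKernel P) (cω ℓ ε : ℝ) {T : ℕ} (hT : 1 ≤ T)
    (E : Fin T → Traj S A H) : IsModelLaw P (mixtureLaw ρ P cω ℓ ε E) ∧
      ∀ h s a, visitProb (mixtureLaw ρ P cω ℓ ε E) h s a
        = 1 / (T : ℝ) * ∑ t : Fin T, occ ρ P (explorePolicy ρ cω ℓ ε E t) h s a := by
  have hlaw := fun t : Fin T =>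
    trajProb_isModelLaw hρ hH hP (explorePolicy_isPolicy ρ cω ℓ ε E t)
  have hT0 : (T : ℝ) ≠ 0 := by exact_mod_cast (show T ≠ 0 by omega)
  have hswap : ∀ g : Traj S A H → ℝ, ∑ z, mixtureLaw ρ P cω ℓ ε E z * g z
      = 1 / (T : ℝ) * ∑ t : Fin T, ∑ z, trajProb ρ P (explorePolicy ρ cω ℓ ε E t) z * g z := by
    intro g
    simp only [mixtureLaw, mul_assoc, Finset.sum_mul, ← Finset.mul_sum]
    rw [Finset.sum_comm]
  have hv : ∀ h s a, visitProb (mixtureLaw ρ P cω ℓ ε E) h s a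
      = 1 / (T : ℝ) * ∑ t : Fin T, occ ρ P (explorePolicy ρ cω ℓ ε E t) h s a := by
    intro h s a
    rw [visitProb, hswap]
    congr 1
    exact Finset.sum_congr rfl fun t _ => (hlaw t).2 h s a
  refine ⟨⟨fun z => ?_, ?_, ?_⟩, hv⟩
  · exact mul_nonneg (by positivity) (Finset.sum_nonneg fun t _ => (hlaw t).1.nonneg z)
  · have := hswap (fun _ => 1)
    simp only [mul_one, (hlaw _).1.sum_one] at this
    rw [this]
    simp [hT0]
  · intro h s a s'
    rw [hswap, hv, mul_assoc, Finset.sum_mul]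
    congr 1
    refine Finset.sum_congr rfl fun t _ => ?_
    rw [(hlaw t).1.trans, (hlaw t).2]

lemma sum_prod_law {Ω : Type*} [Fintype Ω] {q : Ω → ℝ} (hq : ∑ z, q z = 1) (N : ℕ) :
    ∑ D : Fin N → Ω, ∏ n, q (D n) = 1 :=
  sum_seqProb (q := fun _ _ => q) (fun _ _ => hq) N

lemma sum_runProb {ρ : S → ℝ} (hρ : ρ ∈ stdSimplex ℝ S) (hH : 1 ≤ H)
    {P : Fin H → S → A → S → ℝ} (hP : IsKernel P) (cω ℓ ε : ℝ) {T : ℕ} (hT : 1 ≤ T) (N : ℕ) :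
    ∑ E : Fin T → Traj S A H, ∑ D : Fin N → Traj S A H, runProb ρ P cω ℓ ε E D = 1 := by
  simp only [runProb_eq, ← Finset.mul_sum,
    sum_prod_law (mixtureLaw_isModelLaw hρ hH hP cω ℓ ε hT _).1.sum_one, mul_one]
  exact sum_seqProb (fun t E => (episodeLaw_isModelLaw hρ hH hP cω ℓ ε t E).sum_one) T

lemma successProb_eq_one {ρ : S → ℝ} (hρ : ρ ∈ stdSimplex ℝ S) (hH : 1 ≤ H)
    {P : Fin H → S → A → S → ℝ} (hP : IsKernel P) (cω cf ℓ ε : ℝ) {T : ℕ} (hT : 1 ≤ T) (N : ℕ)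
    (hs : ∀ D : Fin N → Traj S A H, Succeeds ρ P cf ℓ ε D) :
    successProb T N ρ P cω cf ℓ ε = 1 := by
  simp only [successProb, hs, if_true]
  exact sum_runProb hρ hH hP cω ℓ ε hT N

/-- If the algorithm succeeds on the two concentration events, it succeeds with high
probability. -/
lemma le_successProb {ρ : S → ℝ} (hρ : ρ ∈ stdSimplex ℝ S) (hH : 1 ≤ H)
    {P : Fin H → S → A → S → ℝ} (hP : IsKernel P) (cω cf ℓ ε : ℝ) {T : ℕ} (hT : 1 ≤ T) (N : ℕ)
    (hS : 1 ≤ Fintype.card S) {L : ℝ} (hL : 1 ≤ L)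
    (hs : ∀ (E : Fin T → Traj S A H) (D : Fin N → Traj S A H),
      ExploreGood P (episodeLaw ρ P cω ℓ ε) L E → EstimGood P (mixtureLaw ρ P cω ℓ ε E) L D →
        Succeeds ρ P cf ℓ ε D) :
    1 - 4 * (((T : ℝ) + 1) ^ 2 + 1) * ((Fintype.card S : ℝ) ^ 2 * Fintype.card A * H)
        * Real.exp (-L) ≤ successProb T N ρ P cω cf ℓ ε := by
  classical
  have hmix := fun E : Fin T → Traj S A H => (mixtureLaw_isModelLaw hρ hH hP cω ℓ ε hT E).1
  have hepi := episodeLaw_isModelLaw hρ hH hP cω ℓ ε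
  have hseq0 : ∀ E : Fin T → Traj S A H, 0 ≤ seqProb (episodeLaw ρ P cω ℓ ε) E := fun E =>
    seqProb_nonneg (fun t E => (hepi t E).nonneg) E
  have hprod0 : ∀ (E : Fin T → Traj S A H) (D : Fin N → Traj S A H),
      0 ≤ ∏ n, mixtureLaw ρ P cω ℓ ε E (D n) := fun E D =>
    Finset.prod_nonneg fun n _ => (hmix E).nonneg _
  have h1 := prob_not_exploreGood hP hepi hL hS T
  have h2 := fun E => prob_not_estimGood hP (hmix E) hL hS N
  set b2 := 4 * ((Fintype.card S : ℝ) ^ 2 * Fintype.card A * H) * Real.exp (-L) with hb2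
  have hpt : ∀ (E : Fin T → Traj S A H) (D : Fin N → Traj S A H), runProb ρ P cω ℓ ε E D
      ≤ (if Succeeds ρ P cf ℓ ε D then runProb ρ P cω ℓ ε E D else 0)
        + (if ExploreGood P (episodeLaw ρ P cω ℓ ε) L E then 0
            else seqProb (episodeLaw ρ P cω ℓ ε) E) * ∏ n, mixtureLaw ρ P cω ℓ ε E (D n)
        + seqProb (episodeLaw ρ P cω ℓ ε) E
          * (if EstimGood P (mixtureLaw ρ P cω ℓ ε E) L D then 0
            else ∏ n, mixtureLaw ρ P cω ℓ ε E (D n)) := by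
    intro E D
    rw [runProb_eq]
    have := mul_nonneg (hseq0 E) (hprod0 E D)
    by_cases hg1 : ExploreGood P (episodeLaw ρ P cω ℓ ε) L E
    · by_cases hg2 : EstimGood P (mixtureLaw ρ P cω ℓ ε E) L D
      · simp [hs E D hg1 hg2, hg1, hg2]
      · rw [if_pos hg1, if_neg hg2]
        split_ifs <;> linarith
    · rw [if_neg hg1]
      split_ifs <;> simp <;> linarith
  have hsum := Finset.sum_le_sum fun E (_ : E ∈ Finset.univ) =>
    Finset.sum_le_sum fun D (_ : D ∈ Finset.univ) => hpt E D
  rw [sum_runProb hρ hH hP cω ℓ ε hT N] at hsum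
  simp only [Finset.sum_add_distrib, ← Finset.mul_sum, sum_prod_law (hmix _).sum_one,
    mul_one] at hsum
  have h3 : ∑ E : Fin T → Traj S A H, seqProb (episodeLaw ρ P cω ℓ ε) E
      * ∑ D : Fin N → Traj S A H, (if EstimGood P (mixtureLaw ρ P cω ℓ ε E) L D then 0
            else ∏ n, mixtureLaw ρ P cω ℓ ε E (D n)) ≤ b2 := by
    calc _ ≤ ∑ E : Fin T → Traj S A H, seqProb (episodeLaw ρ P cω ℓ ε) E * b2 :=
          Finset.sum_le_sum fun E _ => mul_le_mul_of_nonneg_left (h2 E) (hseq0 E)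
      _ = b2 := by
          rw [← Finset.sum_mul, sum_seqProb (fun t E => (hepi t E).sum_one), one_mul]
  have hsucc : successProb T N ρ P cω cf ℓ ε = ∑ E : Fin T → Traj S A H,
      ∑ D : Fin N → Traj S A H,
        if Succeeds ρ P cf ℓ ε D then runProb ρ P cω ℓ ε E D else 0 := by
    unfold successProb
    refine Finset.sum_congr rfl fun E _ => Finset.sum_congr rfl fun D _ => ?_
    congr
  rw [hsucc]
  have e : 4 * (((T : ℝ) + 1) ^ 2 + 1) * ((Fintype.card S : ℝ) ^ 2 * Fintype.card A * H)
        * Real.exp (-L) = 4 * ((T : ℝ) + 1) ^ 2 * ((Fintype.card S : ℝ) ^ 2 * Fintype.card A * H)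
        * Real.exp (-L) + b2 := by rw [hb2]; ring
  rw [e]
  linarith

end Run

/-! ### Coverage and the guarantee -/

section Guarantee

variable {S A : Type*} [Fintype S] [Fintype A] [DecidableEq S] [DecidableEq A] {H : ℕ}

lemma sum_fin_ite_lt (F : ℕ → ℝ) {m T : ℕ} (hm : m ≤ T) :
    ∑ t : Fin T, (if (t : ℕ) < m then F t else 0) = ∑ t ∈ Finset.range m, F t := by
  rw [← Finset.sum_range (fun t => if t < m then F t else 0), ← Finset.sum_filter]
  congr 1
  ext t
  simp only [Finset.mem_filter, Finset.mem_range]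
  omega

/-- Coverage: on the concentration event of the exploration phase the mixture policy visits every
state-action pair about as often as any occupancy measure does, in the sense of a bounded
`χ²`-type ratio, up to the significance level. -/
lemma coverage [Nonempty S] [Nonempty A] {ρ : S → ℝ} (hρ : ρ ∈ stdSimplex ℝ S) (hH : 1 ≤ H)
    {P : Fin H → S → A → S → ℝ} (hP : IsKernel P) {cω ε L ℓ : ℝ} (hL : 3 ≤ L) (hℓ : ℓ = 100 * L)
    (hSA : 2 ≤ Fintype.card S * Fintype.card A) (hω : 0 < sigLevel S A H cω ℓ ε)
    {T : ℕ} (hT : numEpisodes S A H cω ℓ ε = T) (hT1 : 1 ≤ Real.log T)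
    (hT2 : Real.log (1 + T) ≤ L) (E : Fin T → Traj S A H)
    (hE : ExploreGood P (episodeLaw ρ P cω ℓ ε) L E)
    {u : Fin H → S → A → ℝ} (hu : IsOccupancy ρ P u) :
    ∑ h, ∑ s, ∑ a, u h s a * (1 / (sigLevel S A H cω ℓ ε
        + 2 * visitProb (mixtureLaw ρ P cω ℓ ε E) h s a))
      ≤ Fintype.card S * Fintype.card A * H * ℓ ^ 2 := by
  have hTω : 2 * regConst S H ℓ / sigLevel S A H cω ℓ ε ≤ T := by
    rw [← hT]; exact Nat.le_ceil _
  rw [div_le_iff₀ hω] at hTω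
  have hstep := stepSize_bounds (S := S) (A := A) (cω := cω) (ε := ε) (ℓ := ℓ) hH
    Fintype.card_pos Fintype.card_pos hSA
  rw [hT] at hstep
  generalize sigLevel S A H cω ℓ ε = ω at hω hTω ⊢
  set c := regConst S H ℓ with hc
  have hS : (1 : ℝ) ≤ Fintype.card S := by exact_mod_cast Fintype.card_pos
  have hA : (1 : ℝ) ≤ Fintype.card A := by exact_mod_cast Fintype.card_pos
  have hH' : (1 : ℝ) ≤ H := by exact_mod_cast hH
  have hTpos : (0 : ℝ) < T := by
    by_contra h0
    have : (T : ℝ) = 0 := le_antisymm (not_lt.1 h0) (Nat.cast_nonneg T)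
    rw [this, Real.log_zero] at hT1
    linarith
  have hTnat : 1 ≤ T := by exact_mod_cast hTpos
  have hlogle : Real.log T ≤ ℓ := by
    have := Real.log_le_log hTpos (show (T : ℝ) ≤ 1 + T by linarith)
    linarith
  have hmix := (mixtureLaw_isModelLaw hρ hH hP cω ℓ ε hTnat E).2
  have hvis : ∀ (t : Fin T) h s a, visitProb (episodeLaw ρ P cω ℓ ε t (hist E t)) h s a
      = occ ρ P (explorePolicy ρ cω ℓ ε E t) h s a := by
    intro t h s a
    rw [episodeLaw_hist]
    exact (trajProb_isModelLaw hρ hH hP (explorePolicy_isPolicy ρ cω ℓ ε E t)).2 h s a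
  obtain ⟨hη0, hη1, hη2⟩ := hstep (show 1 ≤ ℓ by linarith) hT1 hlogle
  have hgain := comparator_gain_le hρ hH hP (show 1 ≤ L by linarith) (show 1 ≤ ℓ by linarith)
    hη0 hη1 hη2 E (by rw [hℓ]; exact hE.conf) (by
      intro m hm h s a
      have := hE.lower m hm h s a
      simp only [hvis] at this
      rwa [sum_fin_ite_lt (fun t => occ ρ P (explorePolicy ρ cω ℓ ε E t) h s a) hm] at this) hu
  have hc0 : L ≤ c := by
    have h1 : (1 : ℝ) ≤ Fintype.card S * (H : ℝ) ^ 2 := by nlinarith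
    have : c = 4 * (Fintype.card S * (H : ℝ) ^ 2) * ℓ := by rw [hc, regConst]; ring
    rw [this]
    nlinarith
  have hle : ∑ h, ∑ s, ∑ a, u h s a
        * (1 / (ω + 2 * visitProb (mixtureLaw ρ P cω ℓ ε E) h s a))
      ≤ T * ∑ h, ∑ s, ∑ a, u h s a * (1 / (c + visitCount E T h s a)) := by
    simp only [Finset.mul_sum]
    refine Finset.sum_le_sum fun h _ => Finset.sum_le_sum fun s _ => Finset.sum_le_sum fun a _ => ?_
    have hup := hE.upper h s a
    simp only [hvis] at hup
    have hd : (T : ℝ) * visitProb (mixtureLaw ρ P cω ℓ ε E) h s a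
        = ∑ t : Fin T, occ ρ P (explorePolicy ρ cω ℓ ε E t) h s a := by
      rw [hmix]; field_simp
    rw [← hd] at hup
    set d := visitProb (mixtureLaw ρ P cω ℓ ε E) h s a with hdd
    have hd0 : 0 ≤ d := visitProb_nonneg (mixtureLaw_isModelLaw hρ hH hP cω ℓ ε hTnat E).1 h s a
    have hn0 : (0 : ℝ) ≤ visitCount E T h s a := Nat.cast_nonneg _
    rw [mul_left_comm]
    refine mul_le_mul_of_nonneg_left ?_ (hu.nonneg h s a)
    rw [mul_one_div, div_le_div_iff₀ (by linarith) (by linarith)]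
    nlinarith
  refine (hle.trans hgain).trans ?_
  set x : ℝ := (Fintype.card S : ℝ) * Fintype.card A with hx
  have hx1 : 1 ≤ x := by rw [hx]; nlinarith
  have hxH : x ≤ x * H := by nlinarith
  have hlog0 : 0 ≤ Real.log (1 + T) := Real.log_nonneg (by linarith)
  have h1 : (2 * L + 3) * Real.log (1 + T) ≤ 3 * L * L :=
    mul_le_mul (by linarith) hT2 hlog0 (by linarith)
  have h2 := mul_le_mul_of_nonneg_left h1 (show 0 ≤ 84 * (x * H) by positivity)
  have h3 : x ≤ x * H * L ^ 2 := by
    have : 1 ≤ L ^ 2 := by nlinarith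
    nlinarith
  have h4 : 0 ≤ x * H * L ^ 2 := by positivity
  rw [hℓ]
  nlinarith

/-- On both concentration events the offline algorithm succeeds, once `N` is large enough. -/
lemma succeeds_of_good [Nonempty S] [Nonempty A] {ρ : S → ℝ} (hρ : ρ ∈ stdSimplex ℝ S) (hH : 1 ≤ H)
    {P : Fin H → S → A → S → ℝ} (hP : IsKernel P) {ε L ℓ : ℝ} (hL : 3 ≤ L) (hℓ : ℓ = 100 * L)
    (hSA : 2 ≤ Fintype.card S * Fintype.card A) (hε : 0 < ε) (hεH : ε ≤ H)
    {T : ℕ} (hT : numEpisodes S A H (1 / 100) ℓ ε = T) (hT1 : 1 ≤ Real.log T)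
    (hT2 : Real.log (1 + T) ≤ L) (E : Fin T → Traj S A H)
    (hE : ExploreGood P (episodeLaw ρ P (1 / 100) ℓ ε) L E) {N : ℕ}
    (D : Fin N → Traj S A H) (hD : EstimGood P (mixtureLaw ρ P (1 / 100) ℓ ε E) L D)
    (hN : 20000 * ((Fintype.card S : ℝ) ^ 2 * Fintype.card A * (H : ℝ) ^ 3 * ℓ ^ 3)
      ≤ N * ε ^ 2) :
    Succeeds ρ P 5 ℓ ε D := by
  have hT0 : 1 ≤ T := by
    by_contra h0
    have : T = 0 := by omega
    rw [this] at hT1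
    simp at hT1
    linarith
  subst hℓ
  intro r hr f hf
  have hS : (1 : ℝ) ≤ Fintype.card S := by exact_mod_cast Fintype.card_pos
  have hA : (1 : ℝ) ≤ Fintype.card A := by exact_mod_cast Fintype.card_pos
  have hH' : (1 : ℝ) ≤ H := by exact_mod_cast hH
  have hωdef : sigLevel S A H (1 / 100) (100 * L) ε
      = 1 / 100 * ε / (Fintype.card S * Fintype.card A * (H : ℝ) ^ 2 * (100 * L) ^ 2) := rfl
  have hcov := fun u (hu : IsOccupancy ρ P u) => coverage hρ hH hP hL rfl hSA
    (by rw [hωdef]; positivity) hT hT1 hT2 E hE hu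
  have hd := fun h s a => visitProb_nonneg
    (mixtureLaw_isModelLaw hρ hH hP (1 / 100) (100 * L) ε hT0 E).1 h s a
  set ℓ := 100 * L with hℓ
  have hℓ0 : 0 < ℓ := by linarith
  set ω := sigLevel S A H (1 / 100) ℓ ε
  have hω : 0 < ω := by rw [hωdef]; positivity
  set σ : ℝ := (Fintype.card S : ℝ) with hσ
  set α : ℝ := (Fintype.card A : ℝ) with hα
  set Z := σ ^ 2 * α * (H : ℝ) ^ 3 * ℓ ^ 3 with hZ
  have hZ0 : 0 < Z := by rw [hZ]; positivity
  have hNpos : (0 : ℝ) < N := by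
    by_contra h0
    have : (N : ℝ) = 0 := le_antisymm (not_lt.1 h0) (Nat.cast_nonneg N)
    rw [this, zero_mul] at hN
    linarith
  have hNω : 4 * L ≤ N * ω := by
    rw [hωdef, mul_div_assoc', le_div_iff₀ (by positivity)]
    have h1 : 4 * L * (σ * α * (H : ℝ) ^ 2 * ℓ ^ 2) * ε ≤ 20000 / 100 * Z := by
      have e : Z = (σ * α * (H : ℝ) ^ 2 * ℓ ^ 2) * (ℓ * (σ * H)) := by rw [hZ]; ring
      have h2 : L * ε ≤ ℓ * (σ * H) := by
        refine mul_le_mul (by linarith) ?_ hε.le hℓ0.le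
        nlinarith
      have h3 := mul_le_mul_of_nonneg_left h2
        (show 0 ≤ σ * α * (H : ℝ) ^ 2 * ℓ ^ 2 by positivity)
      rw [e]
      have h4 : 0 ≤ (σ * α * (H : ℝ) ^ 2 * ℓ ^ 2) * (ℓ * (σ * H)) := by positivity
      linarith
    refine le_of_mul_le_mul_right ?_ hε
    linarith
  refine suboptimality_le hH hℓ0.le hP hD.conf hr hρ (fun u hu => ?_) hf
  set γ := ε / (16 * (H : ℝ) ^ 2) with hγ
  have hγ0 : 0 < γ := by rw [hγ]; positivity
  have hB := totalPenalty_le hH hℓ0.le hP hD.conf hr hρ hu hd (show 0 < L by linarith) hω hγ0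
    hNω hD.lower (hcov u hu)
  set B := totalPenalty ℓ D r u with hBdef
  have hB0 : 0 ≤ B := Finset.sum_nonneg fun h _ => Finset.sum_nonneg fun s _ =>
    Finset.sum_nonneg fun a _ => mul_nonneg (hu.nonneg h s a)
      (penalty_nonneg (by norm_num) hℓ0.le D _ h s a)
  -- the four contributions: uncovered pairs, variance, lower order, and self-bounding
  have t1 : 3 * H * ω * (σ * α * H * ℓ ^ 2) = 3 / 100 * ε := by
    rw [hωdef]; field_simp
  have t2 : 60 * σ * ℓ / (N * γ) * (σ * α * H * ℓ ^ 2) ≤ 960 / 20000 * ε := by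
    have e : 60 * σ * ℓ / (N * γ) * (σ * α * H * ℓ ^ 2) = 960 * Z / (N * ε) := by
      rw [hγ, hZ]; field_simp; norm_num
    rw [e, div_le_iff₀ (by positivity)]
    linarith
  have t3 : 168 * σ * H * ℓ / N * (σ * α * H * ℓ ^ 2) ≤ 168 / 20000 * ε := by
    have e : 168 * σ * H * ℓ / N * (σ * α * H * ℓ ^ 2) = 168 * Z / (N * H) := by
      rw [hZ]; field_simp
    rw [e, div_le_iff₀ (by positivity)]
    have : (N : ℝ) * ε ^ 2 ≤ N * (ε * H) := by
      refine mul_le_mul_of_nonneg_left ?_ hNpos.le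
      nlinarith
    linarith
  have t4 : γ * H * (H + 2 * B) ≤ ε / 16 + B / 8 := by
    have e : γ * H * (H + 2 * B) = ε / 16 + B / 8 * (ε / H) := by
      rw [hγ]; field_simp; ring
    rw [e]
    have h1 : ε / H ≤ 1 := by rw [div_le_one (by linarith)]; exact hεH
    have := mul_le_mul_of_nonneg_left h1 (show 0 ≤ B / 8 by linarith)
    linarith
  rw [add_mul, add_mul] at hB
  linarith

omit [DecidableEq A] in
lemma value_bounds {P : Fin H → S → A → S → ℝ} (hP : IsKernel P) {r : Fin H → S → A → ℝ}
    (hr : ∀ h s a, r h s a ∈ Set.Icc (0 : ℝ) 1) {π : Fin H → S → A → ℝ} (hπ : IsPolicy π) (s : S) :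
    0 ≤ value P r π s ∧ value P r π s ≤ H := by
  have hu := occ_isOccupancy (single_nonneg s) hP hπ
  rw [value_eq_sum_occ hP hπ]
  refine ⟨Finset.sum_nonneg fun h _ => Finset.sum_nonneg fun x _ => Finset.sum_nonneg fun a _ =>
    mul_nonneg (hu.nonneg h x a) (hr h x a).1, ?_⟩
  calc _ ≤ ∑ h : Fin H, ∑ x, ∑ a, occ (Pi.single s 1) P π h x a :=
        Finset.sum_le_sum fun h _ => Finset.sum_le_sum fun x _ => Finset.sum_le_sum fun a _ =>
          mul_le_of_le_one_right (hu.nonneg h x a) (hr h x a).2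
    _ = H := by
        rw [Finset.sum_congr rfl fun h _ => hu.total (by simp) hP h]; simp

lemma succeeds_of_horizon_le [Nonempty A] {ρ : S → ℝ} (hρ : ρ ∈ stdSimplex ℝ S)
    {P : Fin H → S → A → S → ℝ} (hP : IsKernel P) {cf ℓ ε : ℝ} (hε : (H : ℝ) ≤ ε) {N : ℕ}
    (D : Fin N → Traj S A H) : Succeeds ρ P cf ℓ ε D := by
  intro r hr f _
  have : Nonempty {π : Fin H → S → A → ℝ // IsPolicy π} := ⟨⟨_, uniform_isPolicy⟩⟩
  calc _ ≤ ∑ s, ρ s * (H : ℝ) := by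
        refine Finset.sum_le_sum fun s _ => mul_le_mul_of_nonneg_left ?_ (hρ.1 s)
        have h1 : optValue P r s ≤ H := ciSup_le fun π => (value_bounds hP hr π.2 s).2
        have h2 := (value_bounds hP hr (detPolicy_isPolicy f) s).1
        linarith
    _ ≤ ε := by rw [← Finset.sum_mul, hρ.2, one_mul]; exact hε

lemma succeeds_of_subsingleton [Nonempty A] [Subsingleton A] {ρ : S → ℝ}
    (hρ : ρ ∈ stdSimplex ℝ S) {P : Fin H → S → A → S → ℝ} {cf ℓ ε : ℝ} (hε : 0 ≤ ε) {N : ℕ}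
    (D : Fin N → Traj S A H) : Succeeds ρ P cf ℓ ε D := by
  intro r _ f _
  have : Nonempty {π : Fin H → S → A → ℝ // IsPolicy π} := ⟨⟨_, uniform_isPolicy⟩⟩
  have heq : ∀ π : Fin H → S → A → ℝ, IsPolicy π → π = fun _ _ _ => 1 := by
    intro π hπ
    funext h s a
    rw [← (hπ h s).2, Fintype.sum_subsingleton _ a]
  refine (Finset.sum_nonpos fun s _ => ?_).trans hε
  refine mul_nonpos_of_nonneg_of_nonpos (hρ.1 s) (sub_nonpos.2 (ciSup_le fun π => ?_))
  rw [heq _ π.2, heq _ (detPolicy_isPolicy f)]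

/-- The argument `X` of the logarithmic factor dominates all quantities polynomially. -/
lemma parameter_bounds {σ α h ε δ : ℝ} (hσ : 1 ≤ σ) (hα : 1 ≤ α) (hh : 1 ≤ h) (hσα : 2 ≤ σ * α)
    (hε : 0 < ε) (hδ : 0 < δ) (hδ1 : δ < 1) :
    2 ≤ σ * α * h / (δ * min ε 1) ∧
      σ ^ 2 * α * h ^ 4 / ε ≤ (σ * α * h / (δ * min ε 1)) ^ 4 ∧
      σ ^ 2 * α * h ≤ δ * (σ * α * h / (δ * min ε 1)) ^ 2 := by
  set m := min ε 1 with hm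
  have hm0 : 0 < m := lt_min hε one_pos
  have hm1 : m ≤ 1 := min_le_right _ _
  have hmε : m ≤ ε := min_le_left _ _
  have hdm : 0 < δ * m := mul_pos hδ hm0
  set y := σ * α * h with hy
  have hy2 : 2 ≤ y := by rw [hy]; nlinarith
  have hσy : σ ^ 2 * α * h ≤ y ^ 2 := by
    have e : y ^ 2 = σ ^ 2 * α * h * (α * h) := by rw [hy]; ring
    rw [e]
    have : 1 ≤ α * h := by nlinarith
    nlinarith [show 0 ≤ σ ^ 2 * α * h by positivity]
  have hσy4 : σ ^ 2 * α * h ^ 4 ≤ y ^ 4 := by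
    have e : y ^ 4 = σ ^ 2 * α * h ^ 4 * (σ ^ 2 * α ^ 3) := by rw [hy]; ring
    rw [e]
    have h1 : 1 ≤ σ ^ 2 := one_le_pow₀ hσ
    have h2 : 1 ≤ α ^ 3 := one_le_pow₀ hα
    have : 1 ≤ σ ^ 2 * α ^ 3 := by nlinarith
    nlinarith [show 0 ≤ σ ^ 2 * α * h ^ 4 by positivity]
  have hyX : y / m ≤ y / (δ * m) :=
    div_le_div_of_nonneg_left (by linarith) hdm (by nlinarith)
  have hym : y ≤ y / m := by
    rw [le_div_iff₀ hm0]; nlinarith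
  refine ⟨by linarith, ?_, ?_⟩
  · calc σ ^ 2 * α * h ^ 4 / ε ≤ y ^ 4 / m :=
          div_le_div₀ (by positivity) hσy4 hm0 hmε
      _ ≤ y ^ 4 / m ^ 4 := by
          refine div_le_div_of_nonneg_left (by positivity) (by positivity) ?_
          have : m ^ 4 ≤ m ^ 1 := pow_le_pow_of_le_one hm0.le hm1 (by norm_num)
          simpa using this
      _ = (y / m) ^ 4 := by rw [div_pow]
      _ ≤ _ := pow_le_pow_left₀ (by positivity) hyX 4
  · have e : δ * (y / (δ * m)) ^ 2 = y ^ 2 / (δ * m ^ 2) := by field_simp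
    rw [e, le_div_iff₀ (by positivity)]
    have h1 : δ * m ^ 2 ≤ 1 := by
      have : m ^ 2 ≤ 1 := pow_le_one₀ hm0.le hm1
      nlinarith
    nlinarith [show 0 ≤ σ ^ 2 * α * h by positivity]

omit [DecidableEq S] [DecidableEq A] in
/-- The number of episodes is at most polynomial in the argument of the logarithmic factor. -/
lemma numEpisodes_bounds [Nonempty S] [Nonempty A] (hH : 1 ≤ H) {ε X : ℝ} (hε : 0 < ε)
    (hεH : ε ≤ H) (hX : 2 ≤ X)
    (hX4 : (Fintype.card S : ℝ) ^ 2 * Fintype.card A * (H : ℝ) ^ 4 / ε ≤ X ^ 4) :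
    1 ≤ Real.log (numEpisodes S A H (1 / 100) (20000 * Real.log X) ε) ∧
      (numEpisodes S A H (1 / 100) (20000 * Real.log X) ε : ℝ) + 1 ≤ 10 ^ 16 * X ^ 7 := by
  have hS : (1 : ℝ) ≤ Fintype.card S := by exact_mod_cast Fintype.card_pos
  have hA : (1 : ℝ) ≤ Fintype.card A := by exact_mod_cast Fintype.card_pos
  have hH' : (1 : ℝ) ≤ H := by exact_mod_cast hH
  have hlog : 1 / 2 ≤ Real.log X := by
    have h1 := Real.log_two_gt_d9
    have h2 := Real.log_le_log (by norm_num) hX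
    linarith
  have hlogX : Real.log X ≤ X := by
    have := Real.log_le_sub_one_of_pos (show 0 < X by linarith); linarith
  set lg := Real.log X
  have hlg0 : 0 < lg := by linarith
  have hval : 2 * regConst S H (20000 * lg) / sigLevel S A H (1 / 100) (20000 * lg) ε
      = 6400000000000000 * ((Fintype.card S : ℝ) ^ 2 * Fintype.card A * (H : ℝ) ^ 4 / ε)
        * lg ^ 3 := by
    rw [regConst, sigLevel]; field_simp; norm_num
  set G := (Fintype.card S : ℝ) ^ 2 * Fintype.card A * (H : ℝ) ^ 4 / ε with hG
  have hG1 : 1 ≤ G := by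
    rw [hG, le_div_iff₀ hε, one_mul]
    have h1 : (1 : ℝ) ≤ (Fintype.card S : ℝ) ^ 2 * Fintype.card A := by
      have := one_le_pow₀ (n := 2) hS; nlinarith
    have h2 : (H : ℝ) ≤ (H : ℝ) ^ 4 := le_self_pow₀ hH' (by norm_num)
    nlinarith
  rw [numEpisodes, hval]
  constructor
  · have h1 : (3 : ℝ) ≤ 6400000000000000 * G * lg ^ 3 := by
      have h2 : (1 / 2 : ℝ) ^ 3 ≤ lg ^ 3 := pow_le_pow_left₀ (by norm_num) hlog 3
      nlinarith
    have h3 := h1.trans (Nat.le_ceil _)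
    rw [Real.le_log_iff_exp_le (by linarith)]
    have := Real.exp_one_lt_d9
    linarith
  · have h1 := (Nat.ceil_lt_add_one (show 0 ≤ 6400000000000000 * G * lg ^ 3 by positivity)).le
    have h2 : G * lg ^ 3 ≤ X ^ 7 := by
      have e : X ^ 7 = X ^ 4 * X ^ 3 := by ring
      rw [e]
      exact mul_le_mul hX4 (pow_le_pow_left₀ hlg0.le hlogX 3) (by positivity) (by positivity)
    have h3 : 1 ≤ X ^ 7 := one_le_pow₀ (by linarith)
    linarith

end Guarantee

end RewardFree

end

theorem mainTheorem5 :
    ∃ κ cω cf C : ℝ, 0 < κ ∧ 0 < cω ∧ 0 < cf ∧ 0 < C ∧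
      ∀ (S A : Type*) [Fintype S] [Fintype A] [DecidableEq S] [DecidableEq A] [Nonempty A]
        (H : ℕ) (_ : 1 ≤ H) (ρ : S → ℝ) (_ : ρ ∈ stdSimplex ℝ S)
        (P : Fin H → S → A → S → ℝ) (_ : RewardFree.IsKernel P)
        (ε δ : ℝ) (_ : 0 < ε) (_ : 0 < δ) (_ : δ < 1) (N : ℕ)
        (_ : C * ((Fintype.card S : ℝ) ^ 2 * Fintype.card A * (H : ℝ) ^ 3 *
            RewardFree.logFactor S A H ε δ ^ 3 / ε ^ 2) ≤ N),
        1 - δ ≤ RewardFree.successProb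
          (RewardFree.numEpisodes S A H cω (κ * RewardFree.logFactor S A H ε δ) ε) N ρ P cω cf
          (κ * RewardFree.logFactor S A H ε δ) ε := by
  -- With `κ = 20000` the bonus level is `ℓ = 100 L`, where `L = 200 ℓ₀` is the exponent in the
  -- failure probability `exp (-L)` of a single event. The constant `C` contains `κ³` since the
  -- lower bound on `N` is used in terms of `ℓ`.
  refine ⟨20000, 1 / 100, 5, 20000 * 20000 ^ 3, by norm_num, by norm_num, by norm_num,
    by norm_num, ?_⟩
  intro S A _ _ _ _ _ H hH ρ hρ P hP ε δ hε hδ hδ1 N hN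
  have hSne : Nonempty S := by
    by_contra hc
    rw [not_nonempty_iff] at hc
    have := hρ.2
    simp at this
  have hS : (1 : ℝ) ≤ Fintype.card S := by exact_mod_cast Fintype.card_pos
  have hA : (1 : ℝ) ≤ Fintype.card A := by exact_mod_cast Fintype.card_pos
  have hH' : (1 : ℝ) ≤ H := by exact_mod_cast hH
  have hlog0 : 0 < RewardFree.logFactor S A H ε δ := by
    have hm : 0 < min ε 1 := lt_min hε one_pos
    refine Real.log_pos ?_
    rw [lt_div_iff₀ (mul_pos hδ hm), one_mul]
    have h1 : δ * min ε 1 < 1 := by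
      have := min_le_right ε 1
      nlinarith
    have h2 : (1 : ℝ) ≤ Fintype.card S * Fintype.card A := by nlinarith
    nlinarith
  set l := RewardFree.logFactor S A H ε δ with hl
  have hTpos : 1 ≤ RewardFree.numEpisodes S A H (1 / 100) (20000 * l) ε := by
    refine Nat.one_le_iff_ne_zero.2 (Nat.ceil_pos.2 ?_).ne'
    rw [RewardFree.regConst, RewardFree.sigLevel]
    positivity
  by_cases hεH : (H : ℝ) ≤ ε
  · rw [RewardFree.successProb_eq_one hρ hH hP _ _ _ _ hTpos N
      (fun D => RewardFree.succeeds_of_horizon_le hρ hP hεH D)]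
    linarith
  by_cases hSA : 2 ≤ Fintype.card S * Fintype.card A
  swap
  · have hA1 : Fintype.card A ≤ 1 := by
      have h1 : 1 ≤ Fintype.card S := Fintype.card_pos
      by_contra h2
      nlinarith
    have : Subsingleton A := Fintype.card_le_one_iff_subsingleton.1 hA1
    rw [RewardFree.successProb_eq_one hρ hH hP _ _ _ _ hTpos N
      (fun D => RewardFree.succeeds_of_subsingleton hρ hε.le D)]
    linarith
  push Not at hεH
  have hSA' : (2 : ℝ) ≤ Fintype.card S * Fintype.card A := by exact_mod_cast hSA
  obtain ⟨hX2, hX4, hXδ⟩ := RewardFree.parameter_bounds hS hA hH' hSA' hε hδ hδ1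
  set X := (Fintype.card S * Fintype.card A * H : ℝ) / (δ * min ε 1) with hX
  have hlX : l = Real.log X := rfl
  have hX0 : 0 < X := by linarith
  obtain ⟨hT1, hT2⟩ := RewardFree.numEpisodes_bounds (S := S) (A := A) hH hε hεH.le hX2 hX4
  rw [← hlX] at hT1 hT2
  -- `exp L = X ^ 200` beats the polynomially many events
  have hexp : Real.exp (200 * l) = X ^ 200 := by
    rw [hlX, mul_comm, Real.exp_mul, Real.exp_log hX0]
    exact_mod_cast Real.rpow_natCast X 200
  have hl2 : 1 / 2 ≤ l := by
    have h1 := Real.log_two_gt_d9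
    have h2 := Real.log_le_log (by norm_num) hX2
    rw [hlX]; linarith
  have he : 20000 * l = 100 * (200 * l) := by ring
  rw [he] at hTpos hT1 hT2 ⊢
  set L := 200 * l with hL
  have hL3 : 3 ≤ L := by linarith
  set T := RewardFree.numEpisodes S A H (1 / 100) (100 * L) ε with hT
  have hTL : Real.log (1 + T) ≤ L := by
    rw [Real.log_le_iff_le_exp (by positivity), hexp]
    calc (1 : ℝ) + T ≤ 10 ^ 16 * X ^ 7 := by linarith
      _ ≤ 2 ^ 193 * X ^ 7 := by
          refine mul_le_mul_of_nonneg_right (by norm_num) (by positivity)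
      _ ≤ X ^ 193 * X ^ 7 := by
          refine mul_le_mul_of_nonneg_right ?_ (by positivity)
          exact pow_le_pow_left₀ (by norm_num) hX2 193
      _ = X ^ 200 := by rw [← pow_add]
  have hN' : 20000 * ((Fintype.card S : ℝ) ^ 2 * Fintype.card A * (H : ℝ) ^ 3 * (100 * L) ^ 3)
      ≤ N * ε ^ 2 := by
    rw [mul_div_assoc', div_le_iff₀ (by positivity)] at hN
    rw [hL]
    nlinarith
  refine le_trans ?_ (RewardFree.le_successProb hρ hH hP (1 / 100) 5 (100 * L) ε hTpos N
    Fintype.card_pos (show 1 ≤ L by linarith) fun E D hE hD =>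
      RewardFree.succeeds_of_good hρ hH hP hL3 rfl hSA hε hεH.le rfl hT1 hTL E hE D hD hN')
  have hfail : 4 * (((T : ℝ) + 1) ^ 2 + 1)
      * ((Fintype.card S : ℝ) ^ 2 * Fintype.card A * H) ≤ δ * X ^ 200 := by
    have h1 : 4 * (((T : ℝ) + 1) ^ 2 + 1) ≤ 2 ^ 184 * X ^ 14 := by
      have h2 : ((T : ℝ) + 1) ^ 2 ≤ (10 ^ 16 * X ^ 7) ^ 2 := pow_le_pow_left₀ (by positivity) hT2 2
      have h3 : 1 ≤ X ^ 14 := one_le_pow₀ (by linarith)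
      have e : (10 ^ 16 * X ^ 7) ^ 2 = 10 ^ 32 * X ^ 14 := by ring
      rw [e] at h2
      norm_num at h2 ⊢
      linarith
    calc _ ≤ 2 ^ 184 * X ^ 14 * (δ * X ^ 2) :=
          mul_le_mul h1 hXδ (by positivity) (by positivity)
      _ = δ * (2 ^ 184 * X ^ 16) := by ring
      _ ≤ δ * (X ^ 184 * X ^ 16) := by
          refine mul_le_mul_of_nonneg_left (mul_le_mul_of_nonneg_right ?_ (by positivity)) hδ.le
          exact pow_le_pow_left₀ (by norm_num) hX2 184
      _ = δ * X ^ 200 := by rw [← pow_add]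
  have hmul : X ^ 200 * Real.exp (-L) = 1 := by
    rw [← hexp, ← Real.exp_add]; simp
  have := mul_le_mul_of_nonneg_right hfail (Real.exp_pos (-L)).le
  rw [mul_assoc δ, hmul, mul_one] at this
  linarith
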